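/- A Reuleaux polygon is a plane convex region of constant width $w>0$ whose boundary consists of finitely many circular arcs of radius $w$; its vertices are the corner points of its boundary. A Reinhardt polygon with $n$ sides is an equilateral convex $n$-gon $P$ that can be inscribed in a Reuleaux polygon $R$ (all vertices of $P$ lie on the boundary of $R$) in such a way that every vertex of $R$ is a vertex of $P$. The segments joining vertices of $P$ at maximal distance then contain a closed star polygon on the vertices of $R$, whose interior angles, in the order in which they are visited, are $k_1\pi/n,\dots,k_\ell\pi/n$, where $[k_1,\dots,k_\ell]$ is a composition of $n$ into an odd number $\ell$ of parts. The polygon $P$ is called periodic if this composition is a composition of some divisor $m<n$ of $n$ into an odd number of parts, repeated $n/m$ times, and sporadic otherwise. Let $E_1(n)$ be the number of sporadic Reinhardt polygons with $n$ sides, where two polygons are identified if they agree up to rotations and reflections (and translation and scaling). Theorem. For all distinct odd primes $p$ and $q$, the number of sporadic Reinhardt polygons with $2pq$ sides is the product of the Fermat quotients of $p$ and $q$ with base $2$: $$E_1(2pq)=\frac{(2^{p-1}-1)(2^{q-1}-1)}{pq}.$$ -/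

import Mathlib

namespace Reinhardt

/-! The Euclidean plane is `ℂ` with its usual distance and real inner product. -/

/-- `P` is a convex polygon with exactly `n` vertices, listed counterclockwise: every vertex other
than the two end points of an edge lies strictly to the left of the line through that edge
(`(conj a * b).im` is the determinant of the pair of plane vectors `a`, `b`). -/
def IsConvexPolygon {n : ℕ} (P : Polygon ℂ n) : Prop :=
  3 ≤ n ∧ ∀ i j : Fin n, j ≠ i → j ≠ finRotate n i →
    0 < ((starRingEnd ℂ) (P (finRotate n i) - P i) * (P j - P i)).im

/-- All sides of `P` have the same length. -/
def IsEquilateral {n : ℕ} (P : Polygon ℂ n) : Prop :=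
  ∃ s : ℝ, ∀ i : Fin n, dist (P i) (P (finRotate n i)) = s

/-- `R` is a plane convex body of constant width `w`: the distance between the two supporting
lines of `R` orthogonal to `u` is `w`, for every unit vector `u`. -/
def HasConstantWidth (R : Set ℂ) (w : ℝ) : Prop :=
  IsCompact R ∧ Convex ℝ R ∧ R.Nonempty ∧
    ∀ u : ℂ, ‖u‖ = 1 →
      sSup ((fun x : ℂ => inner ℝ u x) '' R) - sInf ((fun x : ℂ => inner ℝ u x) '' R) = w

/-- `R` is a Reuleaux polygon of width `w`: a region of constant width `w` bounded by finitely many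
circular arcs of radius `w`, that is, one that is an intersection of finitely many closed discs of
radius `w`. -/
def IsReuleauxPolygon (R : Set ℂ) (w : ℝ) : Prop :=
  0 < w ∧ HasConstantWidth R w ∧
    ∃ C : Finset ℂ, R = ⋂ c ∈ C, Metric.closedBall c w

/-- The vertices (corners) of a plane convex body `R`: the points of `R` through which there is more
than one supporting line, i.e. at which there are two different unit outward normal vectors. -/
def corners (R : Set ℂ) : Set ℂ :=
  {x | x ∈ R ∧ ∃ u₁ u₂ : ℂ, ‖u₁‖ = 1 ∧ ‖u₂‖ = 1 ∧ u₁ ≠ u₂ ∧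
    ∀ y ∈ R, (inner ℝ u₁ y : ℝ) ≤ inner ℝ u₁ x ∧ (inner ℝ u₂ y : ℝ) ≤ inner ℝ u₂ x}

/-- A Reinhardt polygon: an equilateral convex polygon that can be inscribed in a Reuleaux polygon
`R` in such a way that every vertex of `R` is a vertex of the polygon. -/
def IsReinhardtPolygon {n : ℕ} (P : Polygon ℂ n) : Prop :=
  IsConvexPolygon P ∧ IsEquilateral P ∧
    ∃ (R : Set ℂ) (w : ℝ), IsReuleauxPolygon R w ∧
      (∀ i : Fin n, P i ∈ frontier R) ∧ corners R ⊆ Set.range P.vertices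

/-- `s` lists, in the order of traversal, the vertices of a closed star polygon contained in the
skeleton of `P`: its vertices are distinct vertices of `P`, and any two consecutive ones are joined
by a diameter of `P`, a segment between two vertices of `P` at maximal distance. -/
def IsStarPolygonIn {n ℓ : ℕ} (P : Polygon ℂ n) (s : Fin ℓ → ℂ) : Prop :=
  Function.Injective s ∧ (∀ i, s i ∈ Set.range P.vertices) ∧
    ∀ i, dist (s i) (s (finRotate ℓ i)) = Metric.diam (Set.range P.vertices)

/-- `c = [k₁, …, k_ℓ]`, a composition of `n` into an odd number of parts, is a composition
associated with the `n`-gon `P`: the interior angles of the star polygon in the skeleton of `P`, in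
the order in which they are visited, are `k₁ π / n, …, k_ℓ π / n`. -/
def HasComposition {n : ℕ} (P : Polygon ℂ n) (c : Composition n) : Prop :=
  Odd c.length ∧ ∃ s : Fin c.length → ℂ, IsStarPolygonIn P s ∧
    ∀ i : Fin c.length,
      EuclideanGeometry.angle (s i) (s (finRotate _ i)) (s (finRotate _ (finRotate _ i))) =
        (c.blocksFun (finRotate _ i) : ℝ) * Real.pi / n

/-- `c` is a composition of a proper divisor `m` of `n` into an odd number of parts, repeated
`n / m` times. -/
def IsPeriodicComposition {n : ℕ} (c : Composition n) : Prop :=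
  ∃ m : ℕ, m ∣ n ∧ m < n ∧ ∃ b : Composition m, Odd b.length ∧
    c.blocks = (List.replicate (n / m) b.blocks).flatten

/-- A periodic Reinhardt polygon. -/
def IsPeriodicReinhardt {n : ℕ} (P : Polygon ℂ n) : Prop :=
  IsReinhardtPolygon P ∧ ∃ c : Composition n, HasComposition P c ∧ IsPeriodicComposition c

/-- A sporadic Reinhardt polygon: a Reinhardt polygon that is not periodic. -/
def IsSporadicReinhardt {n : ℕ} (P : Polygon ℂ n) : Prop :=
  IsReinhardtPolygon P ∧ ¬ IsPeriodicReinhardt P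

/-- Two sporadic Reinhardt `n`-gons are equivalent if a similarity of the plane (translations,
rotations, reflections and scalings, composed) carries the vertex set of one to that of the
other. For convex polygons this says that it carries the one polygon to the other. -/
def sporadicSetoid (n : ℕ) : Setoid {P : Polygon ℂ n // IsSporadicReinhardt P} where
  r P Q := ∃ f : ℂ ≃ᵈ ℂ, f '' Set.range P.1.vertices = Set.range Q.1.vertices
  iseqv :=
    { refl := fun _ => ⟨DilationEquiv.refl ℂ, by simp⟩
      symm := by
        rintro P Q ⟨f, hf⟩
        refine ⟨f.symm, ?_⟩
        rw [← hf, Set.image_image]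
        simp
      trans := by
        rintro P Q S ⟨f, hf⟩ ⟨g, hg⟩
        refine ⟨f.trans g, ?_⟩
        rw [← hg, ← hf, Set.image_image]
        simp }

/-- `E₁(n)`: the number of sporadic Reinhardt `n`-gons, up to equivalence. -/
noncomputable def E₁ (n : ℕ) : ℕ := Nat.card (Quotient (sporadicSetoid n))

end Reinhardt

/-! Let `ζ = exp (iπ/n)`. A Reinhardt polygon with `n` sides is encoded by a word `ε : ℤ → Bool`
with `ε (t + n) = !ε t`: its edge vectors are the `l ζ ^ t` with `ε t = true`, and it closes up iff
the sum of these `ζ ^ t` over one period `2 n` vanishes.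

From word to polygon (`exists_isPath`, `isReinhardtPolygon`): antiperiodicity makes `A (j + n) - A
j` equal to `l ζ ^ j / (1 - ζ)` (`opposite`), so all these segments have one length and are the
diameters. The discs of that radius about the vertices intersect in a Reuleaux polygon whose corners
are vertices. From polygon to word (`IsReinhardtPolygon.exists_isPath`): every edge is the chord of
one boundary arc of `R`. Equal sides give equal angles `θ`. Diameters of a body of constant width
are unique in each direction, so the direction intervals of the `n` arcs and their opposites tile
the circle, and `θ = π / n`. The vertex set determines the word up to shift, and a similarity acts
on words by shifts and reflections. The composition of the star polygon is the run length encoding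
of `ε`, so a polygon is periodic iff `ε` is antiperiodic for a proper divisor of `n`
(`isPeriodicReinhardt_iff`).

For `n = 2pq`, Galois conjugation of the closing condition kills the Fourier coefficients of the
signs of `ε` at all units modulo `4pq`. This forces a vanishing mixed difference with steps `4p` and
`4q` (`mixed_difference_eq_zero`), whence each of the two subwords on a residue class modulo `2` is
antiperiodic with antiperiod `p` or `q` (`half_dichotomy`). Sporadic words are those with one
subword of each type, neither alternating: there are `2 (2 ^ p - 2) (2 ^ q - 2)`. The `8pq` shifts
and reflections act freely on them (`dvd_of_shift`, `not_reflect`, `card_words`), and division gives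
the formula. -/

namespace Reinhardt

open Complex

/-! ### Unit vectors and powers of `exp (iπ/n)`. -/

/-- The unit vector with argument `x`. -/
noncomputable def cis (x : ℝ) : ℂ := Complex.exp (x * I)

theorem cis_add (x y : ℝ) : cis (x + y) = cis x * cis y := by
  simp [cis, add_mul, Complex.exp_add]

@[simp] theorem cis_zero : cis 0 = 1 := by simp [cis]

@[simp] theorem cis_pi : cis Real.pi = -1 := by simp [cis]

@[simp] theorem norm_cis (x : ℝ) : ‖cis x‖ = 1 := by simp [cis, Complex.norm_exp_ofReal_mul_I]

@[simp] theorem cis_ne_zero (x : ℝ) : cis x ≠ 0 := Complex.exp_ne_zero _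

@[simp] theorem cis_re (x : ℝ) : (cis x).re = Real.cos x := by
  simp [cis, Complex.exp_ofReal_mul_I_re]

@[simp] theorem cis_im (x : ℝ) : (cis x).im = Real.sin x := by
  simp [cis, Complex.exp_ofReal_mul_I_im]

theorem conj_cis (x : ℝ) : (starRingEnd ℂ) (cis x) = cis (-x) := by
  apply Complex.ext <;> simp

theorem cis_neg_mul (x : ℝ) : cis (-x) * cis x = 1 := by rw [← cis_add]; simp

theorem cis_mul_neg (x : ℝ) : cis x * cis (-x) = 1 := by rw [← cis_add]; simp

theorem cis_add_pi (x : ℝ) : cis (x + Real.pi) = -cis x := by rw [cis_add]; simp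

theorem norm_mul_cis_arg (z : ℂ) : (‖z‖ : ℂ) * cis (Complex.arg z) = z :=
  Complex.norm_mul_exp_arg_mul_I z

theorem inner_eq_re (u z : ℂ) : inner ℝ u z = ((starRingEnd ℂ) u * z).re := by
  simp [Complex.inner, mul_comm]

theorem inner_mul_mul (a u z : ℂ) : inner ℝ (a * u) (a * z) = ‖a‖ ^ 2 * inner ℝ u z := by
  rw [inner_eq_re, inner_eq_re, ← Complex.normSq_eq_norm_sq, Complex.normSq_apply]
  simp
  ring

/-- The unit vector with argument `t π / n`. -/
noncomputable def dir (n : ℕ) (t : ℤ) : ℂ := cis (t * Real.pi / n)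

theorem dir_add (n : ℕ) (s t : ℤ) : dir n (s + t) = dir n s * dir n t := by
  rw [dir, dir, dir, ← cis_add]; congr 1; push_cast; ring

@[simp] theorem norm_dir (n : ℕ) (t : ℤ) : ‖dir n t‖ = 1 := norm_cis _

@[simp] theorem dir_ne_zero (n : ℕ) (t : ℤ) : dir n t ≠ 0 := cis_ne_zero _

@[simp] theorem dir_zero (n : ℕ) : dir n 0 = 1 := by simp [dir]

theorem dir_self {n : ℕ} (hn : n ≠ 0) : dir n n = -1 := by
  have : (n : ℝ) ≠ 0 := by exact_mod_cast hn
  rw [dir, ← cis_pi]; congr 1; push_cast; field_simp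

theorem dir_add_self {n : ℕ} (hn : n ≠ 0) (t : ℤ) : dir n (t + n) = -dir n t := by
  rw [dir_add, dir_self hn]; ring

theorem dir_add_two_mul {n : ℕ} (hn : n ≠ 0) (t : ℤ) : dir n (t + 2 * n) = dir n t := by
  rw [two_mul, ← add_assoc, dir_add_self hn, dir_add_self hn, neg_neg]

theorem conj_dir (n : ℕ) (t : ℤ) : (starRingEnd ℂ) (dir n t) = dir n (-t) := by
  rw [dir, dir, conj_cis]; congr 1; push_cast; ring

theorem dir_one_ne_one {n : ℕ} (hn : n ≠ 0) : dir n 1 ≠ 1 := by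
  have h0 : (0 : ℝ) < n := by exact_mod_cast Nat.pos_of_ne_zero hn
  intro h
  have h1 := congrArg Complex.re h
  simp only [dir, cis_re, Complex.one_re] at h1
  have h2 := (Real.cos_eq_one_iff_of_lt_of_lt (x := ((1 : ℤ) : ℝ) * Real.pi / n) ?_ ?_).1 h1
  · have : (0 : ℝ) < ((1 : ℤ) : ℝ) * Real.pi / n := by
      have := Real.pi_pos
      push_cast; positivity
    linarith
  · have : (0 : ℝ) < ((1 : ℤ) : ℝ) * Real.pi / n := by
      have := Real.pi_pos
      push_cast; positivity
    have := Real.pi_pos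
    linarith
  · have h1 : (1 : ℝ) ≤ n := by exact_mod_cast Nat.pos_of_ne_zero hn
    push_cast
    rw [div_lt_iff₀ h0]
    nlinarith [Real.pi_pos]

theorem one_sub_dir_ne_zero {n : ℕ} (hn : n ≠ 0) : 1 - dir n 1 ≠ 0 :=
  sub_ne_zero.2 (dir_one_ne_one hn).symm

/-! ### Antiperiodic words and the closed paths they describe. -/

/-- The word `ε` changes sign under translation by `m`. -/
def IsAntiperiodic (m : ℕ) (ε : ℤ → Bool) : Prop := ∀ t, ε (t + m) = !ε t

theorem IsAntiperiodic.two_mul {m : ℕ} {ε : ℤ → Bool} (h : IsAntiperiodic m ε) (t : ℤ) :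
    ε (t + 2 * m) = ε t := by
  rw [_root_.two_mul, ← add_assoc, h, h, Bool.not_not]

/-- The vertices `A j`, each visited as often as consecutive values of `j` allow, of a polygon whose
edges are the vectors `l * dir n j` with `ε j = true`. -/
structure IsPath (n : ℕ) (ε : ℤ → Bool) (l : ℂ) (A : ℤ → ℂ) : Prop where
  step : ∀ j, A (j + 1) = A j + if ε j then l * dir n j else 0
  periodic : ∀ j, A (j + 2 * n) = A j

/-- The diameters of the polygon of a path. -/
noncomputable def diag (n : ℕ) (l : ℂ) (j : ℤ) : ℂ := l * dir n j / (1 - dir n 1)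

/-- The length of the diameters of the polygon of a path. -/
noncomputable def width (n : ℕ) (l : ℂ) : ℝ := ‖l‖ / ‖1 - dir n 1‖

theorem norm_diag (n : ℕ) (l : ℂ) (j : ℤ) : ‖diag n l j‖ = width n l := by
  simp [diag, width]

theorem width_pos {n : ℕ} (hn : n ≠ 0) {l : ℂ} (hl : l ≠ 0) : 0 < width n l :=
  div_pos (norm_pos_iff.2 hl) (norm_pos_iff.2 (one_sub_dir_ne_zero hn))

theorem diag_add_self {n : ℕ} (hn : n ≠ 0) (l : ℂ) (j : ℤ) : diag n l (j + n) = -diag n l j := by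
  rw [diag, dir_add_self hn, diag]; ring

theorem diag_sub_diag {n : ℕ} (hn : n ≠ 0) (l : ℂ) (j : ℤ) :
    diag n l j - diag n l (j + 1) = l * dir n j := by
  have := one_sub_dir_ne_zero hn
  rw [diag, diag, dir_add]; field_simp

namespace IsPath

variable {n : ℕ} {ε : ℤ → Bool} {l : ℂ} {A : ℤ → ℂ}

theorem step_true (h : IsPath n ε l A) {j : ℤ} (hj : ε j = true) :
    A (j + 1) = A j + l * dir n j := by simp [h.step, hj]

theorem step_false (h : IsPath n ε l A) {j : ℤ} (hj : ε j = false) : A (j + 1) = A j := by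
  simp [h.step, hj]

theorem step_ne_iff (h : IsPath n ε l A) (hl : l ≠ 0) (j : ℤ) : A (j + 1) ≠ A j ↔ ε j = true := by
  rcases hj : ε j <;> simp [h.step, hj, hl]

theorem add_int_mul (h : IsPath n ε l A) (j q : ℤ) : A (j + q * (2 * n)) = A j :=
  (Function.Periodic.int_mul (c := (2 * n : ℤ)) h.periodic q) j

theorem eq_of_forall_false (h : IsPath n ε l A) (a : ℤ) (d : ℕ)
    (hd : ∀ t, a ≤ t → t < a + d → ε t = false) : A (a + d) = A a := by
  induction d with
  | zero => simp
  | succ d ih =>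
    rw [Nat.cast_succ, ← add_assoc, h.step_false (hd _ (by omega) (by push_cast; omega)),
      ih fun t h1 h2 => hd t h1 (by push_cast; omega)]

/-- Exactly one of `ε j` and `ε (j + n)` is true, so `A (j + n) - A j` changes by `-l * dir n j` in
either case, exactly as `diag n l j` does. The discrepancy is therefore constant; it also changes
sign under `j ↦ j + n`, so it is zero. -/
theorem opposite (h : IsPath n ε l A) (hn : n ≠ 0) (hε : IsAntiperiodic n ε) (j : ℤ) :
    A (j + n) = A j + diag n l j := by
  set B : ℤ → ℂ := fun j => A (j + n) - A j - diag n l j with hB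
  have h1 : ∀ j, B (j + 1) = B j := by
    intro j
    have hd := diag_sub_diag hn l j
    have e1 : j + 1 + (n : ℤ) = j + n + 1 := by ring
    simp only [hB]
    rw [e1, h.step, h.step, hε, dir_add_self hn]
    rcases ε j <;> simp <;> linear_combination hd
  have h2 : ∀ j (d : ℕ), B (j + d) = B j := by
    intro j d
    induction d with
    | zero => simp
    | succ d ih => rw [Nat.cast_succ, ← add_assoc, h1, ih]
  have h3 : B (j + n) = -B j := by
    simp only [hB]
    rw [diag_add_self hn, add_assoc, ← two_mul, h.periodic]
    ring
  have h4 : B j = 0 := by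
    have := h2 j n
    rw [h3] at this
    exact self_eq_neg.1 this.symm
  simp only [hB] at h4
  linear_combination h4

theorem inner_le (h : IsPath n ε l A) (u : ℂ) (a : ℤ) (d : ℕ)
    (hu : ∀ t, a ≤ t → t < a + d → 0 ≤ (inner ℝ u (l * dir n t) : ℝ)) :
    (inner ℝ u (A a) : ℝ) ≤ inner ℝ u (A (a + d)) := by
  induction d with
  | zero => simp
  | succ d ih =>
    refine (ih fun t h1 h2 => hu t h1 (by push_cast; omega)).trans ?_
    rw [Nat.cast_succ, ← add_assoc, h.step, inner_add_right]
    have := hu (a + d) (by omega) (by push_cast; omega)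
    rcases ε (a + d)
    · simp
    · simpa only [if_true, le_add_iff_nonneg_right] using this

theorem eq_false_of_inner_le (h : IsPath n ε l A) (u : ℂ) (a : ℤ) (d : ℕ)
    (hu : ∀ t, a ≤ t → t < a + d → 0 < (inner ℝ u (l * dir n t) : ℝ))
    (hA : (inner ℝ u (A (a + d)) : ℝ) ≤ inner ℝ u (A a)) :
    ∀ t, a ≤ t → t < a + d → ε t = false := by
  intro t h1 h2
  by_contra hc
  rw [Bool.not_eq_false] at hc
  obtain ⟨i, rfl⟩ := Int.le.dest h1
  obtain ⟨k, hk⟩ := Int.le.dest (show a + i + 1 ≤ a + d by omega)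
  have e1 := h.inner_le u a i fun t h3 h4 => (hu t h3 (by omega)).le
  have e2 := h.inner_le u (a + i + 1) k fun t h3 h4 => (hu t (by omega) (by omega)).le
  rw [hk, h.step_true hc, inner_add_right] at e2
  have e3 := hu _ h1 h2
  linarith

theorem exists_nat_eq (h : IsPath n ε l A) (hn : n ≠ 0) (k a : ℤ) :
    ∃ r : ℕ, r < 2 * n ∧ A a = A (k + r) := by
  have h0 : (0 : ℤ) < 2 * n := by omega
  refine ⟨((a - k) % (2 * n)).toNat, ?_, ?_⟩
  · have := Int.emod_lt_of_pos (a - k) h0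
    have := Int.emod_nonneg (a - k) h0.ne'
    omega
  · rw [Int.toNat_of_nonneg (Int.emod_nonneg _ h0.ne')]
    conv_lhs => rw [show a = k + (a - k) % (2 * n) + (a - k) / (2 * n) * (2 * n) by
      have := Int.emod_add_mul_ediv (a - k) (2 * n); linarith]
    exact h.add_int_mul _ _

/-- The height in direction `u` does not decrease along the indices from `k` to `k + n` and does not
increase along the following half turn, whose edge vectors point the opposite way. Hence the
extremes are at `k` and `k + n`. -/
theorem inner_mem (h : IsPath n ε l A) (hn : n ≠ 0) (u : ℂ) (k : ℤ)
    (hu : ∀ t, k ≤ t → t < k + n → 0 ≤ (inner ℝ u (l * dir n t) : ℝ)) (a : ℤ) :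
    (inner ℝ u (A k) : ℝ) ≤ inner ℝ u (A a) ∧
      (inner ℝ u (A a) : ℝ) ≤ inner ℝ u (A (k + n)) := by
  have hu' : ∀ t, k + n ≤ t → t < k + 2 * n → 0 ≤ (inner ℝ (-u) (l * dir n t) : ℝ) := by
    intro t h1 h2
    have := hu (t - n) (by omega) (by omega)
    rw [show t = t - n + n by ring, dir_add_self hn]
    simpa using this
  obtain ⟨r, hr, e⟩ := h.exists_nat_eq hn k a
  rw [e]
  rcases le_or_gt r n with h1 | h1
  · refine ⟨h.inner_le u k r fun t h3 h4 => hu t h3 (by omega), ?_⟩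
    have := h.inner_le u (k + r) (n - r) fun t h3 h4 => hu t (by omega) (by omega)
    rwa [show k + r + ((n - r : ℕ) : ℤ) = k + n by omega] at this
  · have e1 := h.inner_le (-u) (k + n) (r - n) fun t h3 h4 => hu' t (by omega) (by omega)
    have e2 := h.inner_le (-u) (k + r) (2 * n - r) fun t h3 h4 => hu' t (by omega) (by omega)
    rw [show k + n + ((r - n : ℕ) : ℤ) = k + r by omega] at e1
    rw [show k + r + ((2 * n - r : ℕ) : ℤ) = k + 2 * n by omega, h.periodic] at e2
    simp only [inner_neg_left] at e1 e2
    constructor <;> linarith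

end IsPath

/-! ### Diameters of the vertex set of a path. -/

theorem inner_cis_cis (x y : ℝ) : inner ℝ (cis x) (cis y) = Real.cos (y - x) := by
  rw [inner_eq_re, conj_cis, ← cis_add, cis_re]; congr 1; ring

theorem inner_mul_cis_mul_cis (a b x y : ℝ) :
    inner ℝ ((a : ℂ) * cis x) ((b : ℂ) * cis y) = a * b * Real.cos (y - x) := by
  have h1 : (a : ℂ) * cis x = a • cis x := by simp
  have h2 : (b : ℂ) * cis y = b • cis y := by simp
  rw [h1, h2, real_inner_smul_left, real_inner_smul_right, inner_cis_cis]; ring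

theorem inner_mul_dir (u l : ℂ) (n : ℕ) (t : ℤ) :
    inner ℝ u (l * dir n t) =
      ‖u‖ * ‖l‖ * Real.cos (Complex.arg l + t * Real.pi / n - Complex.arg u) := by
  conv_lhs => rw [← norm_mul_cis_arg u, ← norm_mul_cis_arg l, mul_assoc, dir, ← cis_add]
  rw [inner_mul_cis_mul_cis]

theorem exists_half_turn {n : ℕ} (hn : n ≠ 0) (u l : ℂ) :
    ∃ k : ℤ, ∀ t, k ≤ t → t < k + n → 0 ≤ (inner ℝ u (l * dir n t) : ℝ) := by
  have h0 : (0 : ℝ) < n := by exact_mod_cast Nat.pos_of_ne_zero hn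
  have hpi := Real.pi_pos
  set x := Complex.arg u - Complex.arg l - Real.pi / 2 with hx
  -- The first index whose edge direction has argument at least that of `u` minus a right angle.
  refine ⟨⌈x * n / Real.pi⌉, fun t h1 h2 => ?_⟩
  rw [inner_mul_dir]
  refine mul_nonneg (by positivity) (Real.cos_nonneg_of_mem_Icc ?_)
  have h3 : x * n / Real.pi ≤ t := Int.ceil_le.1 h1
  have h4 : (t : ℝ) < x * n / Real.pi + n := by
    have h5 := Int.ceil_lt_add_one (x * n / Real.pi)
    have h6 : (t : ℝ) + 1 ≤ ⌈x * n / Real.pi⌉ + n := by exact_mod_cast h2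
    linarith
  have h7 : x ≤ t * Real.pi / n := by
    rw [le_div_iff₀ h0]; rwa [div_le_iff₀ hpi] at h3
  have h8 : t * Real.pi / n ≤ x + Real.pi := by
    rw [div_le_iff₀ h0]
    have : x * n / Real.pi * Real.pi = x * n := by field_simp
    nlinarith
  constructor <;> linarith

namespace IsPath

variable {n : ℕ} {ε : ℤ → Bool} {l : ℂ} {A : ℤ → ℂ}

/-- Put `u = A a - A b` and let `k` start the half turn on which edges do not descend along `u`.
Then `‖u‖ ^ 2` is at most the inner product of `u` with `A (k + n) - A k = diag n l k`, and
Cauchy–Schwarz gives the bound. Equality forces `u = diag n l k`. -/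
theorem norm_sub_le_and_exists (h : IsPath n ε l A) (hn : n ≠ 0) (hε : IsAntiperiodic n ε)
    (a b : ℤ) : ‖A a - A b‖ ≤ width n l ∧
      (‖A a - A b‖ = width n l → ∃ j, A a - A b = diag n l j) := by
  obtain ⟨k, hk⟩ := exists_half_turn hn (A a - A b) l
  set u := A a - A b with hu
  have h1 : ‖u‖ ^ 2 ≤ inner ℝ u (diag n l k) := by
    rw [← real_inner_self_eq_norm_sq]
    conv_lhs => rw [hu, inner_sub_right]
    have e1 := (h.inner_mem hn u k hk a).2
    have e2 := (h.inner_mem hn u k hk b).1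
    rw [h.opposite hn hε, inner_add_right] at e1
    linarith
  have h2 := real_inner_le_norm u (diag n l k)
  rw [norm_diag] at h2
  have h3 : 0 ≤ width n l := by unfold width; positivity
  refine ⟨?_, fun he => ⟨k, ?_⟩⟩
  · rcases (norm_nonneg u).eq_or_lt with h0 | h0
    · rwa [← h0]
    · nlinarith
  · have h4 : inner ℝ u (diag n l k) = ‖u‖ * ‖diag n l k‖ := by
      rw [norm_diag]
      apply le_antisymm h2
      rw [← he] at *
      nlinarith
    have h5 := inner_eq_norm_mul_iff_real.1 h4
    rw [norm_diag, he] at h5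
    rcases h3.eq_or_lt with h0 | h0
    · rw [← h0, norm_eq_zero] at he
      have h6 := norm_diag n l k
      rw [← h0, norm_eq_zero] at h6
      rw [he, h6]
    · exact smul_right_injective ℂ h0.ne' h5

theorem norm_sub_le (h : IsPath n ε l A) (hn : n ≠ 0) (hε : IsAntiperiodic n ε) (a b : ℤ) :
    ‖A a - A b‖ ≤ width n l := (h.norm_sub_le_and_exists hn hε a b).1

/-- The vectors `A a - A j` and `A (j + n) - A b` have norm at most that of `diag n l j` and add up
to twice it, so each of them equals it. Thus a diameter is determined by its direction. -/
theorem eq_of_sub_eq_diag (h : IsPath n ε l A) (hn : n ≠ 0) (hε : IsAntiperiodic n ε)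
    {a b j : ℤ} (hab : A a - A b = diag n l j) : A a = A (j + n) ∧ A b = A j := by
  have key : ∀ z : ℂ, ‖z‖ ≤ width n l →
      inner ℝ (diag n l j) z ≤ width n l ^ 2 ∧
      (inner ℝ (diag n l j) z = width n l ^ 2 → z = diag n l j) := by
    intro z hz
    have h1 := real_inner_le_norm (diag n l j) z
    rw [norm_diag] at h1
    have h3 : 0 ≤ width n l := by unfold width; positivity
    refine ⟨by nlinarith [norm_nonneg z], fun he => ?_⟩
    have h4 : ‖z - diag n l j‖ ^ 2 ≤ 0 := by
      rw [norm_sub_sq_real, real_inner_comm, he, norm_diag]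
      nlinarith [norm_nonneg z]
    have h5 : ‖z - diag n l j‖ = 0 := by
      have := norm_nonneg (z - diag n l j)
      nlinarith
    exact sub_eq_zero.1 (norm_eq_zero.1 h5)
  have h1 := key _ (h.norm_sub_le hn hε a j)
  have h2 := key _ (h.norm_sub_le hn hε (j + n) b)
  have h3 : inner ℝ (diag n l j) (A a - A j) + inner ℝ (diag n l j) (A (j + n) - A b) =
      2 * width n l ^ 2 := by
    rw [← inner_add_right, h.opposite hn hε,
      show A a - A j + (A j + diag n l j - A b) = (2 : ℝ) • diag n l j by
        rw [Complex.real_smul]; push_cast; linear_combination hab,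
      real_inner_smul_right, real_inner_self_eq_norm_sq, norm_diag]
  have e1 := h1.2 (by linarith [h1.1, h2.1])
  constructor
  · rw [h.opposite hn hε]; linear_combination e1
  · linear_combination e1 - hab

theorem exists_of_norm_sub_eq (h : IsPath n ε l A) (hn : n ≠ 0) (hε : IsAntiperiodic n ε)
    {a b : ℤ} (hab : ‖A a - A b‖ = width n l) : ∃ j, A a = A (j + n) ∧ A b = A j := by
  obtain ⟨j, hj⟩ := (h.norm_sub_le_and_exists hn hε a b).2 hab
  exact ⟨j, h.eq_of_sub_eq_diag hn hε hj⟩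

theorem finite_range (h : IsPath n ε l A) (hn : n ≠ 0) : (Set.range A).Finite := by
  refine ((Set.finite_lt_nat (2 * n)).image fun r : ℕ => A (0 + r)).subset ?_
  rintro _ ⟨a, rfl⟩
  obtain ⟨r, hr, e⟩ := h.exists_nat_eq hn 0 a
  exact ⟨r, hr, e.symm⟩

theorem diam_range (h : IsPath n ε l A) (hn : n ≠ 0) (hε : IsAntiperiodic n ε) :
    Metric.diam (Set.range A) = width n l := by
  apply le_antisymm
  · refine Metric.diam_le_of_forall_dist_le (by unfold width; positivity) ?_
    rintro _ ⟨a, rfl⟩ _ ⟨b, rfl⟩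
    rw [dist_eq_norm]
    exact h.norm_sub_le hn hε a b
  · have := Metric.dist_le_diam_of_mem (h.finite_range hn).isBounded
      (Set.mem_range_self (0 + (n : ℤ))) (Set.mem_range_self 0)
    rwa [dist_eq_norm, h.opposite hn hε, add_sub_cancel_left, norm_diag] at this

/-- One common diameter aligns the directions of the two paths up to a shift `r`. A diameter has
unique end points for its direction, so `A' j = A (j + r)`, and the word is read off from where the
path moves. -/
theorem exists_shift_of_range_eq (h : IsPath n ε l A) (hn : n ≠ 0) (hε : IsAntiperiodic n ε)
    {ε' : ℤ → Bool} {l' : ℂ} {A' : ℤ → ℂ} (h' : IsPath n ε' l' A') (hε' : IsAntiperiodic n ε')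
    (hl : l ≠ 0) (hl' : l' ≠ 0) (hr : Set.range A = Set.range A') :
    ∃ r : ℤ, ∀ j, ε' j = ε (j + r) := by
  have hw : width n l = width n l' := by
    rw [← h.diam_range hn hε, hr, h'.diam_range hn hε']
  have hmem : ∀ j, ∃ a, A a = A' j := fun j => by
    have : A' j ∈ Set.range A := hr ▸ Set.mem_range_self j
    exact this
  choose f hf using hmem
  obtain ⟨r, hr'⟩ := (h.norm_sub_le_and_exists hn hε (f (0 + n)) (f 0)).2 (by
    rw [hf, hf, h'.opposite hn hε', add_sub_cancel_left, norm_diag, hw])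
  have hd : ∀ j, diag n l' j = diag n l (j + r) := by
    intro j
    rw [hf, hf, h'.opposite hn hε', add_sub_cancel_left] at hr'
    have e1 : diag n l' j = diag n l' 0 * dir n j := by simp [diag]; ring
    rw [e1, hr', diag, diag, dir_add]; ring
  have hA : ∀ j, A' j = A (j + r) := by
    intro j
    have := (h.eq_of_sub_eq_diag hn hε (a := f (j + n)) (b := f j) (j := j + r) (by
      rw [hf, hf, h'.opposite hn hε', add_sub_cancel_left, hd])).2
    rw [← hf, this]
  refine ⟨r, fun j => ?_⟩
  have e1 := h.step_ne_iff hl (j + r)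
  have e2 := h'.step_ne_iff hl' j
  rw [hA, hA, show j + 1 + r = j + r + 1 by ring, e1] at e2
  rcases h1 : ε' j <;> rcases h2 : ε (j + r) <;> simp_all

theorem image_affine (h : IsPath n ε l A) (a b : ℂ) :
    IsPath n ε (a * l) fun j => a * A j + b := by
  refine ⟨fun j => ?_, fun j => by simp only [h.periodic]⟩
  rw [h.step]; split_ifs <;> ring

/-- Conjugation reverses the orientation, so the vertices are visited backwards. The edge between `A
(-(j + 1))` and `A (-j)` has index `-1 - j`. -/
theorem image_conj (h : IsPath n ε l A) :
    IsPath n (fun j => ε (-1 - j)) (-((starRingEnd ℂ) l * dir n 1))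
      fun j => (starRingEnd ℂ) (A (-j)) := by
  refine ⟨fun j => ?_, fun j => ?_⟩
  · have := h.step (-1 - j)
    rw [show -1 - j + 1 = -j by ring] at this
    rw [show -(j + 1) = -1 - j by ring, this]
    split_ifs
    · simp only [map_add, map_mul, conj_dir, mul_assoc, neg_mul, ← dir_add,
        show 1 + j = -(-1 - j) by ring]
      ring
    · simp
  · have := h.periodic (-(j + 2 * n))
    rw [← this]; congr 2; ring

theorem shift (h : IsPath n ε l A) (r : ℤ) :
    IsPath n (fun j => ε (j + r)) (l * dir n r) fun j => A (j + r) := by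
  refine ⟨fun j => ?_, fun j => ?_⟩
  · rw [show j + 1 + r = j + r + 1 by ring, h.step, dir_add]; simp only [mul_assoc, mul_comm]
  · rw [← h.periodic (j + r)]; congr 1; ring

theorem eq_affine (h : IsPath n ε l A) {l' : ℂ} {A' : ℤ → ℂ} (h' : IsPath n ε l' A')
    (hl : l ≠ 0) (j : ℤ) : A' j = l' / l * A j + (A' 0 - l' / l * A 0) := by
  have hs : ∀ j, A' (j + 1) - l' / l * A (j + 1) = A' j - l' / l * A j := by
    intro j
    rw [h.step, h'.step]
    split_ifs
    · field_simp; ring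
    · ring
  have : A' j - l' / l * A j = A' 0 - l' / l * A 0 := by
    induction j using Int.induction_on with
    | zero => rfl
    | succ i ih => rw [hs, ih]
    | pred i ih => rw [← hs, sub_add_cancel, ih]
  linear_combination this

end IsPath

/-! ### The closing condition. -/

theorem sum_range_add_of_periodic {M : Type*} [AddCommGroup M] {F : ℤ → M} {N : ℕ}
    (hF : ∀ j, F (j + N) = F j) (j : ℤ) :
    ∑ e ∈ Finset.range N, F (j + e) = ∑ e ∈ Finset.range N, F e := by
  have hs : ∀ j : ℤ, ∑ e ∈ Finset.range N, F (j + 1 + e) = ∑ e ∈ Finset.range N, F (j + e) := by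
    intro j
    have h1 := Finset.sum_range_succ (fun e : ℕ => F (j + e)) N
    have h2 := Finset.sum_range_succ' (fun e : ℕ => F (j + e)) N
    rw [h1, hF] at h2
    simp only [Nat.cast_zero, add_zero] at h2
    rw [add_right_cancel h2]
    refine Finset.sum_congr rfl fun e _ => ?_
    congr 1; push_cast; ring
  induction j using Int.induction_on with
  | zero => simp
  | succ i ih => rw [hs, ih]
  | pred i ih => rw [← hs, sub_add_cancel, ih]

theorem exists_isPath {n : ℕ} (hn : n ≠ 0) {ε : ℤ → Bool} (hε : IsAntiperiodic n ε) (l : ℂ)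
    (h0 : ∑ t ∈ Finset.range (2 * n), (if ε t then l * dir n t else 0) = 0) :
    ∃ A, IsPath n ε l A := by
  set y : ℤ → ℂ := fun t => if ε t then l * dir n t else 0 with hy
  have hper : ∀ j, y (j + (2 * n : ℕ)) = y j := by
    intro j
    simp only [hy, Nat.cast_mul, Nat.cast_ofNat, hε.two_mul, dir_add_two_mul hn]
  have hN : ((2 * n : ℕ) : ℂ) ≠ 0 := by exact_mod_cast (by omega : 2 * n ≠ 0)
  set N := 2 * n with hNdef
  have hW : ∀ j : ℤ, ∑ e ∈ Finset.range N, y (j - 1 - e) = 0 := by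
    intro j
    rw [← Finset.sum_range_reflect, ← h0, ← sum_range_add_of_periodic hper (j - N)]
    refine Finset.sum_congr rfl fun e he => ?_
    have := Finset.mem_range.1 he
    congr 1
    omega
  -- A weighted sum of the last `N` steps replaces the partial sums from `0`: it makes sense for
  -- negative `j`, inherits its period from `y`, and raising `j` by one adds `y j` minus the mean of
  -- `y` over a period, which is zero.
  refine ⟨fun j => (N : ℂ)⁻¹ * ∑ e ∈ Finset.range N, ((N : ℂ) - e) * y (j - 1 - e), ?_, ?_⟩
  · intro j
    have h1 := Finset.sum_range_succ (fun e : ℕ => ((N : ℂ) - e) * y (j - e)) N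
    have h2 := Finset.sum_range_succ' (fun e : ℕ => ((N : ℂ) - e) * y (j - e)) N
    rw [h1] at h2
    have h3 : ∑ e ∈ Finset.range N, ((N : ℂ) - (e + 1 : ℕ)) * y (j - (e + 1 : ℕ)) =
        ∑ e ∈ Finset.range N, ((N : ℂ) - e) * y (j - 1 - e) -
          ∑ e ∈ Finset.range N, y (j - 1 - e) := by
      rw [← Finset.sum_sub_distrib]
      refine Finset.sum_congr rfl fun e _ => ?_
      rw [show j - ((e + 1 : ℕ) : ℤ) = j - 1 - e by push_cast; ring]
      push_cast; ring
    rw [h3, hW] at h2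
    simp only [sub_self, zero_mul, add_zero, sub_zero, Nat.cast_zero] at h2
    simp only [add_sub_cancel_right]
    rw [h2, mul_add, inv_mul_cancel_left₀ hN]
  · intro j
    congr 1
    refine Finset.sum_congr rfl fun e _ => ?_
    rw [← hper (j - 1 - e)]
    congr 2
    omega

theorem IsPath.sum_eq_zero {n : ℕ} {ε : ℤ → Bool} {l : ℂ} {A : ℤ → ℂ} (h : IsPath n ε l A) :
    ∑ t ∈ Finset.range (2 * n), (if ε t then l * dir n t else 0) = 0 := by
  have h1 : ∀ N : ℕ, ∑ t ∈ Finset.range N, (if ε t then l * dir n t else 0) = A N - A 0 := by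
    intro N
    induction N with
    | zero => simp
    | succ N ih => rw [Finset.sum_range_succ, ih, Nat.cast_succ, h.step]; ring
  rw [h1, sub_eq_zero, ← h.periodic 0]
  congr 1; push_cast; ring

/-! ### Coincidence of vertices and convexity. -/

namespace IsPath

variable {n : ℕ} {ε : ℤ → Bool} {l : ℂ} {A : ℤ → ℂ}

theorem inner_mul_dir_mul_dir (l : ℂ) (n : ℕ) (x : ℝ) (t : ℤ) :
    inner ℝ (l * cis x) (l * dir n t) = ‖l‖ ^ 2 * Real.cos (t * Real.pi / n - x) := by
  rw [inner_mul_mul, dir, inner_cis_cis]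

/-- At most `n` consecutive edge directions lie in an open half plane around their middle direction.
Any edge among them would strictly increase the height in that direction. -/
theorem forall_false_of_eq (h : IsPath n ε l A) (hl : l ≠ 0) {a : ℤ} {d : ℕ} (hd : d ≤ n)
    (hA : A (a + d) = A a) : ∀ t, a ≤ t → t < a + d → ε t = false := by
  refine h.eq_false_of_inner_le (l * cis ((a + ((d : ℝ) - 1) / 2) * Real.pi / n)) a d ?_
    (by rw [hA])
  intro t h1 h2
  rw [inner_mul_dir_mul_dir]
  have h0 : (0 : ℝ) < n := by
    have : 0 < n := by omega
    exact_mod_cast this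
  have hpi := Real.pi_pos
  have hl' := norm_pos_iff.2 hl
  refine mul_pos (by positivity) (Real.cos_pos_of_mem_Ioo ?_)
  rw [← sub_div, ← sub_mul]
  have h3 : (a : ℝ) ≤ t := by exact_mod_cast h1
  have h4 : (t : ℝ) + 1 ≤ a + d := by exact_mod_cast h2
  have h5 : (d : ℝ) ≤ n := by exact_mod_cast hd
  constructor
  · rw [lt_div_iff₀ h0]; nlinarith
  · rw [div_lt_iff₀ h0]; nlinarith

theorem forall_false_or_forall_false (h : IsPath n ε l A) (hl : l ≠ 0) {a : ℤ} {d : ℕ}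
    (hd : d ≤ 2 * n) (hA : A (a + d) = A a) :
    (∀ t, a ≤ t → t < a + d → ε t = false) ∨
      (∀ t, a + d ≤ t → t < a + 2 * n → ε t = false) := by
  rcases le_total d n with h1 | h1
  · exact Or.inl (h.forall_false_of_eq hl h1 hA)
  · refine Or.inr ?_
    have e : a + d + ((2 * n - d : ℕ) : ℤ) = a + 2 * n := by omega
    have := h.forall_false_of_eq hl (a := a + d) (d := 2 * n - d) (by omega)
      (by rw [e, h.periodic, hA])
    rwa [e] at this

/-- Measure heights along the left normal `u` of the direction of index `a`. They agree at `a` and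
`a + 1`, every edge of index between `a + 1` and `a + n - 1` raises them, and every edge of the
opposite indices lowers them. A vertex that is no higher than `A a` can be joined to `A (a + 1)` or
to `A a` without meeting such an edge. -/
theorem eq_or_eq_of_inner_le (h : IsPath n ε l A) (hn : n ≠ 0) (hl : l ≠ 0) {a b : ℤ}
    (hb : ((starRingEnd ℂ) (l * dir n a) * (A b - A a)).im ≤ 0) :
    A b = A a ∨ A b = A (a + 1) := by
  set u := l * cis (a * Real.pi / n + Real.pi / 2) with hu
  have hu2 : u = I * (l * dir n a) := by
    rw [hu, cis_add, dir]
    have : cis (Real.pi / 2) = I := by apply Complex.ext <;> simp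
    rw [this]; ring
  have hin : ∀ z, inner ℝ u z = ((starRingEnd ℂ) (l * dir n a) * z).im := by
    intro z
    rw [hu2, inner_eq_re]; simp; ring
  have h0 : (0 : ℝ) < n := by exact_mod_cast Nat.pos_of_ne_zero hn
  have hg : ∀ t : ℤ, inner ℝ u (l * dir n t) = ‖l‖ ^ 2 * Real.sin ((t - a) * Real.pi / n) := by
    intro t
    rw [hu, inner_mul_dir_mul_dir, ← Real.cos_sub_pi_div_two]
    congr 2; ring
  have hl' := norm_pos_iff.2 hl
  have hpi := Real.pi_pos
  have hpos : ∀ t, a + 1 ≤ t → t < a + n → 0 < (inner ℝ u (l * dir n t) : ℝ) := by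
    intro t h1 h2
    rw [hg]
    have h1' : (a : ℝ) + 1 ≤ t := by exact_mod_cast h1
    have h2' : (t : ℝ) < a + n := by exact_mod_cast h2
    refine mul_pos (by positivity) (Real.sin_pos_of_pos_of_lt_pi ?_ ?_)
    · apply div_pos _ h0; nlinarith
    · rw [div_lt_iff₀ h0]; nlinarith
  have hzero : (inner ℝ u (A (a + 1)) : ℝ) = inner ℝ u (A a) := by
    rw [h.step, inner_add_right]
    split_ifs
    · rw [hg]; simp
    · simp
  rw [← hin, inner_sub_right, sub_nonpos] at hb
  obtain ⟨r, hr, e⟩ := h.exists_nat_eq hn a b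
  rw [e] at hb ⊢
  rcases Nat.eq_zero_or_pos r with h1 | h1
  · left; simp [h1]
  rcases le_or_gt r n with h2 | h2
  · right
    have e1 : a + (r : ℤ) = a + 1 + ((r - 1 : ℕ) : ℤ) := by omega
    rw [e1] at hb ⊢
    apply h.eq_of_forall_false
    exact h.eq_false_of_inner_le u _ _ (fun t h3 h4 => hpos t h3 (by omega)) (by rw [hzero]; exact hb)
  · left
    have e1 : a + r + ((2 * n - r : ℕ) : ℤ) = a + 2 * n := by omega
    rw [← h.periodic a, ← e1]
    symm
    apply h.eq_of_forall_false
    refine h.eq_false_of_inner_le (-u) _ _ (fun t h3 h4 => ?_) ?_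
    · have := hpos (t - n) (by omega) (by omega)
      rw [show t = t - n + n by ring, dir_add_self hn]
      simpa using this
    · rw [e1, h.periodic, inner_neg_left, inner_neg_left]; exact neg_le_neg hb

end IsPath

/-! ### Enumeration of the edges, and the polygon of a path. -/

section Nth

variable {n : ℕ} {ε : ℤ → Bool}

/-- The position of the `k`-th nonnegative letter `true` of the word `ε`. -/
noncomputable def pos (ε : ℤ → Bool) (k : ℕ) : ℕ := Nat.nth (fun i : ℕ => ε i = true) k

theorem infinite_setOf_true (hε : IsAntiperiodic n ε) :
    {i : ℕ | ε i = true}.Infinite := by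
  rw [Set.infinite_iff_exists_gt]
  intro a
  rcases h : ε (a + 1 : ℕ) with _ | _
  · refine ⟨a + 1 + n, ?_, by omega⟩
    have := hε (a + 1 : ℕ)
    rw [h] at this
    rw [Set.mem_ofPred_eq, Nat.cast_add, this, Bool.not_false]
  · exact ⟨a + 1, h, by omega⟩

/-- By antiperiodicity, the true letters in the second half of a period correspond to the false
letters in the first half. -/
theorem count_true_two_mul (hε : IsAntiperiodic n ε) :
    Nat.count (fun i : ℕ => ε i = true) (2 * n) = n := by
  have h1 : ∀ m, Nat.count (fun i : ℕ => ε i = true) m +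
      Nat.count (fun i : ℕ => ¬ ε i = true) m = m := by
    intro m
    induction m with
    | zero => simp
    | succ m ih =>
      rw [Nat.count_succ, Nat.count_succ]
      split_ifs <;> omega
  rw [two_mul, Nat.count_add]
  have : (fun k : ℕ => ε ((n + k : ℕ) : ℤ) = true) = fun i : ℕ => ¬ ε i = true := by
    funext k
    have := hε k
    rw [add_comm] at this
    simp [this]
  simp only [this]
  exact h1 n

theorem eps_pos (hε : IsAntiperiodic n ε) (k : ℕ) : ε (pos ε k) = true :=
  Nat.nth_mem_of_infinite (infinite_setOf_true hε) k

theorem pos_strictMono (hε : IsAntiperiodic n ε) :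
    StrictMono (pos ε) := Nat.nth_strictMono (infinite_setOf_true hε)

theorem pos_add (hε : IsAntiperiodic n ε) (k : ℕ) : pos ε (k + n) = pos ε k + 2 * n := by
  have h1 : ε ((pos ε k + 2 * n : ℕ) : ℤ) = true := by
    have := hε.two_mul (pos ε k)
    rw [eps_pos hε] at this
    simpa using this
  have h2 := Nat.nth_count (p := fun i : ℕ => ε i = true) h1
  rw [add_comm, Nat.count_add, count_true_two_mul hε] at h2
  have : (fun i : ℕ => ε ((2 * n + i : ℕ) : ℤ) = true) = fun i : ℕ => ε i = true := by
    funext i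
    have := hε.two_mul i
    rw [add_comm] at this
    simp [this]
  simp only [this] at h2
  rw [pos, Nat.count_nth_of_infinite (infinite_setOf_true hε), add_comm] at h2
  rw [pos, h2, pos, add_comm]

theorem IsPath.apply_pos_count {l : ℂ} {A : ℤ → ℂ} (h : IsPath n ε l A)
    (hε : IsAntiperiodic n ε) (j : ℕ) :
    A (pos ε (Nat.count (fun i : ℕ => ε i = true) j)) = A j := by
  have h1 : j ≤ pos ε (Nat.count (fun i : ℕ => ε i = true) j) :=
    Nat.le_nth_count (infinite_setOf_true hε) j
  obtain ⟨d, hd⟩ := Nat.exists_eq_add_of_le h1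
  rw [hd, Nat.cast_add]
  refine h.eq_of_forall_false _ _ fun t h2 h3 => ?_
  by_contra hc
  rw [Bool.not_eq_false] at hc
  lift t to ℕ using by omega
  have h4 : t < pos ε (Nat.count (fun i : ℕ => ε i = true) j) := by omega
  have h5 := Nat.nth_count (p := fun i : ℕ => ε i = true) hc
  rw [← h5] at h4
  have h6 := (pos_strictMono hε).lt_iff_lt.1 h4
  have h7 := Nat.count_monotone (fun i : ℕ => ε i = true) (show j ≤ t by omega)
  omega

theorem IsPath.apply_pos_succ {l : ℂ} {A : ℤ → ℂ} (h : IsPath n ε l A)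
    (hε : IsAntiperiodic n ε) (k : ℕ) :
    A (pos ε (k + 1)) = A (pos ε k + 1) := by
  have h1 : Nat.count (fun i : ℕ => ε i = true) (pos ε k + 1) = k + 1 := by
    rw [Nat.count_succ, if_pos (eps_pos hε k), pos,
      Nat.count_nth_of_infinite (infinite_setOf_true hε)]
  have := h.apply_pos_count hε (pos ε k + 1)
  rw [h1] at this
  rw [this]; push_cast; rfl

end Nth

theorem coe_finRotate_eq_mod {n : ℕ} (i : Fin n) : (finRotate n i : ℕ) = (i + 1) % n := by
  cases n with
  | zero => exact i.elim0
  | succ m =>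
    rw [coe_finRotate]
    split_ifs with h
    · simp [h]
    · have h1 := Fin.val_lt_last h
      rw [Nat.mod_eq_of_lt (by omega)]

theorem apply_mod_of_periodic {α : Type*} {f : ℕ → α} {n : ℕ} (hf : ∀ k, f (k + n) = f k) (k : ℕ) :
    f (k % n) = f k :=
  Function.Periodic.map_mod_nat hf k

/-- The polygon of a path. -/
noncomputable def pathPolygon (n : ℕ) (ε : ℤ → Bool) (A : ℤ → ℂ) : Polygon ℂ n :=
  ⟨fun k => A (pos ε k)⟩

namespace IsPath

variable {n : ℕ} {ε : ℤ → Bool} {l : ℂ} {A : ℤ → ℂ}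

theorem apply_pos_add (h : IsPath n ε l A) (hε : IsAntiperiodic n ε) (k : ℕ) :
    A (pos ε (k + n)) = A (pos ε k) := by
  rw [pos_add hε, ← h.periodic (pos ε k)]; push_cast; rfl

theorem pathPolygon_finRotate (h : IsPath n ε l A) (hε : IsAntiperiodic n ε)
    (k : Fin n) : pathPolygon n ε A (finRotate n k) = A (pos ε k + 1) := by
  have := apply_mod_of_periodic (f := fun k => A (pos ε k)) (h.apply_pos_add hε) (k + 1)
  simp only [pathPolygon, coe_finRotate_eq_mod]
  rw [this, h.apply_pos_succ hε]

/-- Equal vertices would leave one of the two complementary stretches of indices without an edge,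
yet each stretch begins at a position with letter `true`. -/
theorem pathPolygon_injective (h : IsPath n ε l A) (hε : IsAntiperiodic n ε)
    (hl : l ≠ 0) : Function.Injective (pathPolygon n ε A).vertices := by
  have key : ∀ i j : Fin n, i < j → A (pos ε i) ≠ A (pos ε j) := by
    intro i j hij he
    have h1 := pos_strictMono hε hij
    have h2 := pos_strictMono hε (show (j : ℕ) < i + n by omega)
    rw [pos_add hε] at h2
    obtain ⟨d, hd⟩ := Nat.exists_eq_add_of_lt h1
    have e : ((pos ε j : ℕ) : ℤ) = pos ε i + (d + 1 : ℕ) := by rw [hd]; push_cast; ring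
    rw [e] at he
    have hi := eps_pos hε i
    have hj := eps_pos hε j
    rcases h.forall_false_or_forall_false hl (by omega) he.symm with h3 | h3
    · rw [h3 _ le_rfl (by omega)] at hi; simp at hi
    · rw [h3 _ (by omega) (by omega)] at hj; simp at hj
  intro i j hij
  rcases lt_trichotomy i j with h1 | h1 | h1
  · exact absurd hij (key i j h1)
  · exact h1
  · exact absurd hij.symm (key j i h1)

theorem range_pathPolygon (h : IsPath n ε l A) (hn : n ≠ 0) (hε : IsAntiperiodic n ε) :
    Set.range (pathPolygon n ε A).vertices = Set.range A := by
  apply Set.Subset.antisymm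
  · rintro _ ⟨k, rfl⟩
    exact ⟨_, rfl⟩
  · rintro _ ⟨a, rfl⟩
    obtain ⟨r, hr, e⟩ := h.exists_nat_eq hn 0 a
    rw [zero_add, ← h.apply_pos_count hε] at e
    have := apply_mod_of_periodic (f := fun k => A (pos ε k)) (h.apply_pos_add hε)
      (Nat.count (fun i : ℕ => ε i = true) r)
    refine ⟨⟨Nat.count (fun i : ℕ => ε i = true) r % n, Nat.mod_lt _ (Nat.pos_of_ne_zero hn)⟩, ?_⟩
    rw [e]; exact this

theorem isConvexPolygon (h : IsPath n ε l A) (hn : 3 ≤ n) (hε : IsAntiperiodic n ε)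
    (hl : l ≠ 0) : IsConvexPolygon (pathPolygon n ε A) := by
  have hn0 : n ≠ 0 := by omega
  refine ⟨hn, fun i j h1 h2 => ?_⟩
  by_contra hc
  have hinj := h.pathPolygon_injective hε hl
  have hs := h.step_true (eps_pos hε i)
  have hr := h.pathPolygon_finRotate hε i
  have e1 : pathPolygon n ε A (finRotate n i) - pathPolygon n ε A i = l * dir n (pos ε i) := by
    rw [hr, hs]; simp [pathPolygon]
  rw [e1, not_lt] at hc
  rcases h.eq_or_eq_of_inner_le hn0 hl hc with h3 | h3
  · exact h1 (hinj h3)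
  · rw [← hr] at h3; exact h2 (hinj h3)

theorem isEquilateral (h : IsPath n ε l A) (hε : IsAntiperiodic n ε) :
    IsEquilateral (pathPolygon n ε A) := by
  refine ⟨‖l‖, fun i => ?_⟩
  rw [h.pathPolygon_finRotate hε, h.step_true (eps_pos hε i), dist_comm, dist_eq_norm]
  simp [pathPolygon]

end IsPath

/-! ### The Reuleaux polygon around the polygon of a path. -/

theorem sin_mul_cis (x y : ℝ) :
    (Real.sin y : ℂ) * cis x = Real.sin (y - x) + Real.sin x * cis y := by
  apply Complex.ext
  · rw [Complex.re_ofReal_mul, Complex.add_re, Complex.ofReal_re, Complex.re_ofReal_mul]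
    simp only [cis_re, Real.sin_sub]; ring
  · rw [Complex.im_ofReal_mul, Complex.add_im, Complex.ofReal_im, Complex.im_ofReal_mul]
    simp only [cis_im]; ring

theorem diag_add (n : ℕ) (l : ℂ) (j k : ℤ) : diag n l (j + k) = diag n l j * dir n k := by
  rw [diag, diag, dir_add]; ring

theorem inner_diag_succ (n : ℕ) (l : ℂ) (j : ℤ) :
    inner ℝ (diag n l j) (diag n l (j + 1)) = width n l ^ 2 * Real.cos (Real.pi / n) := by
  rw [diag_add]
  conv_lhs => rw [← mul_one (diag n l j), mul_assoc, one_mul]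
  rw [inner_mul_mul, norm_diag, dir, ← cis_zero, inner_cis_cis]
  simp

theorem cos_pi_div_lt_one {n : ℕ} (hn : 2 ≤ n) : Real.cos (Real.pi / n) < 1 := by
  have h0 : (2 : ℝ) ≤ n := by exact_mod_cast hn
  rw [← Real.cos_zero]
  apply Real.cos_lt_cos_of_nonneg_of_le_pi le_rfl
  · rw [div_le_iff₀ (by linarith)]; nlinarith [Real.pi_pos]
  · have := Real.pi_pos; positivity

/-- Every direction lies in one of the sectors spanned by two consecutive diameters. -/
theorem exists_eq_smul_diag_add {n : ℕ} (hn : 2 ≤ n) {l : ℂ} (hl : l ≠ 0) {u : ℂ} :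
    ∃ (j : ℤ) (α β : ℝ), 0 ≤ α ∧ 0 ≤ β ∧ u = α • diag n l j + β • diag n l (j + 1) := by
  have hn0 : n ≠ 0 := by omega
  have h0 : (2 : ℝ) ≤ n := by exact_mod_cast hn
  have hpi := Real.pi_pos
  have hw := width_pos hn0 hl
  set x := Complex.arg u - Complex.arg (diag n l 0) with hx
  set j := ⌊x / (Real.pi / n)⌋ with hj
  set d := Real.pi / n with hd
  have hd0 : 0 < d := by positivity
  have hd1 : d < Real.pi := by rw [hd, div_lt_iff₀ (by linarith)]; nlinarith
  have h1 : (j : ℝ) * d ≤ x := by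
    have := Int.floor_le (x / d); rwa [le_div_iff₀ hd0] at this
  have h2 : x < (j : ℝ) * d + d := by
    have := Int.lt_floor_add_one (x / d); rw [div_lt_iff₀ hd0] at this; linarith
  have hs : 0 < Real.sin d := Real.sin_pos_of_pos_of_lt_pi hd0 hd1
  -- The coefficients are those of the sine rule `sin_mul_cis` for a direction at angle `x - j * d`
  -- inside a sector of opening `d`.
  refine ⟨j, ‖u‖ / width n l * (Real.sin (d - (x - j * d)) / Real.sin d),
    ‖u‖ / width n l * (Real.sin (x - j * d) / Real.sin d), ?_, ?_, ?_⟩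
  · have := Real.sin_nonneg_of_nonneg_of_le_pi (x := d - (x - j * d)) (by linarith) (by linarith)
    positivity
  · have := Real.sin_nonneg_of_nonneg_of_le_pi (x := x - j * d) (by linarith) (by linarith)
    positivity
  · have e0 : diag n l j = width n l * cis (Complex.arg (diag n l 0) + j * d) := by
      rw [cis_add, ← mul_assoc, ← norm_diag n l 0, norm_mul_cis_arg, ← zero_add j, diag_add,
        zero_add, dir, hd]
      congr 2; ring
    have e1 : diag n l (j + 1) = diag n l j * cis d := by
      rw [diag_add, dir, hd]; congr 2; push_cast; ring
    have e2 := sin_mul_cis (x - j * d) d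
    have e3 : u = ‖u‖ * (cis (Complex.arg (diag n l 0) + j * d) * cis (x - j * d)) := by
      rw [← cis_add]
      conv_lhs => rw [← norm_mul_cis_arg u]
      congr 2; rw [hx]; ring
    have hw' : (width n l : ℂ) ≠ 0 := by exact_mod_cast hw.ne'
    have hs' : (Real.sin d : ℂ) ≠ 0 := by exact_mod_cast hs.ne'
    rw [e1, e0, Complex.real_smul, Complex.real_smul]
    simp only [Complex.ofReal_mul, Complex.ofReal_div]
    conv_lhs => rw [e3]
    field_simp
    linear_combination (‖u‖ : ℂ) * e2

theorem inner_nonneg_of_norm_sub_le {d z : ℂ} {w : ℝ} (hd : ‖d‖ = w) (h : ‖z - d‖ ≤ w) :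
    ‖z‖ ^ 2 ≤ 2 * inner ℝ d z := by
  have h1 : ‖z - d‖ ^ 2 ≤ w ^ 2 := by gcongr
  rw [norm_sub_sq_real, hd, real_inner_comm] at h1
  linarith

theorem norm_smul_add_smul_diag_sq (n : ℕ) (l : ℂ) (j : ℤ) (α β : ℝ) :
    ‖α • diag n l j + β • diag n l (j + 1)‖ ^ 2 =
      width n l ^ 2 * ((α + β) ^ 2 - 2 * α * β * (1 - Real.cos (Real.pi / n))) := by
  rw [norm_add_sq_real, real_inner_smul_left, real_inner_smul_right, inner_diag_succ, norm_smul,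
    norm_smul, norm_diag, norm_diag, mul_pow, mul_pow, Real.norm_eq_abs, Real.norm_eq_abs, sq_abs,
    sq_abs]
  ring

/-- The intersection of the discs around the vertices of a path whose radius is the diameter. -/
def region (n : ℕ) (l : ℂ) (A : ℤ → ℂ) : Set ℂ :=
  ⋂ c ∈ Set.range A, Metric.closedBall c (width n l)

namespace IsPath

variable {n : ℕ} {ε : ℤ → Bool} {l : ℂ} {A : ℤ → ℂ}

theorem mem_region {z : ℂ} : z ∈ region n l A ↔ ∀ a, ‖z - A a‖ ≤ width n l := by
  simp [region, dist_eq_norm]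

theorem apply_mem_region (h : IsPath n ε l A) (hn : n ≠ 0) (hε : IsAntiperiodic n ε) (a : ℤ) :
    A a ∈ region n l A := mem_region.2 (h.norm_sub_le hn hε a)

theorem one_le_width_mul {u : ℂ} {j : ℤ} {α β : ℝ} (hα : 0 ≤ α) (hβ : 0 ≤ β) (hu : ‖u‖ = 1)
    (h : u = α • diag n l j + β • diag n l (j + 1)) : 1 ≤ width n l * (α + β) := by
  rw [← hu, h]
  refine (norm_add_le _ _).trans ?_
  rw [norm_smul, norm_smul, norm_diag, norm_diag, Real.norm_of_nonneg hα, Real.norm_of_nonneg hβ]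
  linarith

/-- Since `ε j = false`, the vertices `A j` and `A (j + 1)` coincide, so `A j + diag n l j` and `A j
+ diag n l (j + 1)` are both vertices. The conditions that `z` lies in the discs about them are
added with weights `α` and `β`. -/
theorem inner_add_inner_le (h : IsPath n ε l A) (hn : n ≠ 0) (hε : IsAntiperiodic n ε)
    {u z : ℂ} {j : ℤ} {α β : ℝ} (hα : 0 ≤ α) (hβ : 0 ≤ β) (hj : ε j = false)
    (h' : u = α • diag n l j + β • diag n l (j + 1)) (hz : z ∈ region n l A) :
    (α + β) * ‖z - A j‖ ^ 2 ≤ 2 * inner ℝ u (z - A j) := by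
  have h1 := mem_region.1 hz (j + n)
  have h2 := mem_region.1 hz (j + 1 + n)
  rw [h.opposite hn hε, ← sub_sub] at h1 h2
  rw [h.step_false hj] at h2
  have e1 := inner_nonneg_of_norm_sub_le (norm_diag n l j) h1
  have e2 := inner_nonneg_of_norm_sub_le (norm_diag n l (j + 1)) h2
  rw [h', inner_add_left, real_inner_smul_left, real_inner_smul_left]
  nlinarith

/-- With `v = A a - A j` and `w` the width, `‖w u - v‖ ^ 2 = w ^ 2 - 2 w ⟪u, v⟫ + ‖v‖ ^ 2`. The last
two terms are nonpositive because `2 ⟪u, v⟫ ≥ (α + β) ‖v‖ ^ 2` and `w (α + β) ≥ 1`. These points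
form the boundary arc centred at `A j`. -/
theorem add_smul_mem_region (h : IsPath n ε l A) (hn : n ≠ 0) (hε : IsAntiperiodic n ε)
    {u : ℂ} {j : ℤ} {α β : ℝ} (hα : 0 ≤ α) (hβ : 0 ≤ β) (hu : ‖u‖ = 1) (hj : ε j = false)
    (h' : u = α • diag n l j + β • diag n l (j + 1)) : A j + width n l • u ∈ region n l A := by
  rw [mem_region]
  intro a
  have h1 := h.inner_add_inner_le hn hε hα hβ hj h' (h.apply_mem_region hn hε a)
  have h2 := one_le_width_mul hα hβ hu h'
  have hw : 0 ≤ width n l := by unfold width; positivity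
  refine le_of_sq_le_sq ?_ hw
  rw [show A j + width n l • u - A a = width n l • u - (A a - A j) by ring, norm_sub_sq_real,
    norm_smul, hu, real_inner_smul_left, Real.norm_of_nonneg hw, mul_one]
  nlinarith [sq_nonneg ‖A a - A j‖]

theorem isCompact_region : IsCompact (region n l A) := by
  refine (isCompact_closedBall (A 0) (width n l)).of_isClosed_subset ?_ ?_
  · exact isClosed_biInter fun _ _ => Metric.isClosed_closedBall
  · exact Set.biInter_subset_of_mem (Set.mem_range_self 0)

/-- Opposite sectors carry opposite letters, so one of `u` and `-u` lies in a sector whose letter is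
`false`, that is, in the angle of two diameters issuing from one vertex. -/
theorem exists_sector (hn : 2 ≤ n) (hε : IsAntiperiodic n ε) (hl : l ≠ 0) (u : ℂ) :
    (∃ (j : ℤ) (α β : ℝ), 0 ≤ α ∧ 0 ≤ β ∧ ε j = false ∧
      u = α • diag n l j + β • diag n l (j + 1)) ∨
    (∃ (j : ℤ) (α β : ℝ), 0 ≤ α ∧ 0 ≤ β ∧ ε j = false ∧
      -u = α • diag n l j + β • diag n l (j + 1)) := by
  obtain ⟨j, α, β, hα, hβ, e⟩ := exists_eq_smul_diag_add hn hl (u := u)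
  have hn0 : n ≠ 0 := by omega
  rcases hj : ε j with _ | _
  · exact Or.inl ⟨j, α, β, hα, hβ, hj, e⟩
  · refine Or.inr ⟨j + n, α, β, hα, hβ, by rw [hε, hj]; rfl, ?_⟩
    rw [show j + n + 1 = j + 1 + (n : ℤ) by ring, diag_add_self hn0, diag_add_self hn0, e]
    simp; ring

theorem sector_inner_mem (h : IsPath n ε l A) (hn : n ≠ 0) (hε : IsAntiperiodic n ε)
    {u z : ℂ} {j : ℤ} {α β : ℝ} (hα : 0 ≤ α) (hβ : 0 ≤ β) (hu : ‖u‖ = 1) (hj : ε j = false)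
    (h' : u = α • diag n l j + β • diag n l (j + 1)) (hz : z ∈ region n l A) :
    (inner ℝ u (A j) : ℝ) ≤ inner ℝ u z ∧
      (inner ℝ u z : ℝ) ≤ inner ℝ u (A j + width n l • u) := by
  have h1 := h.inner_add_inner_le hn hε hα hβ hj h' hz
  have h2 := real_inner_le_norm u (z - A j)
  have h3 := mem_region.1 hz j
  rw [hu, one_mul] at h2
  rw [inner_sub_right] at h1 h2
  rw [inner_add_right, real_inner_smul_right, real_inner_self_eq_norm_sq, hu]
  have : 0 ≤ (α + β) * ‖z - A j‖ ^ 2 := by positivity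
  constructor <;> linarith

theorem exists_extremal (h : IsPath n ε l A) (hn : 2 ≤ n) (hε : IsAntiperiodic n ε) (hl : l ≠ 0)
    {u : ℂ} (hu : ‖u‖ = 1) : ∃ x ∈ region n l A, ∃ y ∈ region n l A, x - y = width n l • u ∧
      ∀ z ∈ region n l A, (inner ℝ u y : ℝ) ≤ inner ℝ u z ∧ (inner ℝ u z : ℝ) ≤ inner ℝ u x := by
  have hn0 : n ≠ 0 := by omega
  rcases exists_sector hn hε hl u with ⟨j, α, β, hα, hβ, hj, e⟩ | ⟨j, α, β, hα, hβ, hj, e⟩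
  · exact ⟨_, h.add_smul_mem_region hn0 hε hα hβ hu hj e, _, h.apply_mem_region hn0 hε j, by simp,
      fun z hz => h.sector_inner_mem hn0 hε hα hβ hu hj e hz⟩
  · have hu' : ‖-u‖ = 1 := by rwa [norm_neg]
    refine ⟨_, h.apply_mem_region hn0 hε j, _, h.add_smul_mem_region hn0 hε hα hβ hu' hj e, by simp,
      fun z hz => ?_⟩
    have := h.sector_inner_mem hn0 hε hα hβ hu' hj e hz
    rw [inner_neg_left, inner_neg_left, inner_neg_left] at this
    constructor <;> linarith

theorem hasConstantWidth_region (h : IsPath n ε l A) (hn : 2 ≤ n) (hε : IsAntiperiodic n ε)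
    (hl : l ≠ 0) : HasConstantWidth (region n l A) (width n l) := by
  refine ⟨isCompact_region, ?_, ⟨_, h.apply_mem_region (by omega) hε 0⟩, fun u hu => ?_⟩
  · exact convex_iInter₂ fun _ _ => convex_closedBall _ _
  · obtain ⟨x, hx, y, hy, e, hz⟩ := h.exists_extremal hn hε hl hu
    have h1 : IsGreatest ((fun x : ℂ => (inner ℝ u x : ℝ)) '' region n l A) (inner ℝ u x) := by
      refine ⟨⟨x, hx, rfl⟩, ?_⟩
      rintro _ ⟨z, hz', rfl⟩
      exact (hz z hz').2
    have h2 : IsLeast ((fun x : ℂ => (inner ℝ u x : ℝ)) '' region n l A) (inner ℝ u y) := by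
      refine ⟨⟨y, hy, rfl⟩, ?_⟩
      rintro _ ⟨z, hz', rfl⟩
      exact (hz z hz').1
    rw [h1.csSup_eq, h2.csInf_eq, ← inner_sub_right, e, real_inner_smul_right,
      real_inner_self_eq_norm_sq, hu]
    ring

theorem isReuleauxPolygon_region (h : IsPath n ε l A) (hn : 2 ≤ n) (hε : IsAntiperiodic n ε)
    (hl : l ≠ 0) : IsReuleauxPolygon (region n l A) (width n l) := by
  have hn0 : n ≠ 0 := by omega
  refine ⟨width_pos hn0 hl, h.hasConstantWidth_region hn hε hl, (h.finite_range hn0).toFinset, ?_⟩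
  simp [region]

theorem apply_mem_frontier (h : IsPath n ε l A) (hn : n ≠ 0) (hε : IsAntiperiodic n ε)
    (hl : l ≠ 0) (j : ℤ) : A j ∈ frontier (region n l A) := by
  rw [isCompact_region.isClosed.frontier_eq]
  refine ⟨h.apply_mem_region hn hε j, fun hi => ?_⟩
  have h1 : region n l A ⊆ Metric.closedBall (A (j + n)) (width n l) :=
    Set.biInter_subset_of_mem (Set.mem_range_self _)
  have h2 := interior_mono h1 hi
  rw [interior_closedBall _ (width_pos hn hl).ne', Metric.mem_ball, dist_eq_norm,
    h.opposite hn hε] at h2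
  simp [norm_diag] at h2

/-- At a non-vertex `x`, each outward normal `u` gives a centre `A j` with `x = A j + w u`; if
instead `-u` lies in a sector with letter `false`, then `x` is itself the vertex at its apex. Two
normals with centres `A j` and `A k` give `2 w ⟪u₁, A k - A j⟫ = ‖A k - A j‖ ^ 2`, which contradicts
`inner_add_inner_le` unless the centres agree or `w (α + β) = 1`. In the latter case `u₁` bounds its
sector and `x` is the far end of a diameter. -/
theorem corners_region_subset (h : IsPath n ε l A) (hn : 2 ≤ n) (hε : IsAntiperiodic n ε)
    (hl : l ≠ 0) : corners (region n l A) ⊆ Set.range A := by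
  have hn0 : n ≠ 0 := by omega
  have hw := width_pos hn0 hl
  rintro x ⟨hx, u₁, u₂, hu₁, hu₂, hne, hsup⟩
  by_contra hxV
  have key : ∀ u : ℂ, ‖u‖ = 1 → (∀ y ∈ region n l A, (inner ℝ u y : ℝ) ≤ inner ℝ u x) →
      ∃ (j : ℤ) (α β : ℝ), 0 ≤ α ∧ 0 ≤ β ∧ ε j = false ∧ u = α • diag n l j + β • diag n l (j + 1) ∧
        x = A j + width n l • u := by
    intro u hu hmax
    rcases exists_sector hn hε hl u with ⟨j, α, β, hα, hβ, hj, e⟩ | ⟨j, α, β, hα, hβ, hj, e⟩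
    · refine ⟨j, α, β, hα, hβ, hj, e, ?_⟩
      have h1 := hmax _ (h.add_smul_mem_region hn0 hε hα hβ hu hj e)
      rw [inner_add_right, real_inner_smul_right, real_inner_self_eq_norm_sq, hu] at h1
      have h2 : width n l ≤ inner ℝ u (x - A j) := by rw [inner_sub_right]; linarith
      have h3 := mem_region.1 hx j
      have h4 : ‖x - A j - width n l • u‖ ^ 2 ≤ 0 := by
        rw [norm_sub_sq_real, real_inner_smul_right, real_inner_comm, norm_smul, hu,
          Real.norm_of_nonneg hw.le]
        nlinarith [norm_nonneg (x - A j)]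
      have h5 : ‖x - A j - width n l • u‖ = 0 := by
        nlinarith [norm_nonneg (x - A j - width n l • u)]
      linear_combination norm_eq_zero.1 h5
    · exfalso
      apply hxV
      have hu' : ‖-u‖ = 1 := by rwa [norm_neg]
      have h1 := h.inner_add_inner_le hn0 hε hα hβ hj e hx
      have h2 := hmax _ (h.apply_mem_region hn0 hε j)
      have h3 := one_le_width_mul hα hβ hu' e
      rw [inner_neg_left, inner_sub_right] at h1
      have h4 : 0 < α + β := by
        by_contra hc
        nlinarith
      have h6 : (α + β) * ‖x - A j‖ ^ 2 ≤ 0 := by linarith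
      have h5 : ‖x - A j‖ ^ 2 ≤ 0 := nonpos_of_mul_nonpos_right h6 h4
      have h7 : ‖x - A j‖ = 0 := by nlinarith [norm_nonneg (x - A j)]
      exact ⟨j, (sub_eq_zero.1 (norm_eq_zero.1 h7)).symm⟩
  obtain ⟨j, α, β, hα, hβ, hj, e, hxj⟩ := key u₁ hu₁ fun y hy => (hsup y hy).1
  obtain ⟨k, -, -, -, -, -, -, hxk⟩ := key u₂ hu₂ fun y hy => (hsup y hy).2
  have h1 := h.inner_add_inner_le hn0 hε hα hβ hj e (h.apply_mem_region hn0 hε k)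
  have h2 : 2 * width n l * inner ℝ u₁ (A k - A j) = ‖A k - A j‖ ^ 2 := by
    have e1 : width n l • u₁ - (A k - A j) = width n l • u₂ := by
      linear_combination hxk - hxj
    have e2 : ‖width n l • u₁ - (A k - A j)‖ ^ 2 = ‖width n l • u₂‖ ^ 2 := by rw [e1]
    rw [norm_sub_sq_real, norm_smul, norm_smul, hu₁, hu₂, real_inner_smul_left] at e2
    linarith
  have h3 := one_le_width_mul hα hβ hu₁ e
  have h4 : width n l * (α + β) ≠ 1 := by
    intro h4
    have h5 := norm_smul_add_smul_diag_sq n l j α β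
    rw [← e, hu₁] at h5
    have h6 := cos_pi_div_lt_one hn
    have h7 : width n l ^ 2 * (2 * α * β * (1 - Real.cos (Real.pi / n))) = 0 := by
      linear_combination (width n l * (α + β) + 1) * h4 + h5
    have h8 : α = 0 ∨ β = 0 := by
      have : 1 - Real.cos (Real.pi / n) ≠ 0 := by linarith
      simpa [hw.ne', this] using h7
    apply hxV
    rcases h8 with rfl | rfl
    · refine ⟨j + 1 + n, ?_⟩
      rw [h.opposite hn0 hε, h.step_false hj, hxj, e, zero_smul, zero_add, smul_smul]
      rw [zero_add] at h4
      rw [h4, one_smul]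
    · refine ⟨j + n, ?_⟩
      rw [h.opposite hn0 hε, hxj, e, zero_smul, add_zero, smul_smul]
      rw [add_zero] at h4
      rw [h4, one_smul]
  have h5 : 1 < width n l * (α + β) := lt_of_le_of_ne h3 h4.symm
  have h6 : ‖A k - A j‖ = 0 := by
    by_contra hc
    have : 0 < ‖A k - A j‖ ^ 2 := by positivity
    nlinarith
  apply hne
  have h7 : A k = A j := sub_eq_zero.1 (norm_eq_zero.1 h6)
  rw [hxj, h7] at hxk
  exact smul_right_injective ℂ hw.ne' (add_left_cancel hxk)

theorem isReinhardtPolygon (h : IsPath n ε l A) (hn : 3 ≤ n) (hε : IsAntiperiodic n ε)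
    (hl : l ≠ 0) : IsReinhardtPolygon (pathPolygon n ε A) := by
  have hn0 : n ≠ 0 := by omega
  refine ⟨h.isConvexPolygon hn hε hl, h.isEquilateral hε, region n l A, width n l,
    h.isReuleauxPolygon_region (by omega) hε hl, fun i => h.apply_mem_frontier hn0 hε hl _, ?_⟩
  rw [h.range_pathPolygon hn0 hε]
  exact h.corners_region_subset (by omega) hε hl

end IsPath

/-! ### Diameters and boundary of an arbitrary Reuleaux polygon. -/

/-- The determinant of a pair of plane vectors. -/
def cross (a b : ℂ) : ℝ := ((starRingEnd ℂ) a * b).im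

theorem cross_eq (a b : ℂ) : cross a b = a.re * b.im - a.im * b.re := by
  simp [cross]; ring

theorem cross_swap (a b : ℂ) : cross a b = -cross b a := by
  rw [cross_eq, cross_eq]; ring

@[simp] theorem cross_self (a : ℂ) : cross a a = 0 := by rw [cross_eq]; ring

@[simp] theorem cross_zero_right (a : ℂ) : cross a 0 = 0 := by simp [cross_eq]

@[simp] theorem cross_zero_left (a : ℂ) : cross 0 a = 0 := by simp [cross_eq]

theorem cross_add_right (a b c : ℂ) : cross a (b + c) = cross a b + cross a c := by
  simp only [cross_eq, Complex.add_re, Complex.add_im]; ring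

theorem cross_add_left (a b c : ℂ) : cross (a + b) c = cross a c + cross b c := by
  simp only [cross_eq, Complex.add_re, Complex.add_im]; ring

theorem cross_sub_right (a b c : ℂ) : cross a (b - c) = cross a b - cross a c := by
  simp only [cross_eq, Complex.sub_re, Complex.sub_im]; ring

theorem cross_ofReal_mul_left (r : ℝ) (a b : ℂ) : cross (r * a) b = r * cross a b := by
  simp only [cross_eq, Complex.re_ofReal_mul, Complex.im_ofReal_mul]; ring

theorem cross_mul_mul (a b c : ℂ) : cross (a * b) (a * c) = ‖a‖ ^ 2 * cross b c := by
  rw [← Complex.normSq_eq_norm_sq, Complex.normSq_apply]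
  simp only [cross_eq, Complex.mul_re, Complex.mul_im]; ring

theorem inner_neg_I_mul (a b : ℂ) : inner ℝ (-I * a) b = -cross a b := by
  rw [inner_eq_re, cross]; simp; ring

theorem cis_eq_one {x : ℝ} (h1 : -(2 * Real.pi) < x) (h2 : x < 2 * Real.pi) (h : cis x = 1) :
    x = 0 := by
  have := congrArg Complex.re h
  rw [cis_re, Complex.one_re] at this
  exact (Real.cos_eq_one_iff_of_lt_of_lt h1 h2).1 this

theorem continuous_cis : Continuous cis := by unfold cis; fun_prop

namespace IsReuleauxPolygon

variable {R : Set ℂ} {w : ℝ}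

theorem pos (h : IsReuleauxPolygon R w) : 0 < w := h.1

theorem isCompact (h : IsReuleauxPolygon R w) : IsCompact R := h.2.1.1

theorem inner_sub_inner_le (h : IsReuleauxPolygon R w) {u x y : ℂ} (hu : ‖u‖ = 1) (hx : x ∈ R)
    (hy : y ∈ R) : (inner ℝ u x : ℝ) - inner ℝ u y ≤ w := by
  have hc : IsCompact ((fun x : ℂ => (inner ℝ u x : ℝ)) '' R) :=
    h.isCompact.image (by fun_prop)
  rw [← h.2.1.2.2.2 u hu]
  exact sub_le_sub (le_csSup hc.bddAbove ⟨x, hx, rfl⟩) (csInf_le hc.bddBelow ⟨y, hy, rfl⟩)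

theorem norm_sub_le (h : IsReuleauxPolygon R w) {x y : ℂ} (hx : x ∈ R) (hy : y ∈ R) :
    ‖x - y‖ ≤ w := by
  rcases eq_or_ne (x - y) 0 with h0 | h0
  · rw [h0, norm_zero]; exact h.pos.le
  · have hn : 0 < ‖x - y‖ := norm_pos_iff.2 h0
    have h1 := h.inner_sub_inner_le (u := ‖x - y‖⁻¹ • (x - y))
      (by rw [norm_smul, norm_inv, norm_norm, inv_mul_cancel₀ hn.ne']) hx hy
    rw [← inner_sub_right, real_inner_smul_left, real_inner_self_eq_norm_sq] at h1
    field_simp at h1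
    exact h1

theorem norm_mul_unit {u : ℂ} (hu : ‖u‖ = 1) : inner ℝ u ((w : ℂ) * u) = w := by
  rw [← Complex.real_smul, real_inner_smul_right, real_inner_self_eq_norm_sq, hu]; ring

/-- The end points of a diameter in direction `u` are extremal in that direction. -/
theorem inner_mem (h : IsReuleauxPolygon R w) {u y z : ℂ} (hu : ‖u‖ = 1) (hy : y ∈ R)
    (hx : y + w * u ∈ R) (hz : z ∈ R) :
    (inner ℝ u y : ℝ) ≤ inner ℝ u z ∧ (inner ℝ u z : ℝ) ≤ inner ℝ u (y + w * u) := by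
  have h1 := h.inner_sub_inner_le hu hz hy
  have h2 := h.inner_sub_inner_le hu hx hz
  rw [inner_add_right, norm_mul_unit hu] at *
  constructor <;> linarith

/-- The point `z` is at distance at most `w` from `y` but advances by at least `w` in direction `u`,
so Cauchy–Schwarz is an equality. -/
theorem eq_of_inner_le (h : IsReuleauxPolygon R w) {u y z : ℂ} (hu : ‖u‖ = 1) (hy : y ∈ R)
    (hz : z ∈ R) (hzx : (inner ℝ u (y + w * u) : ℝ) ≤ inner ℝ u z) : z = y + w * u := by
  have h1 := h.norm_sub_le hz hy
  have hw := h.pos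
  rw [inner_add_right, norm_mul_unit hu] at hzx
  have h2 : w ≤ inner ℝ u (z - y) := by rw [inner_sub_right]; linarith
  have h3 : ‖z - y - w • u‖ ^ 2 ≤ 0 := by
    rw [norm_sub_sq_real, real_inner_smul_right, real_inner_comm, norm_smul, hu,
      Real.norm_of_nonneg hw.le]
    nlinarith [norm_nonneg (z - y)]
  have h4 : ‖z - y - w • u‖ = 0 := by
    have := norm_nonneg (z - y - w • u)
    nlinarith
  rw [norm_eq_zero, Complex.real_smul] at h4
  linear_combination h4

theorem eq_of_add_mem (h : IsReuleauxPolygon R w) {u y z : ℂ} (hu : ‖u‖ = 1) (hy : y ∈ R)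
    (hx : y + w * u ∈ R) (hz : z ∈ R) (hz' : z + w * u ∈ R) : z = y := by
  have := h.eq_of_inner_le hu hy hz' ((h.inner_mem hu hz hz' hx).2)
  exact add_right_cancel this

/-- Points where the maximum and minimum in direction `u` are attained differ by `w` in that
direction and by at most `w` in norm, hence by `w u`. -/
theorem exists_add_mem (h : IsReuleauxPolygon R w) {u : ℂ} (hu : ‖u‖ = 1) :
    ∃ y ∈ R, y + w * u ∈ R := by
  have hcont : ContinuousOn (fun x : ℂ => (inner ℝ u x : ℝ)) R := by fun_prop
  obtain ⟨x, hx, hmax⟩ := h.isCompact.exists_sSup_image_eq h.2.1.2.2.1 hcont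
  obtain ⟨y, hy, hmin⟩ := h.isCompact.exists_sInf_image_eq h.2.1.2.2.1 hcont
  have hw := h.2.1.2.2.2 u hu
  rw [hmax, hmin] at hw
  have := h.eq_of_inner_le hu hy hx (by rw [inner_add_right, norm_mul_unit hu]; linarith)
  exact ⟨y, hy, this ▸ hx⟩

/-- If `x` were inside all the open discs, their intersection, open since there are finitely many,
would be a neighbourhood of `x` in `R`. -/
theorem exists_center (h : IsReuleauxPolygon R w) {C : Finset ℂ}
    (hC : R = ⋂ c ∈ C, Metric.closedBall c w) {x : ℂ} (hx : x ∈ R) (hxi : x ∉ interior R) :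
    ∃ c ∈ C, ∃ u : ℂ, ‖u‖ = 1 ∧ x = c + w * u := by
  have h1 : ∃ c ∈ C, w ≤ ‖x - c‖ := by
    by_contra! hc
    apply hxi
    rw [mem_interior]
    refine ⟨⋂ c ∈ C, Metric.ball c w, ?_, ?_, ?_⟩
    · rw [hC]; exact Set.iInter₂_mono fun c _ => Metric.ball_subset_closedBall
    · exact isOpen_biInter_finset fun _ _ => Metric.isOpen_ball
    · simp only [Set.mem_iInter, Metric.mem_ball, dist_eq_norm]; exact hc
  obtain ⟨c, hc, h2⟩ := h1
  have h3 : ‖x - c‖ ≤ w := by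
    rw [hC] at hx
    simpa [dist_eq_norm] using Set.mem_iInter₂.1 hx c hc
  have hw : (w : ℂ) ≠ 0 := by exact_mod_cast h.pos.ne'
  refine ⟨c, hc, (x - c) / w, ?_, by field_simp; ring⟩
  rw [norm_div, le_antisymm h3 h2, Complex.norm_real, Real.norm_of_nonneg h.pos.le,
    div_self h.pos.ne']

/-- The diameter in direction `u` ends inside the disc about `c`, so no further than `c + w u`. This
point therefore is the end of the diameter, and `c` is its origin. -/
theorem center_mem (h : IsReuleauxPolygon R w) {C : Finset ℂ}
    (hC : R = ⋂ c ∈ C, Metric.closedBall c w) {c u : ℂ} (hc : c ∈ C) (hu : ‖u‖ = 1)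
    (hx : c + w * u ∈ R) : c ∈ R := by
  obtain ⟨y, hy, hy'⟩ := h.exists_add_mem hu
  have h1 : y + w * u ∈ Metric.closedBall c w := by
    rw [hC] at hy'; exact Set.mem_iInter₂.1 hy' c hc
  rw [Metric.mem_closedBall, dist_eq_norm] at h1
  have h2 : (inner ℝ u (y + w * u) : ℝ) ≤ inner ℝ u (c + w * u) := by
    have h3 := real_inner_le_norm u (y + w * u - c)
    rw [hu, one_mul, inner_sub_right] at h3
    rw [inner_add_right u c, norm_mul_unit hu]
    linarith
  have := h.eq_of_inner_le hu hy hx h2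
  rw [add_right_cancel this]; exact hy

theorem eq_of_notMem_corners (h : IsReuleauxPolygon R w) {u u' y y' : ℂ} (hu : ‖u‖ = 1)
    (hu' : ‖u'‖ = 1) (hy : y ∈ R) (hy' : y' ∈ R) (hx : y + w * u ∈ R)
    (he : y' + w * u' = y + w * u) (hcor : y + w * u ∉ corners R) : y' = y := by
  have : u = u' := by
    by_contra hne
    refine hcor ⟨hx, u, u', hu, hu', hne, fun z hz => ⟨(h.inner_mem hu hy hx hz).2, ?_⟩⟩
    rw [← he]
    exact (h.inner_mem hu' hy' (he ▸ hx) hz).2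
  rw [this] at he
  exact add_right_cancel he

/-- Near a boundary point that is not a corner, the boundary is a circular arc. -/
theorem eventually_mem (h : IsReuleauxPolygon R w) {u y : ℂ} (hu : ‖u‖ = 1) (hy : y ∈ R)
    (hx : y + w * u ∈ R) (hcor : y + w * u ∉ corners R) :
    ∀ᶠ v in nhds u, ‖v‖ = 1 → y + w * v ∈ R := by
  obtain ⟨C, hC⟩ := h.2.2
  have key : ∀ c ∈ C, ∀ᶠ v in nhds u, ‖v‖ = 1 → y + w * v ∈ Metric.closedBall c w := by
    intro c hc
    rcases eq_or_ne c y with rfl | hne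
    · refine Filter.Eventually.of_forall fun v hv => ?_
      simp [hv, abs_of_pos h.pos]
    · have h1 : ‖y + w * u - c‖ ≤ w := by
        rw [hC] at hx
        simpa [dist_eq_norm] using Set.mem_iInter₂.1 hx c hc
      -- A second circle through the point would yield a second diameter ending there, hence a
      -- second normal, and the point would be a corner. So all discs not centred at `y` contain the
      -- point in their interior.
      have h2 : ‖y + w * u - c‖ ≠ w := by
        intro h2
        have hw : (w : ℂ) ≠ 0 := by exact_mod_cast h.pos.ne'
        have h3 : c + w * ((y + w * u - c) / w) = y + w * u := by field_simp; ring
        have h4 : ‖(y + w * u - c) / w‖ = 1 := by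
          rw [norm_div, h2, Complex.norm_real, Real.norm_of_nonneg h.pos.le, div_self h.pos.ne']
        exact hne (h.eq_of_notMem_corners hu h4 hy (h.center_mem hC hc h4 (by rw [h3]; exact hx)) hx h3 hcor)
      have h3 : ‖y + w * u - c‖ < w := lt_of_le_of_ne h1 h2
      have h4 : ContinuousAt (fun v : ℂ => ‖y + w * v - c‖) u := by fun_prop
      filter_upwards [h4.eventually_lt_const h3] with v hv _
      rw [Metric.mem_closedBall, dist_eq_norm]; exact hv.le
  have := (Filter.eventually_all_finset C).2 key
  filter_upwards [this] with v hv hv1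
  rw [hC]
  exact Set.mem_iInter₂.2 fun c hc => hv c hc hv1

/-- The end point is moved along the circle about `y`. After a quarter turn it would be at distance
`√2 w` from its start, outside `R`; let `T` be the first time at which it leaves `R` or meets `V`.
By closedness it is still in `R` at time `T`, and if it were not in `V` then `eventually_mem` would
prolong the arc. -/
theorem exists_first_vertex (h : IsReuleauxPolygon R w) {V : Set ℂ} (hV : V.Finite)
    (hcor : corners R ⊆ V) {u y : ℂ} (hu : ‖u‖ = 1) (hy : y ∈ R) (hx : y + w * u ∈ R)
    (hxV : y + w * u ∉ V) {σ : ℝ} (hσ : |σ| = 1) :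
    ∃ T, 0 < T ∧ T < Real.pi / 2 ∧ y + w * (u * cis (σ * T)) ∈ V ∧
      ∀ t, 0 ≤ t → t < T → y + w * (u * cis (σ * t)) ∈ R ∧ y + w * (u * cis (σ * t)) ∉ V := by
  set z : ℝ → ℂ := fun t => y + w * (u * cis (σ * t)) with hz
  have hzc : Continuous z := by
    have := continuous_cis
    fun_prop
  have hpi := Real.pi_pos
  have hend : z (Real.pi / 2) ∉ R := by
    intro hc
    have h1 := h.norm_sub_le hc hx
    have h2 : z (Real.pi / 2) - (y + w * u) = w * u * (cis (σ * (Real.pi / 2)) - 1) := by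
      simp only [hz]; ring
    rw [h2, norm_mul, norm_mul, hu, Complex.norm_real, Real.norm_of_nonneg h.pos.le] at h1
    have h3 : ‖cis (σ * (Real.pi / 2)) - 1‖ ^ 2 = 2 := by
      rw [← Complex.normSq_eq_norm_sq, Complex.normSq_apply]
      rcases (abs_eq zero_le_one).1 hσ with rfl | rfl <;> simp <;> norm_num
    have h4 : ‖cis (σ * (Real.pi / 2)) - 1‖ ≤ 1 := by
      have := h.pos
      by_contra hc
      nlinarith
    nlinarith [norm_nonneg (cis (σ * (Real.pi / 2)) - 1)]
  set G : Set ℝ := {t | 0 ≤ t ∧ ¬(z t ∈ R ∧ z t ∉ V)} with hG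
  have hGne : Real.pi / 2 ∈ G := ⟨by positivity, fun hc => hend hc.1⟩
  have hGb : BddBelow G := ⟨0, fun t ht => ht.1⟩
  set T := sInf G with hT
  have hT0 : 0 ≤ T := le_csInf ⟨_, hGne⟩ fun t ht => ht.1
  have hlt : ∀ t, 0 ≤ t → t < T → z t ∈ R ∧ z t ∉ V := by
    intro t h0 h1
    by_contra hc
    exact absurd (csInf_le hGb ⟨h0, hc⟩) (not_le.2 h1)
  have hz0 : z 0 = y + w * u := by simp [hz]
  have hTR : z T ∈ R := by
    rcases hT0.eq_or_lt with h0 | h0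
    · rw [← h0, hz0]; exact hx
    · have hcl : IsClosed (z ⁻¹' R) := h.isCompact.isClosed.preimage hzc
      have hsub : Set.Ico 0 T ⊆ z ⁻¹' R := fun t ht => (hlt t ht.1 ht.2).1
      have := hcl.closure_subset_iff.2 hsub
      rw [closure_Ico h0.ne] at this
      exact this ⟨hT0, le_rfl⟩
  have hTV : z T ∈ V := by
    by_contra hc
    have hu' : ‖u * cis (σ * T)‖ = 1 := by simp [hu]
    have e1 := h.eventually_mem hu' hy hTR fun hh => hc (hcor hh)
    have hct : ContinuousAt (fun t : ℝ => u * cis (σ * t)) T := by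
      have := continuous_cis
      fun_prop
    have e2 := hct.eventually e1
    have e3 : ∀ᶠ t in nhds T, z t ∉ V :=
      hzc.continuousAt.eventually (hV.isClosed.isOpen_compl.mem_nhds hc)
    obtain ⟨δ, hδ, hball⟩ := Metric.eventually_nhds_iff.1 (e2.and e3)
    have : T + δ ≤ T := by
      refine le_csInf ⟨_, hGne⟩ fun t ht => ?_
      by_contra hc'
      push Not at hc'
      apply ht.2
      rcases lt_or_ge t T with h1 | h1
      · exact hlt t ht.1 h1
      · have := hball (y := t) (by rw [Real.dist_eq, abs_of_nonneg (by linarith)]; linarith)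
        exact ⟨this.1 (by simp [hu]), this.2⟩
    linarith
  refine ⟨T, lt_of_le_of_ne hT0 ?_, lt_of_le_of_ne (csInf_le hGb hGne) ?_, hTV, hlt⟩
  · intro h0
    rw [← h0, hz0] at hTV
    exact hxV hTV
  · intro h0
    exact hend (h0 ▸ hTR)

end IsReuleauxPolygon

/-! ### Boundary arcs and the edges of an inscribed polygon. -/

/-- The circular arc with centre `c` from `c + w a` to `c + w a e^{iθ}` is part of the boundary of
`R`, its end points and its centre belong to `V`, and no other point of the arc does. -/
structure IsArc (R V : Set ℂ) (w : ℝ) (c a : ℂ) (θ : ℝ) : Prop where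
  center : c ∈ V
  unit : ‖a‖ = 1
  pos : 0 < θ
  lt_pi : θ < Real.pi
  left : c + w * a ∈ V
  right : c + w * (a * cis θ) ∈ V
  inside : ∀ t, 0 < t → t < θ → c + w * (a * cis t) ∈ R ∧ c + w * (a * cis t) ∉ V

namespace IsReuleauxPolygon

variable {R V : Set ℂ} {w : ℝ}

theorem exists_isArc (h : IsReuleauxPolygon R w) (hV : V.Finite) (hcor : corners R ⊆ V) {u y : ℂ}
    (hu : ‖u‖ = 1) (hy : y ∈ R) (hx : y + w * u ∈ R) (hxV : y + w * u ∉ V) :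
    ∃ a θ τ, IsArc R V w y a θ ∧ 0 < τ ∧ τ < θ ∧ u = a * cis τ := by
  obtain ⟨T, h0, h1, h2, h3⟩ := h.exists_first_vertex hV hcor hu hy hx hxV (σ := 1) (by simp)
  obtain ⟨S, k0, k1, k2, k3⟩ := h.exists_first_vertex hV hcor hu hy hx hxV (σ := -1) (by simp)
  have hin : ∀ t, 0 < t → t < S + T → y + w * (u * cis (-1 * S) * cis t) ∈ R ∧
      y + w * (u * cis (-1 * S) * cis t) ∉ V := by
    intro t ht0 ht1
    rw [mul_assoc u, ← cis_add]
    rcases le_total S t with h | h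
    · have := h3 (t - S) (by linarith) (by linarith)
      rwa [show 1 * (t - S) = -1 * S + t by ring] at this
    · have := k3 (S - t) (by linarith) (by linarith)
      rwa [show -1 * (S - t) = -1 * S + t by ring] at this
  have hun : ‖u * cis (-1 * S)‖ = 1 := by simp [hu]
  refine ⟨u * cis (-1 * S), S + T, S, ⟨?_, hun, by linarith, by linarith, k2, ?_, hin⟩, k0,
    by linarith, ?_⟩
  -- The centre is the origin of diameters in two distinct directions, the starting one and one
  -- halfway along the backward part, so it has two outward normals.
  · apply hcor
    refine ⟨hy, -u, -(u * cis (-1 * S) * cis (S / 2)), by simpa, by simp [hu], ?_, fun z hz => ?_⟩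
    · intro he
      rw [neg_inj, mul_assoc, ← cis_add] at he
      have hu0 : u ≠ 0 := by rintro rfl; simp at hu
      have h5 : cis (-1 * S + S / 2) = 1 := mul_left_cancel₀ hu0 (by rw [← he, mul_one])
      have := cis_eq_one (by linarith) (by linarith) h5
      linarith
    · rw [inner_neg_left, inner_neg_left, inner_neg_left, inner_neg_left]
      have e1 := (h.inner_mem hu hy hx hz).1
      have e2 := (h.inner_mem (by simp [hu]) hy (hin (S / 2) (by linarith) (by linarith)).1 hz).1
      exact ⟨neg_le_neg e1, neg_le_neg e2⟩
  · rw [mul_assoc u, ← cis_add]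
    rwa [show -1 * S + (S + T) = 1 * T by ring]
  · rw [mul_assoc, ← cis_add]; simp

/-- A boundary point of `R` is an extreme point. -/
theorem eq_of_convex_combination (h : IsReuleauxPolygon R w) {v p q : ℂ} (hv : v ∈ R)
    (hvi : v ∉ interior R) (hp : p ∈ R) (hq : q ∈ R) {s : ℝ} (h0 : 0 < s) (h1 : s < 1)
    (he : v = (1 - s) • p + s • q) : p = v := by
  obtain ⟨C, hC⟩ := h.2.2
  obtain ⟨c, hc, u, hu, rfl⟩ := h.exists_center hC hv hvi
  have hcR := h.center_mem hC hc hu hv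
  apply h.eq_of_inner_le hu hcR hp
  have e1 := (h.inner_mem hu hcR hv hp).2
  have e2 := (h.inner_mem hu hcR hv hq).2
  have e3 : (inner ℝ u (c + w * u) : ℝ) = inner ℝ u ((1 - s) • p + s • q) := by rw [← he]
  rw [inner_add_right u ((1 - s) • p), real_inner_smul_right, real_inner_smul_right] at e3
  nlinarith

/-- Otherwise `v` lies in the circular segment cut off by the chord. In polar coordinates about `c`,
measured from the bisector, its angle is at most `θ / 2`. On the bounding rays it is an end of the
arc. Strictly between them it is either an inner point of the arc, which is not in `V`, or strictly
between `c` and such a point, which is impossible for a boundary point. -/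
theorem inner_bisector_neg (h : IsReuleauxPolygon R w) (hVR : V ⊆ R)
    (hVi : ∀ v ∈ V, v ∉ interior R) {c a : ℂ} {θ : ℝ} (harc : IsArc R V w c a θ) {v : ℂ}
    (hv : v ∈ V) (hva : v ≠ c + w * a) (hvb : v ≠ c + w * (a * cis θ)) :
    inner ℝ (a * cis (θ / 2)) (v - (c + w * a)) < 0 := by
  by_contra! hc
  have hθ0 := harc.pos
  have hθ1 := harc.lt_pi
  have hw := h.pos
  have hmu : ‖a * cis (θ / 2)‖ = 1 := by simp [harc.unit]
  have hm0 : a * cis (θ / 2) ≠ 0 := fun h0 => by rw [h0] at hmu; simp at hmu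
  set q := (v - c) / (a * cis (θ / 2)) with hq
  have hvq : v = c + a * cis (θ / 2) * q := by
    rw [hq, mul_div_cancel₀ _ hm0]; ring
  have hqr : ‖q‖ ≤ w := by
    rw [hq, norm_div, hmu, div_one]
    exact h.norm_sub_le (hVR hv) (hVR harc.center)
  have h1 : inner ℝ (a * cis (θ / 2)) (v - (c + w * a)) =
      ‖q‖ * Real.cos (arg q) - w * Real.cos (θ / 2) := by
    have e1 : v - (c + w * a) =
        a * cis (θ / 2) * (((‖q‖ : ℝ) : ℂ) * cis (arg q) - ((w : ℝ) : ℂ) * cis (-(θ / 2))) := by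
      rw [norm_mul_cis_arg, hvq, mul_sub]
      linear_combination (w : ℂ) * a * cis_mul_neg (θ / 2)
    rw [e1]
    conv_lhs => rw [← mul_one (a * cis (θ / 2)), mul_assoc, mul_assoc, mul_one, ← mul_assoc]
    rw [show a * cis (θ / 2) = a * cis (θ / 2) * 1 by ring, mul_assoc _ 1, one_mul,
      inner_mul_mul, hmu, inner_eq_re]
    simp
  rw [h1] at hc
  have hc2 : 0 < Real.cos (θ / 2) := Real.cos_pos_of_mem_Ioo ⟨by linarith, by linarith⟩
  have hr0 : 0 < ‖q‖ := by
    rcases (norm_nonneg q).eq_or_lt with h0 | h0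
    · rw [← h0] at hc; nlinarith
    · exact h0
  have hcψ : 0 < Real.cos (arg q) := by
    by_contra hneg
    nlinarith
  have hcc : Real.cos (θ / 2) ≤ Real.cos (arg q) := by nlinarith
  have habs : |arg q| ≤ θ / 2 := by
    by_contra! hlt
    have := Real.cos_lt_cos_of_nonneg_of_le_pi (by linarith) (Complex.abs_arg_le_pi q) hlt
    rw [Real.cos_abs] at this
    linarith
  have hvt : v = c + ‖q‖ * (a * cis (θ / 2 + arg q)) := by
    rw [hvq, cis_add]
    linear_combination -a * cis (θ / 2) * norm_mul_cis_arg q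
  rcases habs.eq_or_lt with heq | hlt
  · have hcos : Real.cos (arg q) = Real.cos (θ / 2) := by rw [← Real.cos_abs, heq]
    have hr : ‖q‖ = w := by
      rw [hcos] at hc
      nlinarith
    rw [hr] at hvt
    rcases abs_eq (by linarith) |>.1 heq with h2 | h2
    · apply hvb; rw [hvt, h2]; congr 3; ring_nf
    · apply hva; rw [hvt, h2]; simp
  · obtain ⟨h2, h3⟩ := abs_lt.1 hlt
    obtain ⟨h4, h5⟩ := harc.inside (θ / 2 + arg q) (by linarith) (by linarith)
    have hr : ‖q‖ < w := by
      refine lt_of_le_of_ne hqr fun h6 => ?_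
      rw [h6] at hvt
      exact h5 (hvt ▸ hv)
    have hw' : (w : ℂ) ≠ 0 := by exact_mod_cast hw.ne'
    have := h.eq_of_convex_combination (hVR hv) (hVi v hv) (hVR harc.center) h4
      (s := ‖q‖ / w) (by positivity) (by rwa [div_lt_one hw]) (by
        conv_lhs => rw [hvt]
        simp only [Complex.real_smul]
        push_cast
        field_simp
        ring)
    rw [hvt] at this
    have h6 : (‖q‖ : ℂ) * (a * cis (θ / 2 + arg q)) = 0 := by linear_combination -this
    have h7 := congrArg norm h6
    rw [norm_mul, norm_mul, harc.unit, norm_cis, Complex.norm_real, norm_norm, norm_zero] at h7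
    linarith

theorem cross_chord (w : ℝ) (a : ℂ) (θ : ℝ) (c z : ℂ) :
    cross (c + w * (a * cis θ) - (c + w * a)) z =
      -(2 * w * Real.sin (θ / 2)) * inner ℝ (a * cis (θ / 2)) z := by
  have e1 : c + w * (a * cis θ) - (c + w * a) =
      ((2 * w * Real.sin (θ / 2) : ℝ) : ℂ) * (I * (a * cis (θ / 2))) := by
    have e2 : cis θ - 1 = 2 * Real.sin (θ / 2) * (I * cis (θ / 2)) := by
      have h1 : θ = θ / 2 + θ / 2 := by ring
      conv_lhs => rw [h1, ← cis_neg_mul (θ / 2), cis_add]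
      have : cis (θ / 2) - cis (-(θ / 2)) = 2 * Real.sin (θ / 2) * I := by
        rw [show (2 : ℂ) * (Real.sin (θ / 2) : ℂ) * I = ((2 * Real.sin (θ / 2) : ℝ) : ℂ) * I by
          rw [Complex.ofReal_mul, Complex.ofReal_ofNat]]
        apply Complex.ext
        · rw [Complex.sub_re, Complex.re_ofReal_mul, cis_re, cis_re, I_re, Real.cos_neg]; ring
        · rw [Complex.sub_im, Complex.im_ofReal_mul, cis_im, cis_im, I_im, Real.sin_neg]; ring
      linear_combination cis (θ / 2) * this
    rw [Complex.ofReal_mul, Complex.ofReal_mul, Complex.ofReal_ofNat]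
    linear_combination (w : ℂ) * a * e2
  rw [e1, cross_ofReal_mul_left, ← neg_neg (cross _ _), ← inner_neg_I_mul]
  rw [show -I * (I * (a * cis (θ / 2))) = a * cis (θ / 2) by
    linear_combination -(a * cis (θ / 2)) * I_mul_I]
  ring

theorem cross_chord_pos (h : IsReuleauxPolygon R w) (hVR : V ⊆ R)
    (hVi : ∀ v ∈ V, v ∉ interior R) {c a : ℂ} {θ : ℝ} (harc : IsArc R V w c a θ) {v : ℂ}
    (hv : v ∈ V) (hva : v ≠ c + w * a) (hvb : v ≠ c + w * (a * cis θ)) :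
    0 < cross (c + w * (a * cis θ) - (c + w * a)) (v - (c + w * a)) := by
  rw [cross_chord]
  have h1 := h.inner_bisector_neg hVR hVi harc hv hva hvb
  have h2 : 0 < Real.sin (θ / 2) :=
    Real.sin_pos_of_pos_of_lt_pi (by linarith [harc.pos]) (by linarith [harc.lt_pi, harc.pos])
  have := h.pos
  have h3 : 0 < 2 * w * Real.sin (θ / 2) := by positivity
  nlinarith

end IsReuleauxPolygon

namespace IsConvexPolygon

variable {n : ℕ} {P : Polygon ℂ n}

theorem cross_pos (h : IsConvexPolygon P) {i j : Fin n} (h1 : j ≠ i) (h2 : j ≠ finRotate n i) :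
    0 < cross (P (finRotate n i) - P i) (P j - P i) := h.2 i j h1 h2

theorem finRotate_ne (h : IsConvexPolygon P) (i : Fin n) : finRotate n i ≠ i := by
  intro he
  have := congrArg Fin.val he
  rw [coe_finRotate_eq_mod] at this
  have h3 := h.1
  have h4 := i.isLt
  rcases Nat.lt_or_ge (i + 1) n with h1 | h1
  · rw [Nat.mod_eq_of_lt h1] at this; omega
  · rw [show (i : ℕ) + 1 = n by omega, Nat.mod_self] at this; omega

theorem finRotate_finRotate_ne (h : IsConvexPolygon P) (i : Fin n) :
    finRotate n (finRotate n i) ≠ i := by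
  intro he
  have := congrArg Fin.val he
  rw [coe_finRotate_eq_mod, coe_finRotate_eq_mod, Nat.mod_add_mod] at this
  have h3 := h.1
  have h4 := i.isLt
  rcases Nat.lt_or_ge (i + 1 + 1) n with h1 | h1
  · rw [Nat.mod_eq_of_lt h1] at this; omega
  · rw [Nat.mod_eq_sub_mod h1, Nat.mod_eq_of_lt (by omega)] at this; omega

theorem injective (h : IsConvexPolygon P) : Function.Injective P.vertices := by
  have hedge : ∀ i, P (finRotate n i) ≠ P i := by
    intro i he
    have := h.cross_pos (h.finRotate_finRotate_ne i) (h.finRotate_ne (finRotate n i))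
    rw [he, sub_self, cross_zero_left] at this
    exact lt_irrefl _ this
  intro i j hij
  by_contra hne
  by_cases h1 : j = finRotate n i
  · rw [h1] at hij; exact hedge i hij.symm
  · have := h.cross_pos (Ne.symm hne) h1
    rw [show P j - P i = 0 from sub_eq_zero.2 hij.symm, cross_zero_right] at this
    exact lt_irrefl _ this

end IsConvexPolygon

namespace IsReuleauxPolygon

variable {n : ℕ} {P : Polygon ℂ n} {R : Set ℂ} {w : ℝ}

theorem frontier_subset (h : IsReuleauxPolygon R w) : frontier R ⊆ R :=
  h.isCompact.isClosed.frontier_subset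

/-- If the vertex after the left end were not the right end, it would be strictly left of the chord
by `cross_chord_pos`, while convexity puts the right end strictly left of the edge. The two
determinants are opposite. -/
theorem exists_edge_of_isArc (h : IsReuleauxPolygon R w) (hP : IsConvexPolygon P)
    (hfr : ∀ i, P i ∈ frontier R) {c a : ℂ} {θ : ℝ}
    (harc : IsArc R (Set.range P.vertices) w c a θ) :
    ∃ i, P i = c + w * a ∧ P (finRotate n i) = c + w * (a * cis θ) := by
  have hVR : Set.range P.vertices ⊆ R := by
    rintro _ ⟨i, rfl⟩; exact h.frontier_subset (hfr i)
  have hVi : ∀ v ∈ Set.range P.vertices, v ∉ interior R := by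
    rintro _ ⟨i, rfl⟩; exact (hfr i).2
  obtain ⟨i, hi⟩ := harc.left
  obtain ⟨j, hj⟩ := harc.right
  refine ⟨i, hi, ?_⟩
  by_contra hne
  have h1 : P (finRotate n i) ≠ c + w * a := fun he =>
    hP.finRotate_ne i (hP.injective (he.trans hi.symm))
  have h2 := h.cross_chord_pos hVR hVi harc ⟨finRotate n i, rfl⟩ h1 hne
  rw [← hi, ← hj] at h2
  have hji : j ≠ i := by
    rintro rfl
    rw [hi] at hj
    have hw : (w : ℂ) ≠ 0 := by exact_mod_cast h.pos.ne'
    have ha : a ≠ 0 := by intro h0; have := harc.unit; rw [h0] at this; simp at this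
    have h3 : cis θ = 1 := by
      have := mul_left_cancel₀ hw (add_left_cancel hj)
      exact mul_left_cancel₀ ha (by rw [← this, mul_one])
    have := cis_eq_one (by linarith [harc.pos, Real.pi_pos]) (by linarith [harc.lt_pi, Real.pi_pos]) h3
    exact harc.pos.ne' this
  have hjr : j ≠ finRotate n i := by
    rintro rfl
    exact hne hj
  have h3 := hP.cross_pos hji hjr
  rw [cross_swap] at h3
  linarith

/-- A direction inside the arc lies between the bisector and one of the two end directions, so
`sin_mul_cis` makes it a nonnegative combination of these with positive weight on the bisector. -/
theorem inner_neg_or_inner_neg {a d₁ d₂ : ℂ} {θ τ : ℝ} (h0 : 0 < τ) (h1 : τ < θ)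
    (hθ : θ < Real.pi) (ha : (inner ℝ a d₁ : ℝ) ≤ 0) (hb : (inner ℝ (a * cis θ) d₂ : ℝ) ≤ 0)
    (hm₁ : (inner ℝ (a * cis (θ / 2)) d₁ : ℝ) < 0) (hm₂ : (inner ℝ (a * cis (θ / 2)) d₂ : ℝ) < 0) :
    (inner ℝ (a * cis τ) d₁ : ℝ) < 0 ∨ (inner ℝ (a * cis τ) d₂ : ℝ) < 0 := by
  have hs : 0 < Real.sin (θ / 2) := Real.sin_pos_of_pos_of_lt_pi (by linarith) (by linarith)
  rcases le_total τ (θ / 2) with h2 | h2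
  · left
    have e1 : Real.sin (θ / 2) • (a * cis τ) =
        Real.sin (θ / 2 - τ) • a + Real.sin τ • (a * cis (θ / 2)) := by
      have := sin_mul_cis τ (θ / 2)
      simp only [Complex.real_smul]
      linear_combination a * this
    have e2 := congrArg (fun z => (inner ℝ z d₁ : ℝ)) e1
    simp only [inner_add_left, real_inner_smul_left] at e2
    have h3 : 0 ≤ Real.sin (θ / 2 - τ) :=
      Real.sin_nonneg_of_nonneg_of_le_pi (by linarith) (by linarith)
    have h4 : 0 < Real.sin τ := Real.sin_pos_of_pos_of_lt_pi (by linarith) (by linarith)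
    by_contra hc
    nlinarith
  · right
    have e1 : Real.sin (θ / 2) • (a * cis τ) =
        Real.sin (τ - θ / 2) • (a * cis θ) + Real.sin (θ - τ) • (a * cis (θ / 2)) := by
      have := sin_mul_cis (τ - θ / 2) (θ / 2)
      rw [show θ / 2 - (τ - θ / 2) = θ - τ by ring] at this
      have e3 : cis τ = cis (τ - θ / 2) * cis (θ / 2) := by rw [← cis_add]; congr 1; ring
      have e4 : cis θ = cis (θ / 2) * cis (θ / 2) := by rw [← cis_add]; congr 1; ring
      simp only [Complex.real_smul]
      rw [e3, e4]
      linear_combination a * cis (θ / 2) * this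
    have e2 := congrArg (fun z => (inner ℝ z d₂ : ℝ)) e1
    simp only [inner_add_left, real_inner_smul_left] at e2
    have h3 : 0 ≤ Real.sin (τ - θ / 2) :=
      Real.sin_nonneg_of_nonneg_of_le_pi (by linarith) (by linarith)
    have h4 : 0 < Real.sin (θ - τ) := Real.sin_pos_of_pos_of_lt_pi (by linarith) (by linarith)
    by_contra hc
    nlinarith

theorem inner_bisector_chord (c a : ℂ) (w θ : ℝ) :
    inner ℝ (a * cis (θ / 2)) (c + w * (a * cis θ) - (c + w * a)) = 0 := by
  have e1 : c + w * (a * cis θ) - (c + w * a) =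
      (w : ℝ) • (a * cis θ - a * cis 0) := by
    rw [Complex.real_smul, cis_zero]; ring
  rw [e1, real_inner_smul_right, inner_sub_right, inner_mul_mul, inner_mul_mul, inner_cis_cis,
    inner_cis_cis, show 0 - θ / 2 = -(θ - θ / 2) by ring, Real.cos_neg, sub_self, mul_zero]

/-- Let `u` be the outward unit normal of the edge. The point of `R` furthest along `u` is not a
vertex, as both ends of the edge would then coincide with it. So it lies on an arc, which spans some
edge `k`. Vertices furthest along `u` can only be the ends of edge `k`, and both ends of edge `i`
are furthest; hence `i = k`. -/
theorem exists_isArc_of_edge (h : IsReuleauxPolygon R w) (hP : IsConvexPolygon P)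
    (hfr : ∀ i, P i ∈ frontier R) (hcor : corners R ⊆ Set.range P.vertices) (i : Fin n) :
    ∃ c a θ, IsArc R (Set.range P.vertices) w c a θ ∧ P i = c + w * a ∧
      P (finRotate n i) = c + w * (a * cis θ) := by
  have hVR : Set.range P.vertices ⊆ R := by
    rintro _ ⟨i, rfl⟩; exact h.frontier_subset (hfr i)
  have hVi : ∀ v ∈ Set.range P.vertices, v ∉ interior R := by
    rintro _ ⟨i, rfl⟩; exact (hfr i).2
  set e := P (finRotate n i) - P i with he
  have he0 : e ≠ 0 := fun h0 => hP.finRotate_ne i (hP.injective (sub_eq_zero.1 h0))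
  have hen : 0 < ‖e‖ := norm_pos_iff.2 he0
  set u : ℂ := ((‖e‖⁻¹ : ℝ) : ℂ) * (-I * e) with hu
  have hu1 : ‖u‖ = 1 := by
    rw [hu, norm_mul, norm_mul, norm_neg, norm_I, one_mul, Complex.norm_real, norm_inv, norm_norm,
      inv_mul_cancel₀ hen.ne']
  have hin : ∀ z, inner ℝ u z = -(‖e‖⁻¹ * cross e z) := by
    intro z
    rw [hu, ← Complex.real_smul, real_inner_smul_left, inner_neg_I_mul]; ring
  have hmax : ∀ j, j ≠ i → j ≠ finRotate n i → (inner ℝ u (P j) : ℝ) < inner ℝ u (P i) := by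
    intro j h1 h2
    have h3 := hP.cross_pos h1 h2
    have h4 := hin (P j - P i)
    rw [inner_sub_right] at h4
    have : 0 < ‖e‖⁻¹ * cross e (P j - P i) := by positivity
    linarith
  have hrot : (inner ℝ u (P (finRotate n i)) : ℝ) = inner ℝ u (P i) := by
    have h4 := hin e
    rw [cross_self, mul_zero, neg_zero, he, inner_sub_right] at h4
    linarith
  have hle : ∀ j, (inner ℝ u (P j) : ℝ) ≤ inner ℝ u (P i) := by
    intro j
    by_cases h1 : j = i
    · rw [h1]
    by_cases h2 : j = finRotate n i
    · rw [h2, hrot]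
    exact (hmax j h1 h2).le
  obtain ⟨y, hy, hx⟩ := h.exists_add_mem hu1
  have hxV : y + w * u ∉ Set.range P.vertices := by
    rintro ⟨k, hk⟩
    have h1 := hle k
    have h2 := h.eq_of_inner_le hu1 hy (hVR ⟨i, rfl⟩) (hk ▸ h1)
    have h3 := h.eq_of_inner_le hu1 hy (hVR ⟨finRotate n i, rfl⟩) (by rw [hrot]; exact hk ▸ h1)
    exact hP.finRotate_ne i (hP.injective (h3.trans h2.symm))
  obtain ⟨a, θ, τ, harc, hτ0, hτ1, hua⟩ := h.exists_isArc (Set.finite_range _) hcor hu1 hy hx hxV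
  obtain ⟨k, hk1, hk2⟩ := h.exists_edge_of_isArc hP hfr harc
  have hbu : ‖a * cis θ‖ = 1 := by simp [harc.unit]
  have key : ∀ j, (inner ℝ u (P i) : ℝ) ≤ inner ℝ u (P j) → j = k ∨ j = finRotate n k := by
    intro j hj
    by_contra! hc
    have n1 : P j ≠ y + w * a := fun h0 => hc.1 (hP.injective (h0.trans hk1.symm))
    have n2 : P j ≠ y + w * (a * cis θ) := fun h0 => hc.2 (hP.injective (h0.trans hk2.symm))
    have hm1 := h.inner_bisector_neg hVR hVi harc ⟨j, rfl⟩ n1 n2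
    have hm2 : inner ℝ (a * cis (θ / 2)) (P j - (y + w * (a * cis θ))) < 0 := by
      have h1 := inner_bisector_chord y a w θ
      rw [inner_sub_right] at h1 hm1 ⊢
      linarith
    have ha := (h.inner_mem harc.unit hy (hVR harc.left) (hVR ⟨j, rfl⟩)).2
    have hb := (h.inner_mem hbu hy (hVR harc.right) (hVR ⟨j, rfl⟩)).2
    have h5 := inner_neg_or_inner_neg (a := a) (d₁ := P j - (y + w * a))
      (d₂ := P j - (y + w * (a * cis θ))) hτ0 hτ1 harc.lt_pi
      (by rw [inner_sub_right]; linarith) (by rw [inner_sub_right]; linarith) hm1 hm2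
    rw [← hua, inner_sub_right, inner_sub_right, ← hk1, ← hk2] at h5
    have h6 := hle k
    have h7 := hle (finRotate n k)
    rcases h5 with h5 | h5 <;> linarith
  have hik : i = k := by
    rcases key i le_rfl with h1 | h1
    · exact h1
    · rcases key (finRotate n i) hrot.ge with h2 | h2
      · rw [h1] at h2
        exact absurd h2 (hP.finRotate_finRotate_ne k)
      · exact (finRotate n).injective h2
  subst hik
  exact ⟨y, a, θ, harc, hk1, hk2⟩

end IsReuleauxPolygon

/-! ### The arcs of an equilateral polygon all have angle `π / n`. -/

theorem norm_cis_sub_one {θ : ℝ} (h0 : 0 ≤ θ) (h1 : θ ≤ 2 * Real.pi) :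
    ‖cis θ - 1‖ = 2 * Real.sin (θ / 2) := by
  have h2 : 0 ≤ Real.sin (θ / 2) :=
    Real.sin_nonneg_of_nonneg_of_le_pi (by linarith) (by linarith)
  have h3 : ‖cis θ - 1‖ ^ 2 = (2 * Real.sin (θ / 2)) ^ 2 := by
    rw [← Complex.normSq_eq_norm_sq, Complex.normSq_apply]
    simp only [sub_re, cis_re, one_re, sub_im, cis_im, one_im, sub_zero]
    have h4 : θ = 2 * (θ / 2) := by ring
    conv_lhs => rw [h4, Real.cos_two_mul, Real.sin_two_mul]
    have := Real.sin_sq_add_cos_sq (θ / 2)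
    have h5 : Real.cos (θ / 2) ^ 2 = 1 - Real.sin (θ / 2) ^ 2 := by linarith
    linear_combination (4 * Real.cos (θ / 2) ^ 2 - 4) * h5
  exact (sq_eq_sq₀ (norm_nonneg _) (by positivity)).1 h3

/-- The arcs of `R` over the edges of the polygon `P`. -/
structure IsArcSystem {n : ℕ} (P : Polygon ℂ n) (R : Set ℂ) (w θ : ℝ) (c a : Fin n → ℂ) : Prop where
  isArc : ∀ i, IsArc R (Set.range P.vertices) w (c i) (a i) θ
  left : ∀ i, P i = c i + w * a i
  right : ∀ i, P (finRotate n i) = c i + w * (a i * cis θ)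
  cover : ∀ u y : ℂ, ‖u‖ = 1 → y ∈ R → y + w * u ∈ R → y + w * u ∉ Set.range P.vertices →
    ∃ i τ, 0 < τ ∧ τ < θ ∧ u = a i * cis τ

/-- The chord of an arc of angle `θ` has length `2 w sin (θ / 2)`, and the sine is injective on the
range of `θ / 2`, so equal sides have equal angles. -/
theorem IsReuleauxPolygon.exists_isArcSystem {n : ℕ} {P : Polygon ℂ n} {R : Set ℂ} {w : ℝ}
    (h : IsReuleauxPolygon R w) (hP : IsConvexPolygon P) (heq : IsEquilateral P)
    (hfr : ∀ i, P i ∈ frontier R) (hcor : corners R ⊆ Set.range P.vertices) :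
    ∃ θ c a, IsArcSystem P R w θ c a := by
  have hw := h.pos
  have hw' : (w : ℂ) ≠ 0 := by exact_mod_cast hw.ne'
  choose c a θ harc hl hr using h.exists_isArc_of_edge hP hfr hcor
  obtain ⟨s, hs⟩ := heq
  have hlen : ∀ (i : Fin n) (c a : ℂ) (θ : ℝ), IsArc R (Set.range P.vertices) w c a θ →
      P i = c + w * a → P (finRotate n i) = c + w * (a * cis θ) →
      s = w * (2 * Real.sin (θ / 2)) := by
    intro i c a θ harc h1 h2
    rw [← hs i, dist_comm, dist_eq_norm, h1, h2,
      show c + w * (a * cis θ) - (c + w * a) = w * (a * (cis θ - 1)) by ring, norm_mul, norm_mul,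
      harc.unit, norm_cis_sub_one harc.pos.le (by linarith [harc.lt_pi, Real.pi_pos]), one_mul,
      Complex.norm_real, Real.norm_of_nonneg hw.le]
  have hangle : ∀ θ θ' : ℝ, 0 < θ → θ < Real.pi → 0 < θ' → θ' < Real.pi →
      s = w * (2 * Real.sin (θ / 2)) → s = w * (2 * Real.sin (θ' / 2)) → θ = θ' := by
    intro θ θ' h1 h2 h3 h4 h5 h6
    have h7 : Real.sin (θ / 2) = Real.sin (θ' / 2) := by
      have := h5.symm.trans h6
      have := mul_left_cancel₀ hw.ne' this
      linarith
    have := Real.injOn_sin (x₁ := θ / 2) (x₂ := θ' / 2) ⟨by linarith, by linarith⟩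
      ⟨by linarith, by linarith⟩ h7
    linarith
  have hn : 0 < n := by have := hP.1; omega
  set θ₀ := θ ⟨0, hn⟩ with hθ₀
  have hθ : ∀ (i : Fin n) (c a : ℂ) (θ : ℝ), IsArc R (Set.range P.vertices) w c a θ →
      P i = c + w * a → P (finRotate n i) = c + w * (a * cis θ) → θ = θ₀ := by
    intro i c' a' θ' h1 h2 h3
    exact hangle _ _ h1.pos h1.lt_pi (harc ⟨0, hn⟩).pos (harc ⟨0, hn⟩).lt_pi
      (hlen i c' a' θ' h1 h2 h3) (hlen _ _ _ _ (harc ⟨0, hn⟩) (hl _) (hr _))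
  have hall : ∀ i, θ i = θ₀ := fun i => hθ i _ _ _ (harc i) (hl i) (hr i)
  refine ⟨θ₀, c, a, fun i => hall i ▸ harc i, hl, fun i => hall i ▸ hr i, ?_⟩
  intro u y hu hy hx hxV
  obtain ⟨a', θ', τ, harc', h0, h1, hua⟩ := h.exists_isArc (Set.finite_range _) hcor hu hy hx hxV
  obtain ⟨k, hk1, hk2⟩ := h.exists_edge_of_isArc hP hfr harc'
  have hθ' := hθ k _ _ _ harc' hk1 hk2
  refine ⟨k, τ, h0, hθ' ▸ h1, ?_⟩
  have hcis : cis θ₀ - 1 ≠ 0 := by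
    intro h0
    have hp := (harc ⟨0, hn⟩).pos
    have hq := (harc ⟨0, hn⟩).lt_pi
    have := cis_eq_one (x := θ₀) (by linarith [Real.pi_pos]) (by linarith [Real.pi_pos])
      (sub_eq_zero.1 h0)
    linarith
  have e1 := hl k
  have e2 := hr k
  rw [hall] at e2
  rw [hθ'] at hk2
  -- Once the angle is known, the edge vector determines the initial direction of its arc.
  have : w * (cis θ₀ - 1) * a' = w * (cis θ₀ - 1) * a k := by
    linear_combination hk1 - hk2 - e1 + e2
  rw [hua, mul_left_cancel₀ (mul_ne_zero hw' hcis) this]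

/-- If a finite set of unit vectors is closed under rotation by `θ`, and the open arcs of length `θ`
that start at its points do not contain points of the set, then the set is a regular polygon. -/
theorem regular_of_rotation {D : Set ℂ} (hD : D.Nonempty) (hD1 : ∀ d ∈ D, ‖d‖ = 1) {θ : ℝ}
    (h0 : 0 < θ) (hstep : ∀ d ∈ D, d * cis θ ∈ D)
    (hdisj : ∀ d ∈ D, ∀ t, 0 ≤ t → t < θ → d * cis t ∈ D → t = 0) :
    D.ncard * θ = 2 * Real.pi ∧ ∀ d ∈ D, ∀ d' ∈ D, ∃ k : ℕ, d' = d * cis (k * θ) := by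
  have hpi := Real.pi_pos
  have hmem : ∀ d ∈ D, ∀ k : ℕ, d * cis (k * θ) ∈ D := by
    intro d hd k
    induction k with
    | zero => simpa
    | succ k ih =>
      have := hstep _ ih
      rw [mul_assoc, ← cis_add] at this
      rwa [Nat.cast_succ, add_one_mul]
  -- Removing the whole multiples of `θ` leaves an angle below `θ` between two points of `D`, so
  -- nothing is left.
  have hfloor : ∀ x : ℝ, 0 ≤ x → ∀ d ∈ D, d * cis x ∈ D → x = ⌊x / θ⌋₊ * θ := by
    intro x hx d hd hdx
    have h1 := Nat.floor_le (show 0 ≤ x / θ by positivity)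
    have h2 := Nat.lt_floor_add_one (x / θ)
    rw [le_div_iff₀ h0] at h1
    rw [div_lt_iff₀ h0] at h2
    have h3 := hdisj _ (hmem d hd ⌊x / θ⌋₊) (x - ⌊x / θ⌋₊ * θ) (by linarith) (by linarith)
      (by rw [mul_assoc, ← cis_add]; convert hdx using 3; ring)
    linarith
  have hall : ∀ d ∈ D, ∀ d' ∈ D, ∃ x, 0 ≤ x ∧ x < 2 * Real.pi ∧ d' = d * cis x := by
    intro d hd d' hd'
    have hd0 : d ≠ 0 := fun h => by have := hD1 d hd; rw [h] at this; simp at this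
    have h1 : d' = d * cis (arg (d' / d)) := by
      have := norm_mul_cis_arg (d' / d)
      rw [norm_div, hD1 d hd, hD1 d' hd', div_one, Complex.ofReal_one, one_mul] at this
      rw [this]; field_simp
    rcases le_or_gt 0 (arg (d' / d)) with h2 | h2
    · exact ⟨_, h2, by linarith [Complex.arg_le_pi (d' / d)], h1⟩
    · refine ⟨arg (d' / d) + Real.pi + Real.pi, by linarith [Complex.neg_pi_lt_arg (d' / d)],
        by linarith, ?_⟩
      rw [cis_add_pi, cis_add_pi, neg_neg]; exact h1
  obtain ⟨d₀, hd₀⟩ := hD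
  have hfull := hfloor (2 * Real.pi) (by positivity) d₀ hd₀
    (by rw [two_mul, cis_add_pi, cis_pi, neg_neg, mul_one]; exact hd₀)
  refine ⟨?_, ?_⟩
  · set N := ⌊2 * Real.pi / θ⌋₊ with hN
    have himg : D = (fun k : ℕ => d₀ * cis (k * θ)) '' (Set.Iio N) := by
      apply Set.Subset.antisymm
      · intro d hd
        obtain ⟨x, hx0, hx1, hx⟩ := hall d₀ hd₀ d hd
        have h1 := hfloor x hx0 d₀ hd₀ (hx ▸ hd)
        refine ⟨⌊x / θ⌋₊, ?_, by simp only [← h1]; exact hx.symm⟩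
        rw [h1, hfull] at hx1
        exact_mod_cast lt_of_mul_lt_mul_right hx1 h0.le
      · rintro _ ⟨k, -, rfl⟩
        exact hmem _ hd₀ k
    have hd0 : d₀ ≠ 0 := fun h => by have := hD1 d₀ hd₀; rw [h] at this; simp at this
    have hinj : Set.InjOn (fun k : ℕ => d₀ * cis (k * θ)) (Set.Iio N) := by
      have key : ∀ k j : ℕ, j < N → k ≤ j → d₀ * cis (k * θ) = d₀ * cis (j * θ) → k = j := by
        intro k j hj hkj he
        have h1 : cis (j * θ - k * θ) = 1 := by
          have h2 : cis (j * θ) = cis (j * θ - k * θ) * cis (k * θ) := by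
            rw [← cis_add]; congr 1; ring
          have h3 := mul_left_cancel₀ hd0 he
          rw [h2] at h3
          exact mul_right_cancel₀ (cis_ne_zero _) (by rw [one_mul, ← h3])
        have h4 : (k : ℝ) ≤ j := by exact_mod_cast hkj
        have h5 : (j : ℝ) < N := by exact_mod_cast hj
        have h6 : (0 : ℝ) ≤ k := by positivity
        have h7 := cis_eq_one (by nlinarith) (by rw [hfull]; nlinarith) h1
        have h8 : ((j : ℝ) - k) * θ = 0 := by linarith
        rcases mul_eq_zero.1 h8 with h9 | h9
        · have : (k : ℝ) = j := by linarith
          exact_mod_cast this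
        · linarith
      intro k hk j hj he
      rcases le_total k j with h1 | h1
      · exact key k j hj h1 he
      · exact (key j k hk h1 he.symm).symm
    rw [himg, hinj.ncard_image, Set.ncard_eq_toFinset_card']
    simp only [Set.toFinset_Iio, Nat.card_Iio]
    exact hfull.symm
  · intro d hd d' hd'
    obtain ⟨x, hx0, -, hx⟩ := hall d hd d' hd'
    exact ⟨⌊x / θ⌋₊, by rw [← hfloor x hx0 d hd (hx ▸ hd')]; exact hx⟩

namespace IsArcSystem

variable {n : ℕ} {P : Polygon ℂ n} {R : Set ℂ} {w θ : ℝ} {c a : Fin n → ℂ}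

/-- The two arcs share the direction at angle `(τ + θ) / 2` from `a i`. Diameters are unique in each
direction, so the centres agree, and for `τ > 0` the vertex `P j` would be an inner point of arc
`i`. -/
theorem eq_of_rotate (h : IsArcSystem P R w θ c a) (hR : IsReuleauxPolygon R w)
    (hP : IsConvexPolygon P) (hVR : Set.range P.vertices ⊆ R) {i j : Fin n} {τ : ℝ} (h0 : 0 ≤ τ)
    (h1 : τ < θ) (he : a j = a i * cis τ) : τ = 0 ∧ i = j := by
  have hi := h.isArc i
  have hj := h.isArc j
  obtain ⟨e1, -⟩ := hi.inside ((τ + θ) / 2) (by linarith) (by linarith)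
  obtain ⟨e2, -⟩ := hj.inside ((θ - τ) / 2) (by linarith) (by linarith)
  rw [he, mul_assoc (a i), ← cis_add, show τ + (θ - τ) / 2 = (τ + θ) / 2 by ring] at e2
  have e3 := hR.eq_of_add_mem (by simp [hi.unit]) (hVR hi.center) e1 (hVR hj.center) e2
  have e4 := h.left j
  rw [e3, he] at e4
  rcases h0.eq_or_lt with h2 | h2
  · refine ⟨h2.symm, hP.injective ?_⟩
    rw [h.left i, e4, ← h2, cis_zero, mul_one]
  · exact absurd ⟨j, e4⟩ (hi.inside τ h2 h1).2

/-- Otherwise one diameter would run from the centre of arc `i`, a vertex, to an inner point of arc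
`i`, and in reverse from the centre of arc `j` to an inner point of arc `j`. That inner point is
then the centre of arc `i`, yet inner points are not vertices. -/
theorem ne_neg_rotate (h : IsArcSystem P R w θ c a) (hR : IsReuleauxPolygon R w)
    (hVR : Set.range P.vertices ⊆ R) {i j : Fin n} {τ : ℝ} (h0 : 0 ≤ τ)
    (h1 : τ < θ) : a j ≠ -(a i * cis τ) := by
  intro he
  have hi := h.isArc i
  have hj := h.isArc j
  obtain ⟨e1, -⟩ := hi.inside ((τ + θ) / 2) (by linarith) (by linarith)
  obtain ⟨e2, e2'⟩ := hj.inside ((θ - τ) / 2) (by linarith) (by linarith)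
  rw [he, neg_mul, mul_assoc (a i), ← cis_add, show τ + (θ - τ) / 2 = (τ + θ) / 2 by ring] at e2 e2'
  have e3 := hR.eq_of_add_mem (by simp [hi.unit]) (hVR hi.center) e1 e2
    (by rw [mul_neg, neg_add_cancel_right]; exact hVR hj.center)
  rw [e3] at e2'
  exact e2' hi.center

/-- The initial directions of the arcs of an arc system, and their opposites. -/
def directions (a : Fin n → ℂ) : Set ℂ := {z | ∃ i, z = a i ∨ z = -a i}

theorem norm_of_mem_directions (h : IsArcSystem P R w θ c a) {d : ℂ} (hd : d ∈ directions a) :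
    ‖d‖ = 1 := by
  obtain ⟨i, rfl | rfl⟩ := hd
  · exact (h.isArc i).unit
  · rw [norm_neg]; exact (h.isArc i).unit

theorem directions_disjoint (h : IsArcSystem P R w θ c a) (hR : IsReuleauxPolygon R w)
    (hP : IsConvexPolygon P) (hVR : Set.range P.vertices ⊆ R) {d : ℂ} (hd : d ∈ directions a)
    {t : ℝ} (h0 : 0 ≤ t) (h1 : t < θ) (hdt : d * cis t ∈ directions a) : t = 0 := by
  obtain ⟨i, rfl | rfl⟩ := hd <;> obtain ⟨j, hj | hj⟩ := hdt
  · exact (h.eq_of_rotate hR hP hVR h0 h1 hj.symm).1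
  · exact absurd (by rw [hj, neg_neg]) (h.ne_neg_rotate hR hVR (i := i) (j := j) h0 h1)
  · exact absurd (by rw [← hj]; ring) (h.ne_neg_rotate hR hVR (i := i) (j := j) h0 h1)
  · exact (h.eq_of_rotate hR hP hVR (i := i) (j := j) h0 h1 (by linear_combination hj)).1

theorem directions_eq (a : Fin n → ℂ) :
    directions a = Set.range a ∪ Set.range fun i => -a i := by
  ext z
  constructor
  · rintro ⟨i, rfl | rfl⟩
    · exact Or.inl ⟨i, rfl⟩
    · exact Or.inr ⟨i, rfl⟩
  · rintro (⟨i, rfl⟩ | ⟨i, rfl⟩)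
    · exact ⟨i, Or.inl rfl⟩
    · exact ⟨i, Or.inr rfl⟩

theorem finite_directions (a : Fin n → ℂ) : (directions a).Finite := by
  rw [directions_eq]
  exact (Set.finite_range _).union (Set.finite_range _)

/-- Take a direction `u` slightly past `b = d * cis θ`, parallel to no segment between vertices. One
end of its diameter is not a vertex, so `u` lies in an open arc beginning at some `d'` in
`directions a`. This `d'` is not strictly between `b` and `u` by the choice of `u`, nor strictly
between `d` and `b` by disjointness, so `d' = b`. -/
theorem rotate_mem_directions (h : IsArcSystem P R w θ c a) (hR : IsReuleauxPolygon R w)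
    (hP : IsConvexPolygon P) (hVR : Set.range P.vertices ⊆ R) {d : ℂ} (hd : d ∈ directions a) :
    d * cis θ ∈ directions a := by
  have hw' : (w : ℂ) ≠ 0 := by exact_mod_cast hR.pos.ne'
  obtain ⟨i₀, -⟩ := id hd
  have hθ0 := (h.isArc i₀).pos
  have hθ1 := (h.isArc i₀).lt_pi
  set b := d * cis θ with hb
  have hb1 : ‖b‖ = 1 := by rw [hb, norm_mul, norm_cis, mul_one, h.norm_of_mem_directions hd]
  have hb0 : b ≠ 0 := fun h => by rw [h] at hb1; simp at hb1
  set V := Set.range P.vertices with hV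
  set F : Set ℂ := (fun p : ℂ × ℂ => (p.1 - p.2) / w) '' (V ×ˢ V) ∪ directions a with hF
  have hFfin : F.Finite :=
    (((Set.finite_range _).prod (Set.finite_range _)).image _).union (finite_directions a)
  have hF' : (F \ {b}).Finite := hFfin.sdiff
  have hct : Continuous fun t : ℝ => b * cis t := continuous_const.mul continuous_cis
  have hev : ∀ᶠ t in nhds (0 : ℝ), b * cis t ∉ F \ {b} := by
    refine hct.continuousAt.eventually (hF'.isClosed.isOpen_compl.mem_nhds ?_)
    simp
  obtain ⟨δ, hδ, hball⟩ := Metric.eventually_nhds_iff.1 hev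
  have havoid : ∀ t, 0 < t → t < δ → t < θ → b * cis t ∉ F := by
    intro t h1 h2 h3 h4
    refine hball (y := t) (by rw [Real.dist_eq, sub_zero, abs_of_pos h1]; exact h2) ⟨h4, ?_⟩
    intro h5
    have h6 : cis t = 1 := mul_left_cancel₀ hb0 (by rw [mul_one]; exact h5)
    have := cis_eq_one (by linarith) (by linarith) h6
    linarith
  set t := min δ θ / 2 with ht
  have hm : 0 < min δ θ := lt_min hδ hθ0
  have ht0 : 0 < t := by linarith
  have htδ : t < δ := by have := min_le_left δ θ; linarith
  have htθ : t < θ := by have := min_le_right δ θ; linarith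
  set u := b * cis t with hu
  have hu1 : ‖u‖ = 1 := by rw [hu, norm_mul, norm_cis, mul_one, hb1]
  have huF : u ∉ F := havoid t ht0 htδ htθ
  obtain ⟨y, hy, hx⟩ := hR.exists_add_mem hu1
  have hcov : ∃ d' ∈ directions a, ∃ σ, 0 < σ ∧ σ < θ ∧ u = d' * cis σ := by
    by_cases hxV : y + w * u ∈ V
    · by_cases hyV : y ∈ V
      · exfalso
        apply huF
        refine Or.inl ⟨(y + w * u, y), ⟨hxV, hyV⟩, ?_⟩
        simp only [add_sub_cancel_left]
        field_simp
      · obtain ⟨i, σ, h1, h2, h3⟩ := h.cover (-u) (y + w * u) (by rwa [norm_neg]) hx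
          (by rwa [mul_neg, add_neg_cancel_right]) (by rwa [mul_neg, add_neg_cancel_right])
        exact ⟨-a i, ⟨i, Or.inr rfl⟩, σ, h1, h2, by linear_combination -h3⟩
    · obtain ⟨i, σ, h1, h2, h3⟩ := h.cover u y hu1 hy hx hxV
      exact ⟨a i, ⟨i, Or.inl rfl⟩, σ, h1, h2, h3⟩
  obtain ⟨d', hd', σ, hσ0, hσ1, hud⟩ := hcov
  have hd'b : d' = b * cis (t - σ) := by
    rw [sub_eq_add_neg, cis_add, ← mul_assoc, ← hu, hud, mul_assoc, cis_mul_neg, mul_one]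
  rcases lt_trichotomy σ t with h1 | h1 | h1
  · exact absurd (Or.inr (hd'b ▸ hd')) (havoid (t - σ) (by linarith) (by linarith) (by linarith))
  · rw [h1, sub_self, cis_zero, mul_one] at hd'b
    exact hd'b ▸ hd'
  · rw [hb, mul_assoc, ← cis_add] at hd'b
    have := h.directions_disjoint hR hP hVR hd (t := θ + (t - σ)) (by linarith) (by linarith)
      (hd'b ▸ hd')
    linarith

theorem injective (h : IsArcSystem P R w θ c a) (hR : IsReuleauxPolygon R w)
    (hP : IsConvexPolygon P) (hVR : Set.range P.vertices ⊆ R) : Function.Injective a := by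
  intro i j hij
  exact (h.eq_of_rotate hR hP hVR le_rfl (h.isArc i).pos (by rw [cis_zero, mul_one, hij])).2

theorem ne_neg (h : IsArcSystem P R w θ c a) (hR : IsReuleauxPolygon R w)
    (hVR : Set.range P.vertices ⊆ R) (i j : Fin n) : a j ≠ -a i := by
  have := h.ne_neg_rotate hR hVR (i := i) (j := j) le_rfl (h.isArc i).pos
  rwa [cis_zero, mul_one] at this

theorem ncard_directions (h : IsArcSystem P R w θ c a) (hR : IsReuleauxPolygon R w)
    (hP : IsConvexPolygon P) (hVR : Set.range P.vertices ⊆ R) : (directions a).ncard = 2 * n := by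
  have hinj := h.injective hR hP hVR
  have hc : ∀ f : Fin n → ℂ, Function.Injective f → (Set.range f).ncard = n := by
    intro f hf
    rw [← Set.image_univ, Set.ncard_image_of_injective _ hf, Set.ncard_univ, Nat.card_eq_fintype_card,
      Fintype.card_fin]
  rw [directions_eq, Set.ncard_union_eq, hc _ hinj, hc (fun i => -a i) (neg_injective.comp hinj), two_mul]
  · rw [Set.disjoint_left]
    rintro _ ⟨j, rfl⟩ ⟨i, hi⟩
    exact h.ne_neg hR hVR i j hi.symm

/-- The `2 n` directions form a regular polygon with step `θ`, so `2 n θ = 2 π`. -/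
theorem angle_eq (h : IsArcSystem P R w θ c a) (hR : IsReuleauxPolygon R w)
    (hP : IsConvexPolygon P) (hVR : Set.range P.vertices ⊆ R) : θ = Real.pi / n ∧
      ∀ d ∈ directions a, ∀ d' ∈ directions a, ∃ k : ℕ, d' = d * dir n k := by
  have hn : 0 < n := by have := hP.1; omega
  have hreg := regular_of_rotation (D := directions a) ⟨a ⟨0, hn⟩, ⟨0, hn⟩, Or.inl rfl⟩
    (fun d hd => h.norm_of_mem_directions hd) (h.isArc ⟨0, hn⟩).pos
    (fun d hd => h.rotate_mem_directions hR hP hVR hd)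
    (fun d hd t h0 h1 => h.directions_disjoint hR hP hVR hd h0 h1)
  have hn' : (n : ℝ) ≠ 0 := by positivity
  have hθ : θ = Real.pi / n := by
    have := hreg.1
    rw [h.ncard_directions hR hP hVR] at this
    push_cast at this
    field_simp
    linarith
  refine ⟨hθ, fun d hd d' hd' => ?_⟩
  obtain ⟨k, hk⟩ := hreg.2 d hd d' hd'
  refine ⟨k, ?_⟩
  rw [hk, hθ, dir]
  congr 2
  push_cast; ring

theorem mul_dir_mem_directions (h : IsArcSystem P R w θ c a) (hR : IsReuleauxPolygon R w)
    (hP : IsConvexPolygon P) (hVR : Set.range P.vertices ⊆ R) {d : ℂ} (hd : d ∈ directions a)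
    (t : ℤ) : d * dir n t ∈ directions a := by
  have hn : n ≠ 0 := by have := hP.1; omega
  have hθ := (h.angle_eq hR hP hVR).1
  have key : ∀ k : ℕ, d * dir n k ∈ directions a := by
    intro k
    induction k with
    | zero => simpa
    | succ k ih =>
      have := h.rotate_mem_directions hR hP hVR ih
      rw [Nat.cast_succ, dir_add, ← mul_assoc]
      convert this using 2
      rw [hθ, dir]; congr 1; push_cast; ring
  have h2 : dir n (t % (2 * n)) = dir n t := by
    have h1 : Function.Periodic (dir n) (2 * n : ℤ) := dir_add_two_mul hn
    have := h1.int_mul (t / (2 * n)) (t % (2 * n))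
    rw [← this]; congr 1
    have := Int.emod_add_mul_ediv t (2 * n)
    simp only [Int.cast_id]
    linarith
  have h3 := Int.emod_nonneg t (show (2 * n : ℤ) ≠ 0 by omega)
  have := key (t % (2 * n)).toNat
  rwa [Int.toNat_of_nonneg h3, h2] at this

end IsArcSystem

/-! ### From a Reinhardt polygon to a path. -/

theorem cross_mul_dir (l : ℂ) (n : ℕ) (s t : ℤ) :
    cross (l * dir n s) (l * dir n t) = ‖l‖ ^ 2 * Real.sin ((t - s) * Real.pi / n) := by
  rw [cross_mul_mul, cross, conj_dir, ← dir_add, dir, cis_im]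
  congr 3; push_cast; ring

/-- The edges of a Reinhardt polygon are the edges of a path. -/
theorem IsReinhardtPolygon.exists_isPath {n : ℕ} {P : Polygon ℂ n} (hRe : IsReinhardtPolygon P) :
    ∃ ε l A, IsAntiperiodic n ε ∧ l ≠ 0 ∧ IsPath n ε l A ∧ Set.range P.vertices = Set.range A := by
  obtain ⟨hP, heq, R, w, hR, hfr, hcor⟩ := hRe
  have hVR : Set.range P.vertices ⊆ R := by
    rintro _ ⟨i, rfl⟩; exact hR.frontier_subset (hfr i)
  obtain ⟨θ, c, a, h⟩ := hR.exists_isArcSystem hP heq hfr hcor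
  have hn3 := hP.1
  have hn : n ≠ 0 := by omega
  have hnR : (0 : ℝ) < n := by exact_mod_cast Nat.pos_of_ne_zero hn
  have hpi := Real.pi_pos
  obtain ⟨hθ, hgen⟩ := h.angle_eq hR hP hVR
  have hinj := h.injective hR hP hVR
  have hw' : (w : ℂ) ≠ 0 := by exact_mod_cast hR.pos.ne'
  have hdir1 : cis θ = dir n 1 := by rw [hθ, dir]; congr 1; push_cast; ring
  set a₀ := a ⟨0, by omega⟩ with ha₀
  have ha₀1 : ‖a₀‖ = 1 := (h.isArc _).unit
  have ha₀0 : a₀ ≠ 0 := fun h => by rw [h] at ha₀1; simp at ha₀1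
  -- Edge `i` is `w * a i * (cis θ - 1)` and `cis θ = dir n 1`, so this is the edge vector belonging
  -- to the direction `a₀`.
  set l := w * (dir n 1 - 1) * a₀ with hl
  have hl0 : l ≠ 0 := mul_ne_zero (mul_ne_zero hw' (sub_ne_zero.2 (dir_one_ne_one hn))) ha₀0
  have hl1 : 0 < ‖l‖ ^ 2 := by positivity
  have ha₀D : a₀ ∈ IsArcSystem.directions a := ⟨_, Or.inl rfl⟩
  have hedge : ∀ i t, a i = a₀ * dir n t → P (finRotate n i) = P i + l * dir n t := by
    intro i t hi
    rw [h.left i, h.right i, hdir1, hi, hl]; ring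
  classical
  set ε : ℤ → Bool := fun t => decide (∃ i, a i = a₀ * dir n t) with hε
  have hεt : ∀ t, ε t = true ↔ ∃ i, a i = a₀ * dir n t := fun t => by simp [hε]
  have hεf : ∀ t, ε t = false ↔ ¬∃ i, a i = a₀ * dir n t := fun t => by simp [hε]
  have hanti : IsAntiperiodic n ε := by
    intro t
    rcases h1 : ε t with _ | _
    · obtain ⟨i, hi | hi⟩ := h.mul_dir_mem_directions hR hP hVR ha₀D t
      · exact absurd ⟨i, hi.symm⟩ ((hεf t).1 h1)
      · rw [Bool.not_false, hεt]
        exact ⟨i, by rw [dir_add_self hn, mul_neg, hi, neg_neg]⟩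
    · obtain ⟨i, hi⟩ := (hεt t).1 h1
      rw [Bool.not_true, hεf]
      rintro ⟨j, hj⟩
      rw [dir_add_self hn, mul_neg, ← hi] at hj
      exact h.ne_neg hR hVR i j hj
  -- Consecutive sides of the polygon belong to consecutive true letters: a convex polygon runs
  -- through its edge directions in cyclic order.
  have hsucc : ∀ i t, a i = a₀ * dir n t → ∃ g : ℕ, 0 < g ∧ a (finRotate n i) = a₀ * dir n (t + g) ∧
      ∀ g' : ℕ, 0 < g' → g' < g → ε (t + g') = false := by
    intro i t hi
    obtain ⟨k, hk⟩ := hgen (a i) ⟨i, Or.inl rfl⟩ (a (finRotate n i)) ⟨_, Or.inl rfl⟩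
    set g := k % (2 * n) with hg
    have hg2 : g < 2 * n := Nat.mod_lt _ (by omega)
    have hkg : dir n k = dir n g := by
      have h1 : Function.Periodic (fun k : ℕ => dir n k) (2 * n) := by
        intro k; simp only [Nat.cast_add, Nat.cast_mul, Nat.cast_ofNat, dir_add_two_mul hn]
      exact (h1.map_mod_nat k).symm
    rw [hkg, hi, mul_assoc, ← dir_add] at hk
    have hei := hedge i t hi
    have hej := hedge _ _ hk
    have hpos : 0 < Real.sin (g * Real.pi / n) := by
      have h1 := hP.cross_pos (hP.finRotate_finRotate_ne i) (hP.finRotate_ne (finRotate n i))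
      rw [hej, hei, show P i + l * dir n t + l * dir n (t + g) - P i =
        l * dir n t + l * dir n (t + g) by ring, add_sub_cancel_left, cross_add_right, cross_self,
        cross_mul_dir, zero_add] at h1
      push_cast at h1
      rw [add_sub_cancel_left] at h1
      exact (mul_pos_iff_of_pos_left hl1).1 h1
    have hg0 : 0 < g := by
      rcases Nat.eq_zero_or_pos g with h0 | h0
      · rw [h0] at hpos; simp at hpos
      · exact h0
    have hgn : g < n := by
      by_contra! hc
      have h1 : (n : ℝ) ≤ g := by exact_mod_cast hc
      have h2 : (g : ℝ) < 2 * n := by exact_mod_cast hg2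
      have h3 : Real.sin (g * Real.pi / n - Real.pi) ≥ 0 := by
        apply Real.sin_nonneg_of_nonneg_of_le_pi
        · rw [sub_nonneg, le_div_iff₀ hnR]; nlinarith
        · rw [sub_le_iff_le_add, div_le_iff₀ hnR]; nlinarith
      rw [Real.sin_sub_pi] at h3
      linarith
    refine ⟨g, hg0, hk, fun g' h1 h2 => ?_⟩
    rw [hεf]
    rintro ⟨m, hm⟩
    have hem := hedge m _ hm
    have h1' : (0 : ℝ) < g' := by exact_mod_cast h1
    have h2' : (g' : ℝ) < g := by exact_mod_cast h2
    have hgn' : (g : ℝ) < n := by exact_mod_cast hgn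
    have hs1 : 0 < Real.sin (g * Real.pi / n - g' * Real.pi / n) := by
      apply Real.sin_pos_of_pos_of_lt_pi
      · rw [← sub_div, ← sub_mul]; apply div_pos _ hnR; nlinarith
      · rw [← sub_div, ← sub_mul, div_lt_iff₀ hnR]; nlinarith
    have hs2 : 0 < Real.sin (g' * Real.pi / n) := by
      apply Real.sin_pos_of_pos_of_lt_pi
      · positivity
      · rw [div_lt_iff₀ hnR]; nlinarith
    -- An edge `m` with a direction between those of edge `i` and its successor is a positive
    -- combination of the two. Take determinants with `P m - P (finRotate n i)`: the right side is
    -- positive, since `P m` is to the left of edge `i` and not to the right of its successor; the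
    -- left side is nonpositive, since `P (finRotate n i)` is not to the right of edge `m`.
    have hcomb : (Real.sin (g * Real.pi / n) : ℂ) * (l * dir n (t + g')) =
        Real.sin (g * Real.pi / n - g' * Real.pi / n) * (l * dir n t) +
          Real.sin (g' * Real.pi / n) * (l * dir n (t + g)) := by
      have := sin_mul_cis (g' * Real.pi / n) (g * Real.pi / n)
      have d1 : dir n (t + g') = dir n t * cis (g' * Real.pi / n) := by
        rw [dir_add, dir, dir]; congr 2
      have d2 : dir n (t + g) = dir n t * cis (g * Real.pi / n) := by
        rw [dir_add, dir, dir]; congr 2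
      rw [d1, d2]
      linear_combination l * dir n t * this
    have hsg : ∀ t : ℤ, ∀ d d' : ℕ, a₀ * dir n (t + d) = a₀ * dir n (t + d') → d ≤ d' → d' < n →
        d = d' := by
      intro t d d' he hle hlt
      have h3 := cross_mul_dir a₀ n (t + d) (t + d')
      rw [he, cross_self, ha₀1] at h3
      by_contra hne
      have h4 : (d : ℝ) < d' := by exact_mod_cast lt_of_le_of_ne hle hne
      have h5 : (d' : ℝ) < n := by exact_mod_cast hlt
      have h6 : (0 : ℝ) ≤ d := by positivity
      have : 0 < Real.sin ((((t + d' : ℤ) : ℝ) - ((t + d : ℤ) : ℝ)) * Real.pi / n) := by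
        push_cast
        rw [add_sub_add_left_eq_sub]
        apply Real.sin_pos_of_pos_of_lt_pi
        · apply div_pos _ hnR; nlinarith
        · rw [div_lt_iff₀ hnR]; nlinarith
      linarith
    have hmi : m ≠ i := by
      rintro rfl
      rw [hi] at hm
      have := hsg t 0 g' (by simpa using hm) (by omega) (by omega)
      omega
    have hmr : m ≠ finRotate n i := by
      rintro rfl
      rw [hk] at hm
      have := hsg t g' g hm.symm (by omega) (by omega)
      omega
    have c1 := hP.cross_pos hmi hmr
    have c2 : 0 ≤ cross (l * dir n (t + g)) (P m - P (finRotate n i)) := by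
      rw [show l * dir n (t + g) = P (finRotate n (finRotate n i)) - P (finRotate n i) by
        rw [hej]; ring]
      by_cases h3 : m = finRotate n (finRotate n i)
      · rw [h3, cross_self]
      · exact (hP.cross_pos hmr h3).le
    have c3 : 0 ≤ cross (l * dir n (t + g')) (P (finRotate n i) - P m) := by
      rw [show l * dir n (t + g') = P (finRotate n m) - P m by rw [hem]; ring]
      by_cases h3 : finRotate n i = finRotate n m
      · rw [h3, cross_self]
      · by_cases h4 : finRotate n i = m
        · exact absurd h4.symm hmr
        · exact (hP.cross_pos h4 h3).le
    have c4 := congrArg (fun z => cross z (P m - P (finRotate n i))) hcomb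
    simp only [cross_add_left, cross_ofReal_mul_left] at c4
    have c5 : cross (l * dir n t) (P m - P (finRotate n i)) =
        cross (P (finRotate n i) - P i) (P m - P i) := by
      rw [hei, add_sub_cancel_left, ← sub_sub, cross_sub_right _ _ (l * dir n t), cross_self,
        sub_zero]
    have c6 : cross (l * dir n (t + g')) (P m - P (finRotate n i)) =
        -cross (l * dir n (t + g')) (P (finRotate n i) - P m) := by
      rw [cross_sub_right, cross_sub_right]; ring
    rw [c5, c6] at c4
    have m1 := mul_pos hs1 c1
    have m2 := mul_nonneg hs2.le c2
    have m3 := mul_nonneg hpos.le c3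
    linarith
  -- At time `t` the path waits at the initial vertex of the first edge whose position is at least
  -- `t`.
  have hnext : ∀ t, ∃ i, ∃ r : ℕ, a i = a₀ * dir n (t + r) ∧ ∀ r' < r, ε (t + r') = false := by
    intro t
    have hex : ∃ r : ℕ, ε (t + r) = true := by
      rcases h1 : ε t with _ | _
      · exact ⟨n, by rw [hanti, h1]; rfl⟩
      · exact ⟨0, by simpa using h1⟩
    obtain ⟨i, hi⟩ := (hεt _).1 (Nat.find_spec hex)
    exact ⟨i, Nat.find hex, hi, fun r' hr => by simpa using Nat.find_min hex hr⟩
  choose f r hf hr using hnext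
  have huniq : ∀ t i (s : ℕ), a i = a₀ * dir n (t + s) → (∀ s' < s, ε (t + s') = false) →
      f t = i := by
    intro t i s h1 h2
    have h3 : r t = s := by
      rcases lt_trichotomy (r t) s with h4 | h4 | h4
      · have := h2 _ h4
        rw [(hεt _).2 ⟨_, hf t⟩] at this
        exact absurd this (by simp)
      · exact h4
      · have := hr t _ h4
        rw [(hεt _).2 ⟨_, h1⟩] at this
        exact absurd this (by simp)
    apply hinj
    rw [hf, h1, h3]
  refine ⟨ε, l, fun t => P (f t), hanti, hl0, ⟨fun t => ?_, fun t => ?_⟩, ?_⟩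
  · rcases h1 : ε t with _ | _
    · simp only [Bool.false_eq_true, if_false, add_zero]
      congr 1
      have h2 : r t ≠ 0 := by
        intro h0
        have := hf t
        rw [h0, Nat.cast_zero, add_zero] at this
        rw [(hεt t).2 ⟨_, this⟩] at h1
        exact absurd h1 (by simp)
      refine huniq _ _ (r t - 1) ?_ fun s hs => ?_
      · rw [hf t]; congr 2; omega
      · have := hr t (s + 1) (by omega)
        rwa [Nat.cast_succ, add_comm (s : ℤ), ← add_assoc] at this
    · obtain ⟨i, hi⟩ := (hεt t).1 h1
      have h2 : f t = i := huniq t i 0 (by simpa using hi) (by simp)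
      obtain ⟨g, hg0, hg1, hg2⟩ := hsucc i t hi
      have h3 : f (t + 1) = finRotate n i := by
        refine huniq _ _ (g - 1) ?_ fun s hs => ?_
        · rw [hg1]; congr 2; omega
        · have := hg2 (s + 1) (by omega) (by omega)
          rwa [Nat.cast_succ, add_comm (s : ℤ), ← add_assoc] at this
      simp only [if_true, h2, h3]
      exact hedge i t hi
  · congr 1
    refine huniq _ _ (r t) ?_ fun s hs => ?_
    · rw [hf t, add_right_comm, dir_add_two_mul hn]
    · rw [add_right_comm, hanti.two_mul]
      exact hr t s hs
  · apply Set.Subset.antisymm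
    · rintro _ ⟨i, rfl⟩
      obtain ⟨k, hk⟩ := hgen a₀ ha₀D (a i) ⟨i, Or.inl rfl⟩
      exact ⟨k, by simp only; rw [huniq k i 0 (by simpa using hk) (by simp)]⟩
    · rintro _ ⟨t, rfl⟩
      exact ⟨_, rfl⟩

/-! ### Periodic sequences, their partial sums, and runs of a word. -/

/-- The entries of a list, repeated periodically. -/
def cyc (L : List ℕ) (i : ℕ) : ℕ := L.getD (i % L.length) 0

theorem cyc_add_length (L : List ℕ) (i : ℕ) : cyc L (i + L.length) = cyc L i := by
  simp [cyc]

theorem cyc_of_lt {L : List ℕ} {i : ℕ} (hi : i < L.length) : cyc L i = L[i] := by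
  simp [cyc, Nat.mod_eq_of_lt hi, hi]

theorem sum_cyc (L : List ℕ) : ∑ i ∈ Finset.range L.length, cyc L i = L.sum := by
  rw [Finset.sum_range, ← Fin.sum_univ_getElem L]
  exact Finset.sum_congr rfl fun i _ => cyc_of_lt i.isLt

theorem getD_flatten_replicate (L : List ℕ) (r j : ℕ) (hj : j < r * L.length) :
    (List.replicate r L).flatten.getD j 0 = L.getD (j % L.length) 0 := by
  induction r generalizing j with
  | zero => simp at hj
  | succ r ih =>
    rw [List.replicate_succ, List.flatten_cons]
    rcases lt_or_ge j L.length with h | h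
    · rw [List.getD_append _ _ _ _ h, Nat.mod_eq_of_lt h]
    · rw [List.getD_append_right _ _ _ _ h, ih _ (by rw [add_one_mul] at hj; omega),
        ← Nat.mod_eq_sub_mod h]

theorem cyc_flatten_replicate {L : List ℕ} (hL : L ≠ []) {r : ℕ} (hr : 0 < r) (i : ℕ) :
    cyc (List.replicate r L).flatten i = cyc L i := by
  have hL0 := List.length_pos_iff.2 hL
  have hlen : (List.replicate r L).flatten.length = r * L.length := by simp
  have hlt : i % (List.replicate r L).flatten.length < r * L.length := by
    rw [hlen]; exact Nat.mod_lt _ (by positivity)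
  rw [cyc, getD_flatten_replicate _ _ _ hlt, hlen, Nat.mod_mul_left_mod, cyc]

section PartialSums

variable {K : ℕ → ℕ} {p m : ℕ}

/-- The partial sums of a sequence. -/
def psum (K : ℕ → ℕ) (i : ℕ) : ℕ := ∑ j ∈ Finset.range i, K j

theorem psum_succ (K : ℕ → ℕ) (i : ℕ) : psum K (i + 1) = psum K i + K i :=
  Finset.sum_range_succ _ _

theorem psum_add_of_periodic (hK : ∀ i, K (i + p) = K i) (hm : psum K p = m) (i : ℕ) :
    psum K (i + p) = psum K i + m := by
  induction i with
  | zero => rw [zero_add, hm]; simp [psum]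
  | succ i ih => rw [show i + 1 + p = i + p + 1 by ring, psum_succ, ih, hK, psum_succ]; ring

theorem psum_shift (hK : ∀ i, K (i + p) = K i) : psum (fun i => K (i + 1)) p = psum K p := by
  have h1 := Finset.sum_range_succ K p
  have h2 := Finset.sum_range_succ' K p
  have h3 := hK 0
  rw [zero_add] at h3
  simp only [psum]
  omega

theorem exists_psum_add (K : ℕ → ℕ) (i s : ℕ) (hs : s < psum K i) :
    ∃ j r, r < K j ∧ s = psum K j + r := by
  induction i with
  | zero => simp [psum] at hs
  | succ i ih =>
    rcases lt_or_ge s (psum K i) with h | h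
    · exact ih h
    · rw [psum_succ] at hs
      exact ⟨i, s - psum K i, by omega, by omega⟩

theorem psum_strictMono (hK : ∀ i, 0 < K i) : StrictMono (psum K) :=
  strictMono_nat_of_lt_succ fun i => by rw [psum_succ]; have := hK i; omega

end PartialSums

theorem bodd_of_odd {k : ℕ} (hk : Odd k) : k.bodd = true := by
  obtain ⟨z, rfl⟩ := hk
  rw [Nat.bodd_add, Nat.bodd_mul]
  rfl

theorem IsAntiperiodic.apply_add_mul {n : ℕ} {ε : ℤ → Bool} (hε : IsAntiperiodic n ε) (t : ℤ)
    (k : ℕ) : ε (t + k * n) = (ε t ^^ k.bodd) := by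
  induction k with
  | zero => simp
  | succ k ih =>
    rw [Nat.cast_succ, add_one_mul, ← add_assoc, hε, ih, Nat.bodd_succ]
    cases ε t <;> cases k.bodd <;> rfl

theorem IsAntiperiodic.add_int_mul {n : ℕ} {ε : ℤ → Bool} (hε : IsAntiperiodic n ε) (t q : ℤ) :
    ε (t + q * (2 * n)) = ε t :=
  (Function.Periodic.int_mul (c := (2 * n : ℤ)) hε.two_mul q) t

/-- The `i`-th run of the word `ε`, reflected as often as necessary, has length at least `K i`. -/
def IsRun (n : ℕ) (ε : ℤ → Bool) (K : ℕ → ℕ) (t₀ : ℤ) : Prop :=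
  ∀ i r : ℕ, r < K i → ε (t₀ + psum K i + i * n + r) = false

/-- In unreflected form, the letters of run `i` are given by the parity of `i`. Run `i + L` has the
same length, begins `m` later and has the opposite parity since `L` is odd. The first `p` runs fill
`n` consecutive positions, and the antiperiod `n` carries the conclusion to all `t`. -/
theorem IsRun.isAntiperiodic {n p L m : ℕ} {ε : ℤ → Bool} {K : ℕ → ℕ} {t₀ : ℤ}
    (h : IsRun n ε K t₀) (hε : IsAntiperiodic n ε) (hn : n ≠ 0) (hp : psum K p = n)
    (hK : ∀ i, K (i + L) = K i) (hL : Odd L) (hm : psum K L = m) : IsAntiperiodic m ε := by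
  intro t
  have hs0 := Int.emod_nonneg (t - t₀) (show (n : ℤ) ≠ 0 by omega)
  have hs1 := Int.emod_lt_of_pos (t - t₀) (show (0 : ℤ) < n by omega)
  have hs2 := Int.emod_add_mul_ediv (t - t₀) n
  obtain ⟨i, r, hr, hs⟩ := exists_psum_add K p ((t - t₀) % n).toNat (by rw [hp]; omega)
  have e1 := h i r hr
  have e2 := h (i + L) r (by rwa [hK])
  rw [psum_add_of_periodic hK hm] at e2
  set x : ℤ := t₀ + psum K i + i * n + r with hx
  have e3 : ε (x + m) = true := by
    have := hε.apply_add_mul (x + m) L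
    rw [bodd_of_odd hL] at this
    rw [show x + m + (L : ℤ) * n = t₀ + (psum K i + m : ℕ) + (i + L : ℕ) * n + r by
      rw [hx]; push_cast; ring, e2] at this
    rcases h0 : ε (x + m) with _ | _
    · rw [h0] at this; simp at this
    · rfl
  set q := (t - t₀) / n - i with hq
  have ht : t = x + q * n := by
    have : ((t - t₀) % n) = psum K i + r := by omega
    rw [hx, hq]
    rw [this] at hs2
    linear_combination -hs2
  rcases Int.even_or_odd' q with ⟨z, hz | hz⟩
  · rw [ht, hz, show x + 2 * z * (n : ℤ) + m = x + m + z * (2 * n) by ring,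
      show x + 2 * z * (n : ℤ) = x + z * (2 * n) by ring, hε.add_int_mul, hε.add_int_mul, e1, e3]
    rfl
  · rw [ht, hz, show x + (2 * z + 1) * (n : ℤ) + m = x + m + n + z * (2 * n) by ring,
      show x + (2 * z + 1) * (n : ℤ) = x + n + z * (2 * n) by ring, hε.add_int_mul, hε.add_int_mul,
      hε, hε, e1, e3]
    rfl

theorem angle_diag {n : ℕ} (hn : n ≠ 0) {l : ℂ} (hl : l ≠ 0) (j k : ℤ) :
    InnerProductGeometry.angle (diag n l j) (diag n l k) =
      Real.arccos (Real.cos ((k - j : ℤ) * Real.pi / n)) := by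
  have hw := width_pos hn hl
  rw [InnerProductGeometry.angle, norm_diag, norm_diag]
  congr 1
  rw [show k = j + (k - j) by ring, diag_add]
  conv_lhs => rw [← mul_one (diag n l j), mul_assoc, one_mul]
  rw [inner_mul_mul, norm_diag, dir, ← cis_zero, inner_cis_cis, sub_zero, add_sub_cancel_left]
  field_simp

theorem angle_diag_add {n : ℕ} (hn : n ≠ 0) {l : ℂ} (hl : l ≠ 0) (j : ℤ) {k : ℕ} (hk : k ≤ n) :
    InnerProductGeometry.angle (diag n l j) (diag n l (j + k)) = k * Real.pi / n := by
  have h0 : (0 : ℝ) < n := by exact_mod_cast Nat.pos_of_ne_zero hn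
  have h1 : (k : ℝ) ≤ n := by exact_mod_cast hk
  have hpi := Real.pi_pos
  rw [angle_diag hn hl, add_sub_cancel_left, Int.cast_natCast, Real.arccos_cos]
  · positivity
  · rw [div_le_iff₀ h0]; nlinarith

theorem exists_of_angle_diag_eq {n : ℕ} (hn : n ≠ 0) {l : ℂ} (hl : l ≠ 0) {j j' : ℤ} {k : ℕ}
    (h : InnerProductGeometry.angle (diag n l j) (diag n l j') = k * Real.pi / n) :
    ∃ q : ℤ, j' = j + k + q * (2 * n) ∨ j' = j - k + q * (2 * n) := by
  have h0 : (n : ℝ) ≠ 0 := by exact_mod_cast hn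
  have hpi := Real.pi_ne_zero
  rw [angle_diag hn hl] at h
  have h1 := congrArg Real.cos h
  rw [Real.cos_arccos (Real.neg_one_le_cos _) (Real.cos_le_one _), Real.cos_eq_cos_iff] at h1
  obtain ⟨q, hq | hq⟩ := h1
  · refine ⟨-q, Or.inl ?_⟩
    have : (k : ℝ) = 2 * q * n + (j' - j : ℤ) := by field_simp at hq; linarith
    have : (k : ℤ) = 2 * q * n + (j' - j) := by exact_mod_cast this
    linear_combination -this
  · refine ⟨q, Or.inr ?_⟩
    have : (k : ℝ) = 2 * q * n - (j' - j : ℤ) := by field_simp at hq; linarith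
    have : (k : ℤ) = 2 * q * n - (j' - j) := by exact_mod_cast this
    linear_combination this

/-! ### Star polygons, their angles, and compositions. -/

section Composition

variable {n : ℕ} {P : Polygon ℂ n} {ε : ℤ → Bool} {l : ℂ} {A : ℤ → ℂ}

theorem blocksFun_finRotate (c : Composition n) (i : Fin c.length) :
    c.blocksFun (finRotate _ i) = cyc c.blocks (i + 1) := by
  have h1 : (finRotate _ i : ℕ) < c.blocks.length := (finRotate c.length i).isLt
  have h2 : cyc c.blocks (i + 1) = cyc c.blocks (finRotate _ i : ℕ) := by
    rw [coe_finRotate_eq_mod]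
    exact (Function.Periodic.map_mod_nat (cyc_add_length c.blocks) (i + 1)).symm
  rw [h2, cyc_of_lt h1]
  rfl

theorem cyc_blocks_pos (c : Composition n) (hc : 0 < c.length) (i : ℕ) : 0 < cyc c.blocks i := by
  have h1 : i % c.blocks.length < c.blocks.length := Nat.mod_lt _ hc
  rw [cyc, List.getD_eq_getElem _ _ h1]
  exact c.blocks_pos (List.getElem_mem h1)

theorem cyc_blocks_le (c : Composition n) (hc : 0 < c.length) (i : ℕ) : cyc c.blocks i ≤ n := by
  have h1 : i % c.blocks.length < c.blocks.length := Nat.mod_lt _ hc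
  rw [cyc, List.getD_eq_getElem _ _ h1]
  exact c.blocks_le (List.getElem_mem h1)

theorem psum_cyc_blocks (c : Composition n) : psum (cyc c.blocks) c.length = n :=
  (sum_cyc c.blocks).trans c.blocks_sum

/-- If two star vertices agree, one of the stretches of indices between them modulo `2 n` has no
edge. A true letter follows each run, so that stretch fits into a single run. Comparing positions
modulo `2 n`, either `j - i` is even and positive, so two full runs would have to fit, or `i = 0`
and `j = p - 1` with `j` odd, contradicting that `p` is odd. -/
theorem IsPath.star_injective (h : IsPath n ε l A) (hε : IsAntiperiodic n ε)
    (hl : l ≠ 0) {K : ℕ → ℕ} {p : ℕ} {t₀ : ℤ} (hrun : IsRun n ε K t₀) (hpos : ∀ i, 0 < K i)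
    (hp : psum K p = n) (hodd : Odd p) {i j : ℕ} (hij : i < j) (hj : j < p) :
    A (t₀ + psum K i + i * n) ≠ A (t₀ + psum K j + j * n) := by
  intro he
  have hmono := psum_strictMono hpos
  have hn : 0 < n := by have := hmono (show 0 < p by omega); omega
  have hend : ∀ i, ε (t₀ + psum K i + i * n + K i) = true := by
    intro i
    have h1 := hrun (i + 1) 0 (hpos _)
    have h2 := hε (t₀ + psum K i + i * n + K i)
    rw [show t₀ + psum K i + i * n + K i + (n : ℤ) =
      t₀ + psum K (i + 1) + ((i + 1 : ℕ) : ℤ) * n + (0 : ℕ) by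
        rw [psum_succ]; push_cast; ring, h1] at h2
    simpa using h2.symm
  set a : ℤ := t₀ + psum K i + i * n with ha
  set b : ℤ := t₀ + psum K j + j * n with hb
  set d := (b - a) % (2 * n) with hd
  have hd0 := Int.emod_nonneg (b - a) (show (2 * n : ℤ) ≠ 0 by omega)
  have hd1 := Int.emod_lt_of_pos (b - a) (show (0 : ℤ) < 2 * n by omega)
  have hd2 := Int.emod_add_mul_ediv (b - a) (2 * n)
  set q := (b - a) / (2 * n) with hq
  rw [← hd] at hd0 hd1 hd2
  have hbd : a + d = b + (-q) * (2 * n) := by linear_combination hd2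
  have hA : A (a + d.toNat) = A a := by
    rw [Int.toNat_of_nonneg hd0, hbd, h.add_int_mul, he]
  have hSij : psum K (i + 1) ≤ psum K j := hmono.monotone hij
  have hSj : psum K (j + 1) ≤ psum K p := hmono.monotone hj
  rw [psum_succ] at hSij hSj
  have hKi := hpos i
  have hKj := hpos j
  rcases h.forall_false_or_forall_false hl (by omega) hA with h1 | h1
  · have h2 : d ≤ K i := by
      by_contra! hc
      have := h1 (a + K i) (by omega) (by omega)
      rw [hend] at this
      simp at this
    have h3 : ((psum K j : ℤ) - psum K i - d) = n * (2 * q - (j - i)) := by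
      linear_combination -hd2 + hb - ha
    have h4 : (2 * q - (j - i : ℤ)) = 0 := by
      have h5 : (n : ℤ) * (2 * q - (j - i)) < n * 1 := by omega
      have h6 : (n : ℤ) * (-1) < n * (2 * q - (j - i)) := by omega
      have h7 := lt_of_mul_lt_mul_left h5 (by omega)
      have h8 := lt_of_mul_lt_mul_left h6 (by omega)
      omega
    rw [h4, mul_zero] at h3
    have h5 : psum K (i + 2) ≤ psum K j := hmono.monotone (by omega)
    rw [psum_succ, psum_succ] at h5
    have := hpos (i + 1)
    omega
  · have h2 : 2 * n - d ≤ K j := by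
      by_contra! hc
      have := h1 (b + K j + (-q) * (2 * n)) (by omega) (by omega)
      rw [hε.add_int_mul, hend] at this
      simp at this
    have h3 : ((psum K j : ℤ) - psum K i + (2 * n - d)) = n * (2 * q + 2 - (j - i)) := by
      linear_combination -hd2 + hb - ha
    have h4 : (2 * q + 2 - (j - i : ℤ)) = 1 := by
      have h5 : (n : ℤ) * (2 * q + 2 - (j - i)) < n * 2 := by omega
      have h6 : (n : ℤ) * 0 < n * (2 * q + 2 - (j - i)) := by omega
      have h7 := lt_of_mul_lt_mul_left h5 (by omega)
      have h8 := lt_of_mul_lt_mul_left h6 (by omega)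
      omega
    rw [h4, mul_one] at h3
    have h5 : psum K i = 0 := by omega
    have h6 : psum K (j + 1) = psum K p := by rw [psum_succ]; omega
    have h7 := hmono.injective h6
    have h8 : i = 0 := by
      by_contra h0
      have := hmono (show 0 < i by omega)
      omega
    obtain ⟨z, hz⟩ := hodd
    omega

/-- The path rests at one vertex during a run, and an index jump of `n` follows a diameter. The
diameters used before and after a run of length `k` differ by `k` index steps, which is the interior
angle `k π / n` there. -/
theorem IsPath.hasComposition (h : IsPath n ε l A) (hn : n ≠ 0) (hε : IsAntiperiodic n ε)
    (hl : l ≠ 0) (hP : Set.range P.vertices = Set.range A) (c : Composition n)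
    (hodd : Odd c.length) {t₀ : ℤ} (hrun : IsRun n ε (cyc c.blocks) t₀) : HasComposition P c := by
  have hc0 : 0 < c.length := hodd.pos
  set K := cyc c.blocks with hK
  set σ : ℕ → ℂ := fun i => A (t₀ + psum K i + i * n) with hσ
  -- The star closes up because the length is odd: one round adds `n + c.length * n` to the index, a
  -- multiple of `2 n`.
  have hσp : ∀ i, σ (i + c.length) = σ i := by
    intro i
    obtain ⟨z, hz⟩ := hodd
    simp only [hσ]
    rw [psum_add_of_periodic (cyc_add_length c.blocks) (psum_cyc_blocks c), hz,
      show t₀ + ((psum K i + n : ℕ) : ℤ) + ((i + (2 * z + 1) : ℕ) : ℤ) * n =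
        t₀ + psum K i + i * n + ((z : ℤ) + 1) * (2 * n) by push_cast; ring, h.add_int_mul]
  have hrot : ∀ i : Fin c.length, σ (finRotate _ i : ℕ) = σ (i + 1) := by
    intro i
    rw [coe_finRotate_eq_mod]; exact apply_mod_of_periodic hσp _
  have hrot2 : ∀ i : Fin c.length, σ (finRotate _ (finRotate _ i) : ℕ) = σ (i + 2) := by
    intro i
    rw [coe_finRotate_eq_mod, coe_finRotate_eq_mod, Nat.mod_add_mod]
    exact apply_mod_of_periodic hσp _
  have hσ2 : ∀ i, σ i = A (t₀ + psum K (i + 1) + i * n) := by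
    intro i
    have := h.eq_of_forall_false (t₀ + psum K i + i * n) (K i) fun t h1 h2 => by
      obtain ⟨r, rfl⟩ := Int.le.dest h1
      exact hrun i r (by omega)
    simp only [hσ]
    rw [← this, psum_succ]
    congr 1; push_cast; ring
  have hdiff : ∀ i : ℕ, σ (i + 1) = σ i + diag n l (t₀ + psum K (i + 1) + i * n) := by
    intro i
    rw [hσ2 i, ← h.opposite hn hε]
    simp only [hσ]
    congr 1; push_cast; ring
  refine ⟨hodd, fun i => σ i, ⟨?_, fun i => ?_, fun i => ?_⟩, fun i => ?_⟩
  · intro i j hij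
    rcases lt_trichotomy i j with h1 | h1 | h1
    · exact absurd hij (h.star_injective hε hl hrun (cyc_blocks_pos c hc0) (psum_cyc_blocks c) hodd
        h1 j.isLt)
    · exact h1
    · exact absurd hij.symm (h.star_injective hε hl hrun (cyc_blocks_pos c hc0) (psum_cyc_blocks c)
        hodd h1 i.isLt)
  · rw [hP]; exact ⟨_, rfl⟩
  · beta_reduce
    rw [hP, h.diam_range hn hε, hrot, hdiff, dist_comm, dist_eq_norm, add_sub_cancel_left, norm_diag]
  · beta_reduce
    rw [hrot, hrot2, blocksFun_finRotate, EuclideanGeometry.angle, vsub_eq_sub, vsub_eq_sub,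
      hdiff (i + 1), add_sub_cancel_left, hdiff i, sub_add_cancel_left, ← diag_add_self hn]
    have := angle_diag_add hn hl (t₀ + psum K (i + 1) + (i : ℕ) * n + n)
      (cyc_blocks_le c hc0 (i + 1))
    rw [← this]
    congr 2
    rw [psum_succ K (i + 1)]
    push_cast; ring

end Composition

theorem IsAntiperiodic.reflect {n : ℕ} {ε : ℤ → Bool} (h : IsAntiperiodic n ε) (r : ℤ) :
    IsAntiperiodic n fun j => ε (r - j) := by
  intro t
  have := h (r - (t + n))
  rw [show r - (t + n) + n = r - t by ring] at this
  simp [this]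

theorem IsAntiperiodic.shift {n : ℕ} {ε : ℤ → Bool} (h : IsAntiperiodic n ε) (r : ℤ) :
    IsAntiperiodic n fun j => ε (j + r) := by
  intro t
  simp only
  rw [add_right_comm, h]

/-- If a signed sum of positive integers with total `n` is congruent to `n` modulo `2 n`, then all
signs agree. -/
theorem signs_eq {n p : ℕ} (hn : n ≠ 0) {K : ℕ → ℕ} (hK : ∀ i, 0 < K i) (hp : psum K p = n)
    {δ : ℕ → ℤ} (hδ : ∀ i, δ i = 1 ∨ δ i = -1) {q : ℤ}
    (h : ∑ i ∈ Finset.range p, δ i * K i = n + q * (2 * n)) :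
    (∀ i < p, δ i = 1) ∨ (∀ i < p, δ i = -1) := by
  have hp' : ∑ i ∈ Finset.range p, (K i : ℤ) = n := by
    rw [← hp, psum]; push_cast; rfl
  have hKi : ∀ i, (0 : ℤ) < K i := fun i => by exact_mod_cast hK i
  have h1 : ∀ i ∈ Finset.range p, 0 ≤ (K i : ℤ) - δ i * K i := by
    intro i _
    have := hKi i
    rcases hδ i with h | h <;> rw [h] <;> linarith
  have h2 : ∀ i ∈ Finset.range p, 0 ≤ (K i : ℤ) + δ i * K i := by
    intro i _
    have := hKi i
    rcases hδ i with h | h <;> rw [h] <;> linarith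
  have e1 : ∑ i ∈ Finset.range p, ((K i : ℤ) - δ i * K i) = -q * (2 * n) := by
    rw [Finset.sum_sub_distrib, hp', h]; ring
  have e2 : ∑ i ∈ Finset.range p, ((K i : ℤ) + δ i * K i) = (q + 1) * (2 * n) := by
    rw [Finset.sum_add_distrib, hp', h]; ring
  have s1 := Finset.sum_nonneg h1
  have s2 := Finset.sum_nonneg h2
  rw [e1] at s1
  rw [e2] at s2
  have hn' : (0 : ℤ) < 2 * n := by omega
  have q1 : 0 ≤ -q := nonneg_of_mul_nonneg_left s1 hn'
  have q2 : 0 ≤ q + 1 := nonneg_of_mul_nonneg_left s2 hn'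
  have q3 : q = 0 ∨ q = -1 := by omega
  rcases q3 with rfl | rfl
  · left
    intro i hi
    rw [neg_zero, zero_mul] at e1
    have := (Finset.sum_eq_zero_iff_of_nonneg h1).1 e1 i (Finset.mem_range.2 hi)
    have h3 := hKi i
    rcases hδ i with h | h
    · exact h
    · rw [h] at this; omega
  · right
    intro i hi
    rw [neg_add_cancel, zero_mul] at e2
    have := (Finset.sum_eq_zero_iff_of_nonneg h2).1 e2 i (Finset.mem_range.2 hi)
    have h3 := hKi i
    rcases hδ i with h | h
    · rw [h] at this; omega
    · exact h

section Composition

variable {n : ℕ} {P : Polygon ℂ n} {ε : ℤ → Bool} {l : ℂ} {A : ℤ → ℂ}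

/-- Each side of the star joins `A j` to `A (j + n)`, and an interior angle `k π / n` makes the next
index `j + n ± k` modulo `2 n`. Closing up after an odd number of sides makes the signed sum of the
parts congruent to `n`, so `signs_eq` gives one common sign: plus yields runs of `ε`, minus runs of
the reversed word. Parts are shifted by one since the `i`-th angle sits at the vertex following `s
i`. -/
theorem IsPath.exists_isRun (h : IsPath n ε l A) (hn : n ≠ 0) (hε : IsAntiperiodic n ε)
    (hl : l ≠ 0) (hP : Set.range P.vertices = Set.range A) (c : Composition n)
    (hc : HasComposition P c) :
    ∃ t₀, IsRun n ε (fun i => cyc c.blocks (i + 1)) t₀ ∨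
      IsRun n (fun j => ε (-1 - j)) (fun i => cyc c.blocks (i + 1)) t₀ := by
  obtain ⟨hodd, s, ⟨-, hmem, hdist⟩, hang⟩ := hc
  have hc0 : 0 < c.length := hodd.pos
  have hj : ∀ i, ∃ j, s (finRotate _ i) = A (j + n) ∧ s i = A j := by
    intro i
    obtain ⟨a, ha⟩ := hP ▸ hmem i
    obtain ⟨b, hb⟩ := hP ▸ hmem (finRotate _ i)
    have h1 := hdist i
    rw [hP, h.diam_range hn hε, dist_comm, dist_eq_norm, ← ha, ← hb] at h1
    obtain ⟨j, h2, h3⟩ := h.exists_of_norm_sub_eq hn hε h1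
    exact ⟨j, by rw [← hb, h2], by rw [← ha, h3]⟩
  choose j' hj1 hj2 using hj
  set K : ℕ → ℕ := fun i => cyc c.blocks (i + 1) with hK
  set f : ℕ → Fin c.length := fun i => ⟨i % c.length, Nat.mod_lt _ hc0⟩ with hf
  have hfr : ∀ i, f (i + 1) = finRotate _ (f i) := by
    intro i
    apply Fin.ext
    rw [coe_finRotate_eq_mod]
    simp [hf]
  have hfp : ∀ i, f (i % c.length) = f i := by
    intro i; apply Fin.ext; simp [hf]
  have hKf : ∀ i, c.blocksFun (finRotate _ (f i)) = K i := by
    intro i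
    rw [blocksFun_finRotate]
    have : Function.Periodic (fun i => cyc c.blocks (i + 1)) c.blocks.length := fun i => by
      simp only
      rw [add_right_comm, cyc_add_length]
    exact this.map_mod_nat i
  have hKp : ∀ i, K (i % c.length) = K i := fun i => by rw [← hKf, hfp, hKf]
  set j : ℕ → ℤ := fun i => j' (f i) with hjdef
  have hAj : ∀ i, A (j i + n) = A (j (i + 1)) := by
    intro i
    simp only [hjdef]
    rw [← hj1, ← hj2, hfr]
  have hstep : ∀ i, ∃ δ q : ℤ, (δ = 1 ∨ δ = -1) ∧ j (i + 1) = j i + n + δ * K i + q * (2 * n) := by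
    intro i
    have h1 := hang (f i)
    rw [hKf, EuclideanGeometry.angle, vsub_eq_sub, vsub_eq_sub, hj1 (finRotate _ (f i)),
      hj2 (finRotate _ (f i)), h.opposite hn hε, add_sub_cancel_left] at h1
    have h2 : s (f i) - A (j' (finRotate _ (f i))) = diag n l (j i + n) := by
      rw [← hj2 (finRotate _ (f i)), hj1, hj2 (f i), h.opposite hn hε, diag_add_self hn]
      ring
    rw [h2] at h1
    obtain ⟨q, hq | hq⟩ := exists_of_angle_diag_eq hn hl h1
    · exact ⟨1, q, Or.inl rfl, by simp only [hjdef, hfr]; rw [hq]; ring⟩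
    · exact ⟨-1, q, Or.inr rfl, by simp only [hjdef, hfr]; rw [hq]; ring⟩
  choose δ q hδ hjs using hstep
  have hpos : ∀ i, 0 < K i := fun i => cyc_blocks_pos c hc0 _
  have hle : ∀ i, K i ≤ n := fun i => cyc_blocks_le c hc0 _
  have hsum : psum K c.length = n :=
    (psum_shift (cyc_add_length c.blocks)).trans (psum_cyc_blocks c)
  have htel : ∀ N : ℕ, ∑ i ∈ Finset.range N, δ i * K i =
      j N - j 0 - N * n - (∑ i ∈ Finset.range N, q i) * (2 * n) := by
    intro N
    induction N with
    | zero => simp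
    | succ N ih => rw [Finset.sum_range_succ, ih, Finset.sum_range_succ, hjs]; push_cast; ring
  have hj0 : j c.length = j 0 := by
    simp only [hjdef]
    rw [← hfp c.length, Nat.mod_self]
  have hsgn := htel c.length
  obtain ⟨z, hz⟩ := id hodd
  have hz' : (c.length : ℤ) = 2 * z + 1 := by exact_mod_cast hz
  rw [hj0, sub_self, zero_sub] at hsgn
  have hsigns := signs_eq hn hpos hsum hδ (q := -(z + 1) - ∑ i ∈ Finset.range c.length, q i)
    (by rw [hsgn]; linear_combination -(n : ℤ) * hz')
  have hjmod : ∀ i, j (i % c.length) = j i ∧ j (i % c.length + 1) = j (i + 1) := by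
    intro i
    simp only [hjdef]
    rw [hfr, hfp, hfr]
    exact ⟨rfl, rfl⟩
  rcases hsigns with hs | hs
  · have hall : ∀ i, ∃ q : ℤ, j (i + 1) = j i + n + K i + q * (2 * n) := by
      intro i
      have h1 := hjs (i % c.length)
      rw [hs _ (Nat.mod_lt _ hc0), (hjmod i).1, (hjmod i).2, hKp, one_mul] at h1
      exact ⟨_, h1⟩
    have hform : ∀ i : ℕ, ∃ q : ℤ, j i = j 0 + psum K i + i * n + q * (2 * n) := by
      intro i
      induction i with
      | zero => exact ⟨0, by simp [psum]⟩
      | succ i ih =>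
        obtain ⟨q, hq⟩ := ih
        obtain ⟨q', hq'⟩ := hall i
        exact ⟨q + q', by rw [hq', hq, psum_succ]; push_cast; ring⟩
    refine ⟨j 0 + n, Or.inl fun i r hr => ?_⟩
    obtain ⟨q, hq⟩ := hform i
    obtain ⟨q', hq'⟩ := hall i
    have h1 : A (j i + n + K i) = A (j i + n) := by
      rw [hAj, hq', h.add_int_mul]
    have h2 := h.forall_false_of_eq hl (hle i) h1 (j i + n + r) (by omega) (by omega)
    rw [hq, show j 0 + psum K i + i * n + q * (2 * n) + n + r =
      j 0 + n + psum K i + i * n + r + q * (2 * n) by ring, hε.add_int_mul] at h2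
    exact h2
  · have hall : ∀ i, ∃ q : ℤ, j (i + 1) = j i + n - K i + q * (2 * n) := by
      intro i
      have h1 := hjs (i % c.length)
      rw [hs _ (Nat.mod_lt _ hc0), (hjmod i).1, (hjmod i).2, hKp] at h1
      exact ⟨q (i % c.length), by rw [h1]; ring⟩
    have hform : ∀ i : ℕ, ∃ q : ℤ, j i = j 0 - psum K i - i * n + q * (2 * n) := by
      intro i
      induction i with
      | zero => exact ⟨0, by simp [psum]⟩
      | succ i ih =>
        obtain ⟨q, hq⟩ := ih
        obtain ⟨q', hq'⟩ := hall i
        exact ⟨q + q' + 1, by rw [hq', hq, psum_succ]; push_cast; ring⟩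
    refine ⟨-j 0 - n, Or.inr fun i r hr => ?_⟩
    obtain ⟨q, hq⟩ := hform i
    obtain ⟨q', hq'⟩ := hall i
    have h1 : A (j i + n - K i + K i) = A (j i + n - K i) := by
      rw [sub_add_cancel, hAj, hq', h.add_int_mul]
    have h2 := h.forall_false_of_eq hl (hle i) h1 (j i + n - 1 - r) (by omega) (by omega)
    rw [hq, show j 0 - psum K i - i * n + q * (2 * n) + n - 1 - r =
      -1 - (-j 0 - n + psum K i + i * n + r) + q * (2 * n) by ring, hε.add_int_mul] at h2
    exact h2

end Composition

/-! ### Run length encoding, and periodic polygons. -/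

/-- Run length encoding of a finite piece of a word. -/
theorem exists_runs (ε : ℤ → Bool) (t₀ : ℤ) (m : ℕ) (h0 : ε t₀ = false) :
    ∃ L : List ℕ, L ≠ [] ∧ (∀ k ∈ L, 0 < k) ∧ L.sum = m + 1 ∧
      (∀ i < L.length, ∀ r < cyc L i, ε (t₀ + psum (cyc L) i + r) = i.bodd) ∧
      ε (t₀ + m) = (L.length - 1).bodd := by
  have key : ∀ (L : List ℕ) (k i : ℕ), i < L.length → cyc (L ++ [k]) i = cyc L i := by
    intro L k i hi
    rw [cyc_of_lt hi, cyc_of_lt (by simp; omega), List.getElem_append_left hi]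
  have key2 : ∀ (L : List ℕ) (k : ℕ), cyc (L ++ [k]) L.length = k := by
    intro L k
    rw [cyc_of_lt (by simp)]; simp
  have key3 : ∀ (L : List ℕ) (k i : ℕ), i ≤ L.length →
      psum (cyc (L ++ [k])) i = psum (cyc L) i := by
    intro L k i hi
    refine Finset.sum_congr rfl fun j hj => key L k j ?_
    have := Finset.mem_range.1 hj
    omega
  induction m with
  | zero =>
    refine ⟨[1], by simp, by simp, by simp, ?_, by simpa using h0⟩
    intro i hi r hr
    have : i = 0 := by simpa using hi
    subst this
    have hr0 : r = 0 := by
      have : cyc [1] 0 = 1 := rfl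
      omega
    simp [hr0, psum, h0]
  | succ m ih =>
    obtain ⟨L, hL, hpos, hsum, hrun, hlast⟩ := ih
    have hL0 := List.length_pos_iff.2 hL
    -- The new letter either prolongs the last run or opens a new one of length `1`.
    by_cases hc : ε (t₀ + (m + 1 : ℕ)) = (L.length - 1).bodd
    · obtain ⟨M, k, rfl⟩ := List.eq_nil_or_concat' L |>.resolve_left hL
      rw [List.length_append, List.length_singleton, Nat.add_sub_cancel] at hc hlast
      have hMs : psum (cyc (M ++ [k])) M.length = M.sum := by
        rw [key3 _ _ _ le_rfl, psum, sum_cyc]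
      rw [List.sum_append, List.sum_singleton] at hsum
      refine ⟨M ++ [k + 1], by simp, ?_, ?_, ?_, ?_⟩
      · intro x hx
        rcases List.mem_append.1 hx with h | h
        · exact hpos x (List.mem_append_left _ h)
        · rw [List.mem_singleton.1 h]; omega
      · rw [List.sum_append, List.sum_singleton]; omega
      · intro i hi r hr
        rw [List.length_append, List.length_singleton] at hi
        rw [key3 _ _ _ (by omega)]
        rcases Nat.lt_or_ge i M.length with h | h
        · rw [key _ _ _ h] at hr
          have := hrun i (by simp; omega) r (by rwa [key _ _ _ h])
          rwa [key3 _ _ _ (by omega)] at this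
        · have hi' : i = M.length := by omega
          subst hi'
          rw [key2] at hr
          rcases Nat.lt_or_ge r k with h' | h'
          · have := hrun M.length (by simp) r (by rwa [key2])
            rwa [key3 _ _ _ le_rfl] at this
          · have hr' : r = k := by omega
            rw [← hc, psum, sum_cyc]
            congr 1
            have : M.sum + k = m + 1 := hsum
            omega
      · rw [List.length_append, List.length_singleton, Nat.add_sub_cancel]; exact hc
    · refine ⟨L ++ [1], by simp, ?_, ?_, ?_, ?_⟩
      · intro x hx
        rcases List.mem_append.1 hx with h | h
        · exact hpos x h
        · rw [List.mem_singleton.1 h]; omega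
      · rw [List.sum_append, List.sum_singleton]; omega
      · intro i hi r hr
        rw [List.length_append, List.length_singleton] at hi
        rw [key3 _ _ _ (by omega)]
        rcases Nat.lt_or_ge i L.length with h | h
        · rw [key _ _ _ h] at hr
          exact hrun i h r hr
        · have hi' : i = L.length := by omega
          subst hi'
          rw [key2] at hr
          have hr0 : r = 0 := by omega
          rw [psum, sum_cyc, hsum, hr0, Nat.cast_zero, add_zero]
          obtain ⟨z, hz⟩ : ∃ z, L.length = z + 1 := ⟨L.length - 1, by omega⟩
          rw [hz, Nat.add_sub_cancel] at hc
          rw [hz, Nat.bodd_succ]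
          cases h1 : ε (t₀ + (m + 1 : ℕ)) <;> cases h2 : z.bodd <;> simp_all
      · rw [List.length_append, List.length_singleton, Nat.add_sub_cancel]
        obtain ⟨z, hz⟩ : ∃ z, L.length = z + 1 := ⟨L.length - 1, by omega⟩
        rw [hz, Nat.add_sub_cancel] at hc
        rw [hz, Nat.bodd_succ]
        cases h1 : ε (t₀ + (m + 1 : ℕ)) <;> cases h2 : z.bodd <;> simp_all

theorem odd_of_bodd {k : ℕ} (hk : k.bodd = true) : Odd k := by
  by_contra h
  obtain ⟨z, rfl⟩ := Nat.not_odd_iff_even.1 h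
  rw [Nat.bodd_add] at hk
  simp at hk

theorem IsAntiperiodic.exists_ascent {m : ℕ} {ε : ℤ → Bool} (h : IsAntiperiodic m ε) :
    ∃ t, ε t = false ∧ ε (t - 1) = true := by
  obtain ⟨t, ht⟩ : ∃ t, ε t = true := by
    rcases h0 : ε 0 with _ | _
    · exact ⟨0 + m, by rw [h, h0]; rfl⟩
    · exact ⟨0, h0⟩
  by_contra! hc
  have key : ∀ k : ℕ, ε (t + k) = true := by
    intro k
    induction k with
    | zero => simpa
    | succ k ih =>
      by_contra h1
      rw [Bool.not_eq_true] at h1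
      apply hc _ h1
      rw [← ih]; congr 1; push_cast; ring
  have := key m
  rw [h, ht] at this
  simp at this

/-- An antiperiodic word is encoded by a periodic composition. -/
theorem exists_composition_isRun {n m : ℕ} {ε : ℤ → Bool} (hn : n ≠ 0) (hε : IsAntiperiodic n ε)
    (hm : IsAntiperiodic m ε) (hmn : m ∣ n) :
    ∃ (b : Composition m) (c : Composition n) (t₀ : ℤ), Odd b.length ∧ Odd c.length ∧
      c.blocks = (List.replicate (n / m) b.blocks).flatten ∧ IsRun n ε (cyc c.blocks) t₀ := by
  obtain ⟨k, rfl⟩ := hmn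
  have hm0 : 0 < m := Nat.pos_of_ne_zero (left_ne_zero_of_mul hn)
  have hk0 : 0 < k := Nat.pos_of_ne_zero (right_ne_zero_of_mul hn)
  obtain ⟨t₀, ht, ht1⟩ := hm.exists_ascent
  obtain ⟨L, hL, hpos, hsum, hrun, hlast⟩ := exists_runs ε t₀ (m - 1) ht
  rw [Nat.sub_add_cancel hm0] at hsum
  have hL0 := List.length_pos_iff.2 hL
  -- The letter before `t₀` is `true`, so the last letter of the block of length `m` is `false` and
  -- the last run has even index.
  have hLodd : Odd L.length := by
    have h1 := hm (t₀ - 1)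
    rw [show t₀ - 1 + (m : ℤ) = t₀ + (m - 1 : ℕ) by omega, hlast, ht1] at h1
    apply odd_of_bodd
    rw [show L.length = L.length - 1 + 1 by omega, Nat.bodd_succ, h1]
    rfl
  -- Both `m` and `m * k` are antiperiods.
  have hkodd : Odd k := by
    apply odd_of_bodd
    have h1 := hm.apply_add_mul t₀ k
    have h2 := hε t₀
    rw [show t₀ + ((m * k : ℕ) : ℤ) = t₀ + k * m by push_cast; ring, h1, ht] at h2
    simpa using h2
  have hdiv : m * k / m = k := Nat.mul_div_cancel_left k hm0
  let b : Composition m := ⟨L, fun hi => hpos _ hi, hsum⟩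
  let c : Composition (m * k) := ⟨(List.replicate k L).flatten, fun {i} hi => by
      obtain ⟨l, hl, hi⟩ := List.mem_flatten.1 hi
      rw [List.eq_of_mem_replicate hl] at hi
      exact hpos _ hi, by simp [List.sum_flatten, hsum, mul_comm]⟩
  have hcl : c.length = k * L.length := by
    change ((List.replicate k L).flatten).length = _
    simp
  refine ⟨b, c, t₀, hLodd, hcl ▸ hkodd.mul hLodd, by rw [hdiv], ?_⟩
  have hcyc : cyc c.blocks = cyc L := funext fun i => cyc_flatten_replicate hL hk0 i
  rw [hcyc]
  intro i r hr
  set q := i / L.length with hq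
  set j := i % L.length with hj
  have hi : i = j + q * L.length := by
    rw [hj, hq, mul_comm]; exact (Nat.mod_add_div i L.length).symm
  have hjL : j < L.length := Nat.mod_lt _ hL0
  have hp : ∀ q j, psum (cyc L) (j + q * L.length) = psum (cyc L) j + q * m := by
    intro q j
    induction q with
    | zero => simp
    | succ q ih =>
      rw [add_one_mul, ← add_assoc,
        psum_add_of_periodic (cyc_add_length L) ((sum_cyc L).trans hsum), ih]
      ring
  have hcj : cyc L i = cyc L j :=
    ((Function.Periodic.map_mod_nat (cyc_add_length L)) i).symm
  have h1 := hrun j hjL r (hcj ▸ hr)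
  -- Run `i` has letters given by the parity of `i`, and the shift by `i * n` flips them `i` times,
  -- so every letter becomes `false`.
  rw [show t₀ + psum (cyc L) i + i * ((m * k : ℕ) : ℤ) + r =
    t₀ + psum (cyc L) j + r + (q + i * k : ℕ) * m by
      conv_lhs => rw [hi, hp]
      conv_rhs => rw [hi]
      push_cast; ring, hm.apply_add_mul, h1, hi]
  simp only [Nat.bodd_add, Nat.bodd_mul, bodd_of_odd hLodd, bodd_of_odd hkodd]
  cases j.bodd <;> cases q.bodd <;> rfl

theorem IsPath.isPeriodicReinhardt_iff {n : ℕ} {P : Polygon ℂ n} {ε : ℤ → Bool} {l : ℂ}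
    {A : ℤ → ℂ} (h : IsPath n ε l A) (hn : n ≠ 0) (hε : IsAntiperiodic n ε)
    (hl : l ≠ 0) (hP : Set.range P.vertices = Set.range A) (hRe : IsReinhardtPolygon P) :
    IsPeriodicReinhardt P ↔ ∃ m, m ∣ n ∧ m < n ∧ IsAntiperiodic m ε := by
  constructor
  · rintro ⟨-, c, hc, m, hmn, hlt, b, hb, hcb⟩
    refine ⟨m, hmn, hlt, ?_⟩
    have hnm : 0 < n / m := Nat.div_pos hlt.le (Nat.pos_of_dvd_of_pos hmn (Nat.pos_of_ne_zero hn))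
    have hbne : b.blocks ≠ [] := by
      intro h0
      have : b.length = 0 := by rw [Composition.length, h0]; rfl
      rw [this] at hb
      exact absurd hb (by decide)
    have hcyc : cyc c.blocks = cyc b.blocks := by
      rw [hcb]; exact funext fun i => cyc_flatten_replicate hbne hnm i
    have hper : ∀ i, cyc c.blocks (i + 1 + b.length) = cyc c.blocks (i + 1) := fun i => by
      rw [hcyc]; exact cyc_add_length _ _
    have hp1 : psum (fun i => cyc c.blocks (i + 1)) c.length = n :=
      (psum_shift (cyc_add_length c.blocks)).trans (psum_cyc_blocks c)
    have hp2 : psum (fun i => cyc c.blocks (i + 1)) b.length = m := by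
      rw [hcyc]
      exact (psum_shift (cyc_add_length b.blocks)).trans (psum_cyc_blocks b)
    have hK : ∀ i, (fun i => cyc c.blocks (i + 1)) (i + b.length) =
        (fun i => cyc c.blocks (i + 1)) i := fun i => by
      simp only
      rw [add_right_comm]; exact hper i
    obtain ⟨t₀, hrun | hrun⟩ := h.exists_isRun hn hε hl hP c hc
    · exact hrun.isAntiperiodic hε hn hp1 hK hb hp2
    · have := (hrun.isAntiperiodic (hε.reflect (-1)) hn hp1 hK hb hp2).reflect (-1)
      simpa using this
  · rintro ⟨m, hmn, hlt, hm⟩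
    obtain ⟨b, c, t₀, hb, hc, hcb, hrun⟩ := exists_composition_isRun hn hε hm hmn
    exact ⟨hRe, c, h.hasComposition hn hε hl hP c hc hrun, m, hmn, hlt, b, hb, hcb⟩

/-! ### Fourier analysis of the closing condition. -/

open scoped ZMod

section Fourier

variable {N : ℕ} [NeZero N]

theorem dft_comp_add (g : ZMod N → ℂ) (a k : ZMod N) :
    𝓕 (fun j => g (j + a)) k = ZMod.stdAddChar (a * k) * 𝓕 g k := by
  simp only [ZMod.dft_apply, smul_eq_mul, Finset.mul_sum]
  refine Fintype.sum_equiv (Equiv.addRight a) _ _ fun j => ?_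
  rw [Equiv.coe_addRight, ← mul_assoc, ← AddChar.map_add_eq_mul]
  congr 2
  ring

theorem isPrimitiveRoot_stdAddChar_one : IsPrimitiveRoot (ZMod.stdAddChar (1 : ZMod N)) N := by
  have h := Complex.isPrimitiveRoot_exp N (NeZero.ne N)
  have h1 := ZMod.stdAddChar_coe (N := N) 1
  simp only [Int.cast_one, mul_one] at h1
  rwa [h1]

theorem stdAddChar_mul_eq_pow (k j : ZMod N) :
    ZMod.stdAddChar (j * k) = (ZMod.stdAddChar k : ℂ) ^ j.val := by
  rw [← AddChar.map_nsmul_eq_pow, nsmul_eq_mul, ZMod.natCast_zmod_val]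

/-- For integer valued functions the vanishing of the discrete Fourier transform is invariant under
the Galois group. -/
theorem dft_eq_zero_of_isUnit {S : ZMod N → ℤ}
    (h : ∑ j : ZMod N, ZMod.stdAddChar j * (S j : ℂ) = 0) {k : ZMod N} (hk : IsUnit k) :
    𝓕 (fun j => (S j : ℂ)) k = 0 := by
  set F : Polynomial ℤ := ∑ j : ZMod N, Polynomial.C (S j) * Polynomial.X ^ j.val with hF
  set ζ : ℂ := ZMod.stdAddChar (1 : ZMod N) with hζdef
  have hζ : IsPrimitiveRoot ζ N := isPrimitiveRoot_stdAddChar_one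
  have haeval : ∀ m : ZMod N, Polynomial.aeval (ZMod.stdAddChar m : ℂ) F =
      ∑ j : ZMod N, ZMod.stdAddChar (j * m) * (S j : ℂ) := by
    intro m
    simp only [hF, map_sum, map_mul, map_pow, Polynomial.aeval_X, Polynomial.aeval_C]
    refine Finset.sum_congr rfl fun j _ => ?_
    rw [stdAddChar_mul_eq_pow, mul_comm]
    simp
  have h1 : Polynomial.aeval ζ F = 0 := by
    rw [haeval]; simpa using h
  -- The minimal polynomial of `ζ` is also that of every conjugate `ζ ^ m` with `m` prime to `N`, so
  -- `F` vanishes there too. The exponent `-k` matches the sign convention of the transform.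
  have h2 : minpoly ℤ ζ ∣ F :=
    minpoly.isIntegrallyClosed_dvd (hζ.isIntegral (NeZero.pos N)) h1
  have h3 : Nat.Coprime (-k).val N := (ZMod.isUnit_iff_coprime _ _).1 (by
    rw [ZMod.natCast_zmod_val]; exact hk.neg)
  have h4 : (ZMod.stdAddChar (-k) : ℂ) = ζ ^ (-k).val := by
    rw [← stdAddChar_mul_eq_pow, mul_one]
  rw [hζ.minpoly_eq_pow_coprime h3, ← h4] at h2
  have h5 := Polynomial.aeval_eq_zero_of_dvd_aeval_eq_zero h2 (minpoly.aeval ℤ _)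
  rw [haeval] at h5
  rw [ZMod.dft_apply, ← h5]
  refine Finset.sum_congr rfl fun j _ => ?_
  rw [smul_eq_mul, mul_neg]

/-- It suffices that each Fourier coefficient of the mixed difference vanishes. For even `k` the
coefficient of `S` is zero by the sign change under `2pq`; for `p ∣ k` or `q ∣ k` one of the two
difference factors is zero; every other `k` is a unit, where the Galois argument applies. -/
theorem mixed_difference_eq_zero {p q : ℕ} (hp : p.Prime) (hq : q.Prime) (hN : N = 4 * p * q)
    {S : ZMod N → ℤ} (h : ∑ j : ZMod N, ZMod.stdAddChar j * (S j : ℂ) = 0)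
    (hS : ∀ j, S (j + (2 * p * q : ℕ)) = -S j) (j : ZMod N) :
    S (j + (4 * p : ℕ) + (4 * q : ℕ)) + S j = S (j + (4 * p : ℕ)) + S (j + (4 * q : ℕ)) := by
  set G : ZMod N → ℂ := fun j => (S j : ℂ) with hG
  have hN0 : ((4 * p * q : ℕ) : ZMod N) = 0 := by rw [← hN]; exact ZMod.natCast_self N
  have key : ∀ k, (ZMod.stdAddChar (((4 * p : ℕ) : ZMod N) * k) - 1) *
      ((ZMod.stdAddChar (((4 * q : ℕ) : ZMod N) * k) - 1) * 𝓕 G k) = 0 := by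
    intro k
    have hkv : ((k.val : ℕ) : ZMod N) = k := ZMod.natCast_zmod_val k
    by_cases h2 : 2 ∣ k.val
    · obtain ⟨m, hm⟩ := h2
      have h3 : ((2 * p * q : ℕ) : ZMod N) * k = 0 := by
        rw [← hkv, hm, ← Nat.cast_mul, show 2 * p * q * (2 * m) = 4 * p * q * m by ring,
          Nat.cast_mul, hN0, zero_mul]
      have h4 := dft_comp_add G ((2 * p * q : ℕ) : ZMod N) k
      rw [h3, AddChar.map_zero_eq_one, one_mul] at h4
      have h5 : (fun j => G (j + ((2 * p * q : ℕ) : ZMod N))) = -G := by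
        funext j; simp only [hG, hS, Pi.neg_apply]; push_cast; ring
      rw [h5, map_neg, Pi.neg_apply] at h4
      have : 𝓕 G k = 0 := by linear_combination -h4 / 2
      rw [this]; ring
    by_cases hpk : p ∣ k.val
    · obtain ⟨m, hm⟩ := hpk
      have h3 : ((4 * q : ℕ) : ZMod N) * k = 0 := by
        rw [← hkv, hm, ← Nat.cast_mul, show 4 * q * (p * m) = 4 * p * q * m by ring,
          Nat.cast_mul, hN0, zero_mul]
      rw [h3, AddChar.map_zero_eq_one]; ring
    by_cases hqk : q ∣ k.val
    · obtain ⟨m, hm⟩ := hqk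
      have h3 : ((4 * p : ℕ) : ZMod N) * k = 0 := by
        rw [← hkv, hm, ← Nat.cast_mul, show 4 * p * (q * m) = 4 * p * q * m by ring,
          Nat.cast_mul, hN0, zero_mul]
      rw [h3, AddChar.map_zero_eq_one]; ring
    have hu : IsUnit k := by
      rw [← hkv, ZMod.isUnit_iff_coprime]
      have c2 := ((Nat.Prime.coprime_iff_not_dvd Nat.prime_two).2 h2).symm
      have cp := ((Nat.Prime.coprime_iff_not_dvd hp).2 hpk).symm
      have cq := ((Nat.Prime.coprime_iff_not_dvd hq).2 hqk).symm
      have h8 : k.val.Coprime (2 * 2 * p * q) := ((c2.mul_right c2).mul_right cp).mul_right cq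
      have h9 : 2 * 2 * p * q = N := hN.symm
      rwa [h9] at h8
    rw [dft_eq_zero_of_isUnit h hu]; ring
  set D : ZMod N → ℂ := fun j => G (j + (4 * p : ℕ)) - G j with hD
  have hDd : ∀ k, 𝓕 D k = (ZMod.stdAddChar (((4 * p : ℕ) : ZMod N) * k) - 1) * 𝓕 G k := by
    intro k
    have : D = (fun j => G (j + (4 * p : ℕ))) - G := rfl
    rw [this, map_sub, Pi.sub_apply, dft_comp_add]; ring
  have hE : (fun j => D (j + (4 * q : ℕ))) - D = 0 := by
    refine (ZMod.dft (N := N) (E := ℂ)).injective ?_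
    funext k
    rw [map_sub, Pi.sub_apply, dft_comp_add, hDd, map_zero, Pi.zero_apply]
    linear_combination key k
  have h6 := congrFun hE j
  simp only [hD, hG, Pi.sub_apply, Pi.zero_apply] at h6
  have h7 : (S (j + (4 * q : ℕ) + (4 * p : ℕ)) : ℂ) + S j =
      S (j + (4 * p : ℕ)) + S (j + (4 * q : ℕ)) := by linear_combination h6
  rw [add_right_comm]
  exact_mod_cast h7

theorem sum_zmod_eq_sum_range {M : Type*} [AddCommMonoid M] (F : ZMod N → M) :
    ∑ x, F x = ∑ t ∈ Finset.range N, F (t : ZMod N) := by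
  refine Finset.sum_nbij' ZMod.val (fun t => (t : ZMod N)) ?_ ?_ ?_ ?_ ?_
  · intro x _; exact Finset.mem_range.2 (ZMod.val_lt x)
  · intro x _; exact Finset.mem_univ _
  · intro x _; exact ZMod.natCast_zmod_val x
  · intro t ht; exact ZMod.val_cast_of_lt (Finset.mem_range.1 ht)
  · intro x _; rw [ZMod.natCast_zmod_val]

end Fourier

theorem dir_eq_stdAddChar {n : ℕ} [NeZero (2 * n)] (t : ℤ) :
    dir n t = ZMod.stdAddChar (t : ZMod (2 * n)) := by
  rw [ZMod.stdAddChar_coe, dir, cis]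
  congr 1
  have : (n : ℂ) ≠ 0 := by
    have := NeZero.ne (2 * n)
    exact_mod_cast (show n ≠ 0 by omega)
  push_cast
  field_simp

theorem sum_dir {n : ℕ} (hn : n ≠ 0) : ∑ t ∈ Finset.range (2 * n), dir n t = 0 := by
  have h1 := sum_range_add_of_periodic (F := fun t => dir n t) (N := 2 * n)
    (fun j => by push_cast; exact dir_add_two_mul hn j) n
  simp only [add_comm (n : ℤ), dir_add_self hn, Finset.sum_neg_distrib] at h1
  linear_combination -h1 / 2

/-- The sign is twice the indicator minus one, and the sum of all `2 n`-th roots of unity is zero.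
-/
theorem sum_ite_dir_eq_zero_iff {n : ℕ} (hn : n ≠ 0) (ε : ℤ → Bool) :
    ∑ t ∈ Finset.range (2 * n), (if ε t then dir n t else 0) = 0 ↔
      ∑ t ∈ Finset.range (2 * n), dir n t * ((if ε t then 1 else -1 : ℤ) : ℂ) = 0 := by
  have h : ∑ t ∈ Finset.range (2 * n), dir n t * ((if ε t then 1 else -1 : ℤ) : ℂ) =
      2 * ∑ t ∈ Finset.range (2 * n), (if ε t then dir n t else 0) := by
    trans 2 * ∑ t ∈ Finset.range (2 * n), (if ε t then dir n t else 0) -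
      ∑ t ∈ Finset.range (2 * n), dir n t
    · rw [Finset.mul_sum, ← Finset.sum_sub_distrib]
      refine Finset.sum_congr rfl fun t _ => ?_
      split_ifs <;> push_cast <;> ring
    · rw [sum_dir hn, sub_zero]
  rw [h]; simp

/-! ### The two subwords of a closing word. -/

/-- The subword of `ε` at the positions congruent to `a` modulo `2`. -/
def half (a : ℤ) (ε : ℤ → Bool) (k : ℤ) : Bool := ε (2 * k + a)

/-- Shifts by `4p` and `4q` of `ε` are shifts by `2p` and `2q` of the subword. For signs, `S₁₁ + S₀₀
= S₁₀ + S₀₁` with `S₁₀ = -S₀₀` leaves only `S₀₁ = S₀₀` and `S₁₁ = -S₀₀`. -/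
theorem half_mixed {p q : ℕ} (hp : p.Prime) (hq : q.Prime) {ε : ℤ → Bool}
    (hε : IsAntiperiodic (2 * p * q) ε)
    (h0 : ∑ t ∈ Finset.range (2 * (2 * p * q)), (if ε t then dir (2 * p * q) t else 0) = 0)
    (a k : ℤ) (hk : half a ε (k + 2 * p) ≠ half a ε k) :
    half a ε (k + 2 * q) = half a ε k ∧
      half a ε (k + 2 * q + 2 * p) ≠ half a ε (k + 2 * q) := by
  have hn : 2 * p * q ≠ 0 := by have := hp.pos; have := hq.pos; positivity
  have : NeZero (2 * (2 * p * q)) := ⟨by omega⟩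
  rw [sum_ite_dir_eq_zero_iff hn] at h0
  set N := 2 * (2 * p * q) with hN
  set S : ZMod N → ℤ := fun x => if ε x.val then 1 else -1 with hS
  have hSj : ∀ j : ℤ, S (j : ZMod N) = if ε j then 1 else -1 := by
    intro j
    simp only [hS]
    have h1 : (((j : ZMod N).val : ℕ) : ℤ) = j % N := ZMod.val_intCast j
    have h2 := hε.add_int_mul (j % N) (j / N)
    rw [show j % N + j / N * (2 * (2 * p * q : ℕ)) = j by
      have := Int.emod_add_mul_ediv j N
      rw [hN] at this ⊢; push_cast at this ⊢; linarith] at h2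
    rw [h1, h2]
  have h1 : ∑ x : ZMod N, ZMod.stdAddChar x * (S x : ℂ) = 0 := by
    rw [sum_zmod_eq_sum_range, ← h0]
    refine Finset.sum_congr rfl fun t _ => ?_
    rw [dir_eq_stdAddChar, ← hSj, Int.cast_natCast]
  have h2 := mixed_difference_eq_zero hp hq (by rw [hN]; ring) h1 (by
    intro x
    obtain ⟨j, rfl⟩ := ZMod.intCast_surjective x
    have h3 := hε j
    rw [← Int.cast_natCast, ← Int.cast_add, hSj, hSj, h3]
    cases ε j <;> rfl) ((2 * k + a : ℤ) : ZMod N)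
  have hc : ∀ (i : ℤ) (m : ℕ), ((i : ℤ) : ZMod N) + (m : ZMod N) = ((i + m : ℤ) : ZMod N) :=
    fun i m => by push_cast; ring
  simp only [hc, hSj] at h2
  have e1 : half a ε (k + 2 * q + 2 * p) = ε (2 * k + a + (4 * p : ℕ) + (4 * q : ℕ)) := by
    rw [half]; congr 1; push_cast; ring
  have e2 : half a ε (k + 2 * p) = ε (2 * k + a + (4 * p : ℕ)) := by
    rw [half]; congr 1; push_cast; ring
  have e3 : half a ε (k + 2 * q) = ε (2 * k + a + (4 * q : ℕ)) := by
    rw [half]; congr 1; push_cast; ring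
  have e4 : half a ε k = ε (2 * k + a) := rfl
  rw [e2, e4] at hk
  rw [e1, e3, e4]
  revert h2 hk
  cases ε (2 * k + a + (4 * p : ℕ) + (4 * q : ℕ)) <;> cases ε (2 * k + a + (4 * p : ℕ)) <;>
    cases ε (2 * k + a + (4 * q : ℕ)) <;> cases ε (2 * k + a) <;> simp

theorem half_add_two_mul (a c : ℤ) (ε : ℤ → Bool) :
    half (a + 2 * c) ε = fun k => half a ε (k + c) := by
  funext k; simp only [half]; congr 1; ring

theorem half_congr {a b : ℤ} {m : ℕ} {ε : ℤ → Bool} (hab : Even (b - a))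
    (h : IsAntiperiodic m (half a ε)) : IsAntiperiodic m (half b ε) := by
  obtain ⟨c, hc⟩ := hab
  rw [show b = a + 2 * c by linarith, half_add_two_mul]
  exact h.shift c

theorem half_congr_iff {a b : ℤ} {m : ℕ} {ε : ℤ → Bool} (hab : Even (b - a)) :
    IsAntiperiodic m (half a ε) ↔ IsAntiperiodic m (half b ε) :=
  ⟨half_congr hab, half_congr (by rw [← neg_sub]; exact hab.neg)⟩

theorem isAntiperiodic_two_mul_iff (a : ℤ) {m : ℕ} {ε : ℤ → Bool} :
    IsAntiperiodic (2 * m) ε ↔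
      IsAntiperiodic m (half a ε) ∧ IsAntiperiodic m (half (a + 1) ε) := by
  constructor
  · intro h
    have : ∀ b, IsAntiperiodic m (half b ε) := by
      intro b t
      have := h (2 * t + b)
      rw [half, half, ← this]
      congr 1; push_cast; ring
    exact ⟨this _, this _⟩
  · rintro ⟨h1, h2⟩ t
    have key : ∀ b, IsAntiperiodic m (half b ε) → Even (t - b) →
        ε (t + (2 * m : ℕ)) = !ε t := by
      rintro b hb ⟨k, hk⟩
      have h3 := hb k
      rw [half, half] at h3
      rw [show t = 2 * k + b by linarith, ← h3]
      congr 1; push_cast; ring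
    rcases Int.even_or_odd (t - a) with h | h
    · exact key a h1 h
    · exact key (a + 1) h2 (by rw [← sub_sub]; exact h.sub_odd odd_one)

theorem IsAntiperiodic.mul_odd {m r : ℕ} {δ : ℤ → Bool} (h : IsAntiperiodic m δ) (hr : Odd r) :
    IsAntiperiodic (m * r) δ := by
  intro t
  rw [Nat.cast_mul, mul_comm, h.apply_add_mul, bodd_of_odd hr, Bool.xor_true]

theorem IsAntiperiodic.of_mul_odd {m r : ℕ} {δ : ℤ → Bool} (h : IsAntiperiodic (m * r) δ)
    (hr : Odd r) (hper : ∀ k, δ (k + 2 * m) = δ k) : IsAntiperiodic m δ := by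
  obtain ⟨s, rfl⟩ := hr
  intro t
  rw [← h t]
  have := Function.Periodic.int_mul (c := (2 * m : ℤ)) hper s (t + m)
  rw [← this]
  congr 1; push_cast; ring

/-- By Bézout `u p + v (2 e) = 1`; using `2 e` instead of `e` forces `u` to be odd. A shift by `1`
is then an odd multiple of the antiperiod up to a period. -/
theorem IsAntiperiodic.one_of_period {p : ℕ} (hp : p.Prime) (hp2 : Odd p) {δ : ℤ → Bool}
    (h : IsAntiperiodic p δ) {e : ℤ} (he : ∀ k, δ (k + e) = δ k) (hpe : ¬ (p : ℤ) ∣ e) :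
    IsAntiperiodic 1 δ := by
  have hpZ : Prime (p : ℤ) := Nat.prime_iff_prime_int.1 hp
  have hp2' : ¬ (p : ℤ) ∣ 2 := by
    intro h2
    have h3 : p ∣ 2 := by exact_mod_cast h2
    rw [Nat.prime_dvd_prime_iff_eq hp Nat.prime_two] at h3
    subst h3
    exact absurd hp2 (by decide)
  have hcop : IsCoprime (p : ℤ) (2 * e) :=
    (hpZ.irreducible.coprime_iff_not_dvd).2 fun h1 => (hpZ.dvd_or_dvd h1).elim hp2' hpe
  obtain ⟨u, v, huv⟩ := hcop
  have hu : Odd u := by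
    by_contra hu
    rw [Int.not_odd_iff_even] at hu
    have : Even (1 : ℤ) := by
      rw [← huv]
      exact (hu.mul_right _).add ((even_two_mul e).mul_left v)
    exact absurd this (by decide)
  obtain ⟨w, hw⟩ := hu
  intro t
  have h1 := Function.Periodic.int_mul (c := e) he (2 * v) (t + u * p)
  have h2 := h.add_int_mul (t + p) w
  rw [← h t, ← h2, show t + p + w * (2 * p) = t + u * p by rw [hw]; ring, ← h1]
  congr 1
  push_cast
  linear_combination -huv

theorem not_dvd_two_mul {p q : ℕ} (hp : p.Prime) (hq : q.Prime) (hp2 : Odd p) (hpq : p ≠ q) :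
    ¬ (p : ℤ) ∣ 2 * q := by
  intro h
  have h1 : p ∣ 2 * q := by exact_mod_cast h
  rcases (Nat.Prime.dvd_mul hp).1 h1 with h2 | h2
  · rw [Nat.prime_dvd_prime_iff_eq hp Nat.prime_two] at h2
    subst h2
    exact absurd hp2 (by decide)
  · exact hpq ((Nat.prime_dvd_prime_iff_eq hp hq).1 h2)

theorem IsAntiperiodic.one_of_both {p q : ℕ} (hp : p.Prime) (hq : q.Prime) (hp2 : Odd p)
    (hpq : p ≠ q) {δ : ℤ → Bool} (h : IsAntiperiodic p δ) (h' : IsAntiperiodic q δ) :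
    IsAntiperiodic 1 δ :=
  h.one_of_period hp hp2 h'.two_mul (not_dvd_two_mul hp hq hp2 hpq)

/-- Otherwise the letter changes somewhere under `+2p` and somewhere under `+2q`. By `half_mixed`
the first kind of change propagates along steps of `2q` and excludes the second kind there; the
second propagates along steps of `2p`. Once the starting points have equal parity, the two
progressions meet, which is a contradiction. -/
theorem half_dichotomy {p q : ℕ} (hp : p.Prime) (hq : q.Prime) (hp2 : Odd p) (hq2 : Odd q)
    (hpq : p ≠ q) {ε : ℤ → Bool} (hε : IsAntiperiodic (2 * p * q) ε)
    (h0 : ∑ t ∈ Finset.range (2 * (2 * p * q)), (if ε t then dir (2 * p * q) t else 0) = 0)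
    (a : ℤ) : IsAntiperiodic p (half a ε) ∨ IsAntiperiodic q (half a ε) := by
  have hε' : IsAntiperiodic (2 * q * p) ε := by rwa [mul_right_comm]
  have hδ : IsAntiperiodic (p * q) (half a ε) :=
    ((isAntiperiodic_two_mul_iff a).1 (by rwa [← mul_assoc])).1
  by_contra! hcon
  obtain ⟨k0, hk0⟩ : ∃ k, half a ε (k + 2 * p) ≠ half a ε k := by
    by_contra! h
    exact hcon.1 (hδ.of_mul_odd hq2 h)
  obtain ⟨k1, hk1⟩ : ∃ k, half a ε (k + 2 * q) ≠ half a ε k := by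
    by_contra! h
    exact hcon.2 (IsAntiperiodic.of_mul_odd (by rwa [mul_comm]) hp2 h)
  obtain ⟨k2, hk2, hev⟩ : ∃ k, half a ε (k + 2 * q) ≠ half a ε k ∧ Even (k - k0) := by
    rcases Int.even_or_odd (k1 - k0) with h | h
    · exact ⟨k1, hk1, h⟩
    -- Shifting by the odd antiperiod `p * q` changes the parity and preserves the inequality of
    -- letters.
    · refine ⟨k1 + (p * q : ℕ), ?_, ?_⟩
      · rw [add_right_comm, hδ, hδ]
        simpa using hk1
      · rw [add_sub_right_comm]
        exact h.add_odd (by exact_mod_cast hp2.mul hq2)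
  have hx : ∀ x : ℕ, half a ε (k0 + x * (2 * q) + 2 * p) ≠ half a ε (k0 + x * (2 * q)) := by
    intro x
    induction x with
    | zero => simpa using hk0
    | succ x ih =>
      have := (half_mixed hp hq hε h0 a _ ih).2
      rwa [show k0 + (x + 1 : ℕ) * (2 * q : ℤ) = k0 + x * (2 * q) + 2 * q by push_cast; ring]
  have hy : ∀ y : ℕ, half a ε (k2 + y * (2 * p) + 2 * q) ≠ half a ε (k2 + y * (2 * p)) := by
    intro y
    induction y with
    | zero => simpa using hk2
    | succ y ih =>
      have h0' := h0
      rw [mul_right_comm 2 p q] at h0'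
      have := (half_mixed hq hp hε' h0' a _ ih).2
      rwa [show k2 + (y + 1 : ℕ) * (2 * p : ℤ) = k2 + y * (2 * p) + 2 * p by push_cast; ring]
  obtain ⟨c, hc⟩ := hev
  have hcop : IsCoprime (q : ℤ) (p : ℤ) :=
    Nat.isCoprime_iff_coprime.2 ((Nat.coprime_primes hq hp).2 hpq.symm)
  obtain ⟨u, v, huv⟩ := hcop
  -- Adding `M * p` and `M * q` makes both Bézout coefficients nonnegative without moving the
  -- meeting point off either progression.
  set M : ℤ := |c * u| + |c * v| with hM
  have hp1 : (1 : ℤ) ≤ p := by exact_mod_cast hp.one_le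
  have hq1 : (1 : ℤ) ≤ q := by exact_mod_cast hq.one_le
  have hM0 : 0 ≤ M := by positivity
  have hX : 0 ≤ c * u + M * p := by
    have h1 := neg_abs_le (c * u)
    have h2 := abs_nonneg (c * v)
    nlinarith
  have hY : 0 ≤ -(c * v) + M * q := by
    have h1 := le_abs_self (c * v)
    have h2 := abs_nonneg (c * u)
    nlinarith
  obtain ⟨x, hx'⟩ := Int.eq_ofNat_of_zero_le hX
  obtain ⟨y, hy'⟩ := Int.eq_ofNat_of_zero_le hY
  have heq : k0 + x * (2 * q : ℤ) = k2 + y * (2 * p) := by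
    rw [← hx', ← hy']
    linear_combination 2 * c * huv - hc
  have h1 := (half_mixed hp hq hε h0 a _ (hx x)).1
  rw [heq] at h1
  exact hy y h1

/-- A shift by `m` multiplies the sum over a period by `-dir n m`, which is not `1` since `0 < m <
n`. -/
theorem sum_eq_zero_of_twist {n m : ℕ} (hm : 0 < m) (hmn : m < n) {F : ℤ → ℂ}
    (hper : ∀ j, F (j + 2 * n) = F j) (h : ∀ j, F (j + m) = -dir n m * F j) :
    ∑ t ∈ Finset.range (2 * n), F t = 0 := by
  have : NeZero (2 * n) := ⟨by omega⟩
  have h1 := sum_range_add_of_periodic (F := F) (N := 2 * n)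
    (fun j => by push_cast; exact hper j) m
  simp only [add_comm (m : ℤ), h, ← Finset.mul_sum] at h1
  have h2 : dir n m ≠ -1 := by
    rw [← dir_self (n := n) (by omega), dir_eq_stdAddChar, dir_eq_stdAddChar]
    intro h3
    have h4 := ZMod.injective_stdAddChar h3
    rw [Int.cast_natCast, Int.cast_natCast, ZMod.natCast_eq_natCast_iff'] at h4
    rw [Nat.mod_eq_of_lt (by omega), Nat.mod_eq_of_lt (by omega)] at h4
    omega
  have h3 : (1 + dir n m) * ∑ t ∈ Finset.range (2 * n), F t = 0 := by linear_combination -h1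
  rcases mul_eq_zero.1 h3 with h4 | h4
  · exact absurd (by linear_combination h4) h2
  · exact h4

/-! ### Classification of the sporadic words for `n = 2pq`. -/

/-- The words of the sporadic Reinhardt polygons with `n` sides. -/
def IsSporadicWord (n : ℕ) (ε : ℤ → Bool) : Prop :=
  IsAntiperiodic n ε ∧ ∑ t ∈ Finset.range (2 * n), (if ε t then dir n t else 0) = 0 ∧
    ¬ ∃ m, m ∣ n ∧ m < n ∧ IsAntiperiodic m ε

/-- One of the two subwords is antiperiodic with antiperiod `p`, and the other one with antiperiod
`q`, and neither of them is alternating. -/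
def IsMixed (p q : ℕ) (a : ℤ) (ε : ℤ → Bool) : Prop :=
  (IsAntiperiodic p (half a ε) ∧ ¬ IsAntiperiodic 1 (half a ε)) ∧
    (IsAntiperiodic q (half (a + 1) ε) ∧ ¬ IsAntiperiodic 1 (half (a + 1) ε))

theorem IsAntiperiodic.of_one {p : ℕ} (hp2 : Odd p) {δ : ℤ → Bool} (h : IsAntiperiodic 1 δ) :
    IsAntiperiodic p δ := by
  simpa using h.mul_odd hp2

/-- If both subwords had the same antiperiod `p` or `q`, the word would have antiperiod `2p` or
`2q`. An alternating subword has both antiperiods, as `p` and `q` are odd, and would lead to the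
same situation. -/
theorem IsSporadicWord.exists_isMixed {p q : ℕ} (hp : p.Prime) (hq : q.Prime) (hp2 : Odd p)
    (hq2 : Odd q) (hpq : p ≠ q) {ε : ℤ → Bool} (h : IsSporadicWord (2 * p * q) ε) :
    IsMixed p q 0 ε ∨ IsMixed p q 1 ε := by
  obtain ⟨hε, h0, hno⟩ := h
  have hp1 := hp.two_le
  have hq1 := hq.two_le
  have hnp : ¬ IsAntiperiodic (2 * p) ε := fun h =>
    hno ⟨_, ⟨q, rfl⟩, by nlinarith, h⟩
  have hnq : ¬ IsAntiperiodic (2 * q) ε := fun h =>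
    hno ⟨_, ⟨p, by ring⟩, by nlinarith, h⟩
  have hd := half_dichotomy hp hq hp2 hq2 hpq hε h0
  rw [isAntiperiodic_two_mul_iff 0, zero_add] at hnp hnq
  have e : ∀ m, IsAntiperiodic m (half 0 ε) ↔ IsAntiperiodic m (half (1 + 1) ε) := fun m =>
    half_congr_iff (by decide)
  rcases hd 0 with h1 | h1
  · have h2 : IsAntiperiodic q (half 1 ε) := (hd 1).resolve_left fun h => hnp ⟨h1, h⟩
    refine Or.inl ⟨⟨h1, fun h => hnq ⟨h.of_one hq2, h2⟩⟩, ?_⟩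
    rw [zero_add]
    exact ⟨h2, fun h => hnp ⟨h1, h.of_one hp2⟩⟩
  · have h2 : IsAntiperiodic p (half 1 ε) := (hd 1).resolve_right fun h => hnq ⟨h1, h⟩
    refine Or.inr ⟨⟨h2, fun h => hnq ⟨h1, h.of_one hq2⟩⟩, ?_⟩
    rw [← e, ← e]
    exact ⟨h1, fun h => hnp ⟨h.of_one hp2, h2⟩⟩

theorem IsMixed.antiperiodic {p q : ℕ} (hp2 : Odd p) (hq2 : Odd q) {a : ℤ} {ε : ℤ → Bool}
    (h : IsMixed p q a ε) : IsAntiperiodic (2 * p * q) ε := by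
  rw [mul_assoc, isAntiperiodic_two_mul_iff a]
  exact ⟨h.1.1.mul_odd hq2, by rw [mul_comm]; exact h.2.1.mul_odd hp2⟩

theorem sum_half_eq_zero {m n : ℕ} (hm : 0 < m) (hmn : 2 * m < n) {ε : ℤ → Bool}
    (hε : IsAntiperiodic n ε) {a : ℤ} (h : IsAntiperiodic m (half a ε)) :
    ∑ t ∈ Finset.range (2 * n),
      (if Even ((t : ℤ) - a) then dir n t * ((if ε t then 1 else -1 : ℤ) : ℂ) else 0) = 0 := by
  refine sum_eq_zero_of_twist (m := 2 * m) (by omega) hmn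
    (F := fun t => if Even (t - a) then dir n t * ((if ε t then 1 else -1 : ℤ) : ℂ) else 0)
    ?_ ?_
  · intro j
    have : Even (j + 2 * n - a) ↔ Even (j - a) := by
      rw [show j + 2 * n - a = j - a + 2 * n by ring, Int.even_add]
      simp
    simp only [this, dir_add_two_mul (show n ≠ 0 by omega), hε.two_mul]
  · intro j
    have h1 : Even (j + (2 * m : ℕ) - a) ↔ Even (j - a) := by
      rw [show j + (2 * m : ℕ) - a = j - a + 2 * m by push_cast; ring, Int.even_add]
      simp
    simp only [h1]
    by_cases h2 : Even (j - a)
    · obtain ⟨k, hk⟩ := id h2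
      have h5 := h k
      rw [half, half, show 2 * (k + (m : ℤ)) + a = j + (2 * m : ℕ) by push_cast; linarith,
        show 2 * k + a = j by linarith] at h5
      rw [if_pos h2, if_pos h2, h5, dir_add]
      cases ε j <;> simp <;> ring
    · rw [if_neg h2, if_neg h2, mul_zero]

theorem IsMixed.sum_eq_zero {p q : ℕ} (hp : p.Prime) (hq : q.Prime) (hp2 : Odd p) (hq2 : Odd q)
    {a : ℤ} {ε : ℤ → Bool} (h : IsMixed p q a ε) :
    ∑ t ∈ Finset.range (2 * (2 * p * q)), (if ε t then dir (2 * p * q) t else 0) = 0 := by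
  have hε := h.antiperiodic hp2 hq2
  have hp1 := hp.two_le
  have hq1 := hq.two_le
  have hn : 2 * p * q ≠ 0 := by positivity
  have hA := sum_half_eq_zero hp.pos (by nlinarith) hε h.1.1
  have hB := sum_half_eq_zero hq.pos (by nlinarith) hε h.2.1
  have hAB := congrArg₂ (· + ·) hA hB
  simp only [add_zero] at hAB
  rw [sum_ite_dir_eq_zero_iff hn, ← hAB, ← Finset.sum_add_distrib]
  refine Finset.sum_congr rfl fun t _ => ?_
  have : Even ((t : ℤ) - (a + 1)) ↔ ¬ Even ((t : ℤ) - a) := by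
    rw [← sub_sub, Int.even_sub_one]
  by_cases h1 : Even ((t : ℤ) - a) <;> simp [this, h1]

/-- If `m` is an antiperiod with `m * r = 2pq` and `m < 2pq`, then `r` is odd and divisible by `p`
or `q`, so `2q` or `2p` is an antiperiod as well. One subword then has both antiperiods `p` and `q`
and is alternating. -/
theorem IsMixed.isSporadicWord {p q : ℕ} (hp : p.Prime) (hq : q.Prime) (hp2 : Odd p)
    (hq2 : Odd q) (hpq : p ≠ q) {a : ℤ} {ε : ℤ → Bool} (h : IsMixed p q a ε) :
    IsSporadicWord (2 * p * q) ε := by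
  have hε := h.antiperiodic hp2 hq2
  refine ⟨hε, h.sum_eq_zero hp hq hp2 hq2, ?_⟩
  rintro ⟨m, ⟨r, hr⟩, hlt, hm⟩
  have hro : Odd r := by
    by_contra hro
    rw [Nat.not_odd_iff_even] at hro
    obtain ⟨s, rfl⟩ := hro
    have h1 := hε 0
    rw [hr, show ((m * (s + s) : ℕ) : ℤ) = s * (2 * m) by push_cast; ring, hm.add_int_mul] at h1
    simp at h1
  have hr1 : r ≠ 1 := by rintro rfl; omega
  obtain ⟨l, hl, hlr⟩ := Nat.exists_prime_and_dvd hr1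
  have hlo : Odd l := hro.of_dvd_nat hlr
  have hl2 : ¬ l ∣ 2 := by
    intro h
    rw [Nat.prime_dvd_prime_iff_eq hl Nat.prime_two] at h
    subst h
    exact absurd hlo (by decide)
  obtain ⟨s, rfl⟩ := hlr
  have hso : Odd s := (Nat.odd_mul.1 hro).2
  have hdvd : l ∣ 2 * p * q := ⟨m * s, by rw [hr]; ring⟩
  have h3 : l = p ∨ l = q := by
    rcases (Nat.Prime.dvd_mul hl).1 hdvd with h1 | h1
    · rcases (Nat.Prime.dvd_mul hl).1 h1 with h2 | h2
      · exact absurd h2 hl2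
      · exact Or.inl ((Nat.prime_dvd_prime_iff_eq hl hp).1 h2)
    · exact Or.inr ((Nat.prime_dvd_prime_iff_eq hl hq).1 h1)
  rcases h3 with rfl | rfl
  · have h4 : m * s = 2 * q := by
      apply Nat.eq_of_mul_eq_mul_left hl.pos
      rw [← mul_assoc, mul_comm l m, mul_assoc, ← hr]; ring
    have h5 := hm.mul_odd hso
    rw [h4, isAntiperiodic_two_mul_iff a] at h5
    exact h.1.2 (h.1.1.one_of_both hp hq hp2 hpq h5.1)
  · have h4 : m * s = 2 * p := by
      apply Nat.eq_of_mul_eq_mul_left hl.pos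
      rw [← mul_assoc, mul_comm l m, mul_assoc, ← hr]; ring
    have h5 := hm.mul_odd hso
    rw [h4, isAntiperiodic_two_mul_iff a] at h5
    exact h.2.2 (h5.2.one_of_both hp hq hp2 hpq h.2.1)

theorem IsMixed.not_half_succ {p q : ℕ} (hp : p.Prime) (hq : q.Prime) (hp2 : Odd p)
    (hpq : p ≠ q) {a b : ℤ} {ε : ℤ → Bool} (h : IsMixed p q a ε) (hb : Odd (b - a))
    (h' : IsAntiperiodic p (half b ε)) : False :=
  h.2.2 ((half_congr (by rw [show a + 1 - b = -(b - a) + 1 by ring]; exact hb.neg.add_odd odd_one)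
    h').one_of_both hp hq hp2 hpq h.2.1)

/-- An odd shift would exchange the two subwords, which have different types. An even shift `2 e`
has `p ∣ e` and `q ∣ e` because no subword alternates, and `e` is an even multiple of `pq` since
`2pq` is an antiperiod. -/
theorem IsMixed.dvd_of_shift {p q : ℕ} (hp : p.Prime) (hq : q.Prime) (hp2 : Odd p)
    (hq2 : Odd q) (hpq : p ≠ q) {a : ℤ} {ε : ℤ → Bool} (h : IsMixed p q a ε) {r : ℤ}
    (hr : ∀ j, ε (j + r) = ε j) : ((2 * (2 * p * q) : ℕ) : ℤ) ∣ r := by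
  rcases Int.even_or_odd r with ⟨e, he⟩ | hodd
  · have hper : ∀ b k, half b ε (k + e) = half b ε k := by
      intro b k
      rw [half, half, ← hr (2 * k + b)]
      congr 1; rw [he]; ring
    have h1 : (p : ℤ) ∣ e := by
      by_contra hpe
      exact h.1.2 (h.1.1.one_of_period hp hp2 (hper a) hpe)
    have h2 : (q : ℤ) ∣ e := by
      by_contra hqe
      exact h.2.2 (h.2.1.one_of_period hq hq2 (hper (a + 1)) hqe)
    have hcop : IsCoprime (p : ℤ) (q : ℤ) :=
      Nat.isCoprime_iff_coprime.2 ((Nat.coprime_primes hp hq).2 hpq)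
    obtain ⟨k, hk⟩ := hcop.mul_dvd h1 h2
    have hε := h.antiperiodic hp2 hq2
    rcases Int.even_or_odd k with ⟨w, hw⟩ | ⟨w, hw⟩
    · exact ⟨w, by rw [he, hk, hw]; push_cast; ring⟩
    · have h3 := hε 0
      rw [← hr 0, ← hε.add_int_mul _ w, show (0 : ℤ) + r =
        0 + (2 * p * q : ℕ) + w * (2 * (2 * p * q : ℕ)) by rw [he, hk, hw]; push_cast; ring] at h3
      simp at h3
  · refine (h.not_half_succ hp hq hp2 hpq (b := a + r) (by simpa using hodd) ?_).elim
    have : half (a + r) ε = half a ε := by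
      funext k
      rw [half, half, ← add_assoc, hr]
    rw [this]
    exact h.1.1

/-- A reflection with odd `r` exchanges the two subwords. One with `r = 2 e` exchanges `e - pq` and
`e + pq`, whose letters differ by antiperiodicity. -/
theorem IsMixed.not_reflect {p q : ℕ} (hp : p.Prime) (hq : q.Prime) (hp2 : Odd p)
    (hq2 : Odd q) (hpq : p ≠ q) {a : ℤ} {ε : ℤ → Bool} (h : IsMixed p q a ε) {r : ℤ}
    (hr : ∀ j, ε (r - j) = ε j) : False := by
  rcases Int.even_or_odd r with ⟨e, he⟩ | hodd
  · have h1 := h.antiperiodic hp2 hq2 (e - p * q)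
    rw [← hr (e - p * q), show r - (e - p * q) = e - p * q + (2 * p * q : ℕ) by
      rw [he]; push_cast; ring] at h1
    simp at h1
  · refine h.not_half_succ hp hq hp2 hpq (b := r - a) ?_ ?_
    · rw [sub_sub]
      exact hodd.sub_even ⟨a, rfl⟩
    · have : half (r - a) ε = fun k => half a ε (0 - k) := by
        funext k
        rw [half, half, ← hr]
        congr 1; ring
      rw [this]
      exact h.1.1.reflect 0

/-! ### Counting the sporadic words. -/

/-- Words with antiperiod `m` are determined by their first `m` letters. -/
def antiperiodicEquiv {m : ℕ} (hm : 0 < m) :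
    {δ : ℤ → Bool // IsAntiperiodic m δ} ≃ (Fin m → Bool) where
  toFun δ i := δ.1 (i : ℕ)
  invFun f := ⟨fun j => f ⟨(j % m).toNat, by
      have := Int.emod_lt_of_pos j (show (0 : ℤ) < m by exact_mod_cast hm)
      omega⟩ ^^ (j / m).bodd, by
    intro t
    have h0 : (m : ℤ) ≠ 0 := by omega
    simp only [Int.add_emod_right, Int.add_ediv_of_dvd_right (dvd_refl (m : ℤ)), Int.ediv_self h0,
      Int.bodd_add, Int.bodd_one, Bool.xor_true, Bool.xor_not]⟩
  left_inv := by
    rintro ⟨δ, hδ⟩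
    apply Subtype.ext
    funext j
    have h1 := Int.emod_nonneg j (show (m : ℤ) ≠ 0 by omega)
    have h2 := Int.emod_add_mul_ediv j m
    simp only [Int.toNat_of_nonneg h1]
    rcases Int.even_or_odd (j / m) with ⟨w, hw⟩ | ⟨w, hw⟩
    · have h3 := hδ.add_int_mul (j % m) w
      rw [show j % m + w * (2 * m) = j by rw [hw] at h2; linarith] at h3
      rw [hw, h3]
      simp
    · have h3 := hδ.add_int_mul (j % m + m) w
      rw [show j % m + m + w * (2 * m) = j by rw [hw] at h2; linarith, hδ] at h3
      rw [hw, h3]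
      simp [show Int.bodd 2 = false from rfl]
  right_inv := by
    intro f
    funext i
    have h1 : ((i : ℕ) : ℤ) % m = i := Int.emod_eq_of_lt (by omega) (by exact_mod_cast i.2)
    have h2 : ((i : ℕ) : ℤ) / m = 0 := Int.ediv_eq_zero_of_lt (by omega) (by exact_mod_cast i.2)
    simp [h1, h2]

theorem ncard_antiperiodic {m : ℕ} (hm : 0 < m) :
    {δ : ℤ → Bool | IsAntiperiodic m δ}.ncard = 2 ^ m := by
  rw [← Nat.card_coe_set_eq]
  exact (Nat.card_congr (antiperiodicEquiv hm)).trans (by simp)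

theorem ncard_antiperiodic_diff {p : ℕ} (hp2 : Odd p) :
    {δ : ℤ → Bool | IsAntiperiodic p δ ∧ ¬ IsAntiperiodic 1 δ}.ncard = 2 ^ p - 2 := by
  have h1 := Set.ncard_sdiff_add_ncard_of_subset
    (s := {δ : ℤ → Bool | IsAntiperiodic 1 δ}) (t := {δ : ℤ → Bool | IsAntiperiodic p δ})
    (fun δ hδ => hδ.of_one hp2)
    (Set.finite_of_ncard_ne_zero (by rw [ncard_antiperiodic hp2.pos]; positivity))
  rw [ncard_antiperiodic hp2.pos, ncard_antiperiodic one_pos] at h1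
  have h2 : {δ : ℤ → Bool | IsAntiperiodic p δ ∧ ¬ IsAntiperiodic 1 δ} =
    {δ : ℤ → Bool | IsAntiperiodic p δ} \ {δ : ℤ → Bool | IsAntiperiodic 1 δ} := rfl
  rw [h2]
  omega

/-- A word is determined by its two subwords. -/
def halves (a : ℤ) : (ℤ → Bool) ≃ (ℤ → Bool) × (ℤ → Bool) where
  toFun ε := (half a ε, half (a + 1) ε)
  invFun x j := if (j - a) % 2 = 0 then x.1 ((j - a) / 2) else x.2 ((j - a) / 2)
  left_inv := by
    intro ε
    funext j
    simp only [half]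
    split_ifs with h
    · congr 1; omega
    · congr 1; omega
  right_inv := by
    rintro ⟨δ, δ'⟩
    refine Prod.ext ?_ ?_
    · funext k
      simp [half]
    · funext k
      simp only [half]
      rw [if_neg (by omega)]
      congr 1; omega

theorem ncard_isMixed {p q : ℕ} (hp2 : Odd p) (hq2 : Odd q) (a : ℤ) :
    {ε | IsMixed p q a ε}.ncard = (2 ^ p - 2) * (2 ^ q - 2) := by
  rw [← ncard_antiperiodic_diff hp2, ← ncard_antiperiodic_diff hq2, ← Set.ncard_prod,
    ← Set.ncard_preimage_of_injective_subset_range (halves a).injective (by simp)]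
  rfl

theorem ncard_isSporadicWord {p q : ℕ} (hp : p.Prime) (hq : q.Prime) (hp2 : Odd p)
    (hq2 : Odd q) (hpq : p ≠ q) :
    {ε | IsSporadicWord (2 * p * q) ε}.ncard = 2 * ((2 ^ p - 2) * (2 ^ q - 2)) := by
  have h1 : {ε | IsSporadicWord (2 * p * q) ε} =
      {ε | IsMixed p q 0 ε} ∪ {ε | IsMixed p q 1 ε} := by
    ext ε
    exact ⟨fun h => h.exists_isMixed hp hq hp2 hq2 hpq, fun h => h.elim
      (fun h => h.isSporadicWord hp hq hp2 hq2 hpq) (fun h => h.isSporadicWord hp hq hp2 hq2 hpq)⟩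
  have hpos : ∀ {m : ℕ}, m.Prime → Odd m → 0 < 2 ^ m - 2 := by
    intro m hm hm2
    have h3 : 3 ≤ m := by
      have := hm.two_le
      rcases hm2 with ⟨k, hk⟩
      omega
    have := Nat.pow_le_pow_right (show 0 < 2 by norm_num) h3
    omega
  have hfin : ∀ a, {ε | IsMixed p q a ε}.Finite := fun a => Set.finite_of_ncard_ne_zero (by
    rw [ncard_isMixed hp2 hq2]
    exact (Nat.mul_pos (hpos hp hp2) (hpos hq hq2)).ne')
  have hdisj : Disjoint {ε | IsMixed p q 0 ε} {ε | IsMixed p q 1 ε} := by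
    rw [Set.disjoint_left]
    intro ε h h'
    exact h.not_half_succ hp hq hp2 hpq (b := 1) (by decide) h'.1.1
  rw [h1, Set.ncard_union_eq hdisj (hfin _) (hfin _), ncard_isMixed hp2 hq2, ncard_isMixed hp2 hq2]
  ring

/-! ### Similarities of the plane and their action on words. -/

theorem exists_eq_of_dilationEquiv (f : ℂ ≃ᵈ ℂ) :
    ∃ a b : ℂ, a ≠ 0 ∧ ((∀ z, f z = a * z + b) ∨ ∀ z, f z = a * (starRingEnd ℂ) z + b) := by
  set r : ℝ := (Dilation.ratio f : ℝ) with hr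
  have hr0 : 0 < r := by
    rw [hr]; exact_mod_cast Dilation.ratio_pos f
  have hrC : (r : ℂ) ≠ 0 := by exact_mod_cast hr0.ne'
  -- Dividing by the ratio leaves an isometry, which is affine by Mazur–Ulam; its linear part is a
  -- rotation, possibly after conjugation.
  let g : ℂ ≃ᵢ ℂ :=
    { toEquiv := f.toEquiv.trans (Equiv.mulLeft₀ ((r : ℂ)⁻¹) (inv_ne_zero hrC))
      isometry_toFun := Isometry.of_dist_eq fun x y => by
        have h1 : dist (f x) (f y) = r * dist x y := Dilation.dist_eq f x y
        rw [dist_eq_norm] at h1 ⊢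
        simp only [Equiv.toFun_as_coe, Equiv.trans_apply, Equiv.mulLeft₀_apply,
          DilationEquiv.coe_toEquiv]
        rw [← mul_sub, norm_mul, h1, norm_inv, Complex.norm_real, Real.norm_of_nonneg hr0.le]
        field_simp }
  have hg : ∀ z, f z = r * g z := by
    intro z
    change f z = r * ((r : ℂ)⁻¹ * f z)
    field_simp
  have hL : ∀ z, g z = g.toRealAffineIsometryEquiv.linearIsometryEquiv z + g 0 := by
    intro z
    have := g.toRealAffineIsometryEquiv.map_vadd 0 z
    simpa using this
  obtain ⟨c, hc | hc⟩ := linear_isometry_complex g.toRealAffineIsometryEquiv.linearIsometryEquiv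
  · refine ⟨r * c, r * g 0, mul_ne_zero hrC (Circle.coe_ne_zero c), Or.inl fun z => ?_⟩
    rw [hg, hL, hc, rotation_apply]; ring
  · refine ⟨r * c, r * g 0, mul_ne_zero hrC (Circle.coe_ne_zero c), Or.inr fun z => ?_⟩
    rw [hg, hL, hc, LinearIsometryEquiv.trans_apply, rotation_apply, conjLIE_apply]; ring

theorem exists_dilationEquiv_affine {a : ℂ} (ha : a ≠ 0) (b : ℂ) :
    ∃ f : ℂ ≃ᵈ ℂ, ∀ z, f z = a * z + b :=
  ⟨{ toEquiv := (Equiv.mulLeft₀ a ha).trans (Equiv.addRight b)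
     edist_eq' := ⟨‖a‖₊, by simpa using ha, fun x y => by
      simp only [Equiv.toFun_as_coe, Equiv.trans_apply, Equiv.mulLeft₀_apply, Equiv.coe_addRight,
        edist_add_right]
      rw [edist_nndist, edist_nndist, nndist_eq_nnnorm, nndist_eq_nnnorm, ← mul_sub, nnnorm_mul,
        ENNReal.coe_mul]⟩ }, fun _ => rfl⟩

theorem exists_dilationEquiv_conj {a : ℂ} (ha : a ≠ 0) (b : ℂ) :
    ∃ f : ℂ ≃ᵈ ℂ, ∀ z, f z = a * (starRingEnd ℂ) z + b := by
  obtain ⟨f, hf⟩ := exists_dilationEquiv_affine ha b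
  exact ⟨conjLIE.toIsometryEquiv.toDilationEquiv.trans f, fun z => hf _⟩

/-- Two words are equivalent if they agree up to a shift and a reflection. -/
def WordEquiv (ε ε' : ℤ → Bool) : Prop :=
  ∃ r : ℤ, (∀ j, ε' j = ε (j + r)) ∨ ∀ j, ε' j = ε (r - j)

namespace IsPath

variable {n : ℕ} {ε : ℤ → Bool} {l : ℂ} {A : ℤ → ℂ}

theorem reflect (h : IsPath n ε l A) (hl : l ≠ 0) (r : ℤ) :
    ∃ l' : ℂ, l' ≠ 0 ∧
      IsPath n (fun j => ε (r - j)) l' fun j => (starRingEnd ℂ) (A (1 + r - j)) := by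
  have h1 := h.image_conj.shift (-1 - r)
  have e1 : (fun j => ε (-1 - (j + (-1 - r)))) = fun j => ε (r - j) := by
    funext j; congr 1; ring
  have e2 : (fun j => (starRingEnd ℂ) (A (-(j + (-1 - r))))) =
      fun j => (starRingEnd ℂ) (A (1 + r - j)) := by
    funext j; congr 2; ring
  rw [e1, e2] at h1
  exact ⟨_, by simpa using hl, h1⟩

/-- A similarity carries a path to a path with the same word or, if it reverses orientation, to one
with the reversed word, and the vertex set determines the word up to shift. Conversely, paths with
the same word differ by an affine map `z ↦ a z + b`. -/
theorem exists_dilationEquiv_iff (h : IsPath n ε l A) (hn : n ≠ 0) (hε : IsAntiperiodic n ε)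
    {ε' : ℤ → Bool} {l' : ℂ} {A' : ℤ → ℂ} (h' : IsPath n ε' l' A') (hε' : IsAntiperiodic n ε')
    (hl : l ≠ 0) (hl' : l' ≠ 0) :
    (∃ f : ℂ ≃ᵈ ℂ, f '' Set.range A = Set.range A') ↔ WordEquiv ε ε' := by
  constructor
  · rintro ⟨f, hf⟩
    rw [← Set.range_comp] at hf
    obtain ⟨a, b, ha, hab | hab⟩ := exists_eq_of_dilationEquiv f
    · obtain ⟨r, hr⟩ := (h.image_affine a b).exists_shift_of_range_eq hn hε h' hε'
        (mul_ne_zero ha hl) hl' (by rw [← hf]; congr 1; funext j; exact (hab _).symm)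
      exact ⟨r, Or.inl hr⟩
    · obtain ⟨l₁, hl₁, h₁⟩ := h.reflect hl 0
      obtain ⟨r, hr⟩ := (h₁.image_affine a b).exists_shift_of_range_eq hn (hε.reflect 0) h' hε'
        (mul_ne_zero ha hl₁) hl' (by
          rw [← hf]
          ext z
          constructor
          · rintro ⟨j, rfl⟩
            exact ⟨1 + 0 - j, hab _⟩
          · rintro ⟨j, rfl⟩
            refine ⟨1 - j, ?_⟩
            simp only [Function.comp_apply, hab]
            congr 4; ring)
      refine ⟨-r, Or.inr fun j => ?_⟩
      rw [hr]; congr 1; ring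
  · rintro ⟨r, hr | hr⟩
    · obtain rfl : ε' = fun j => ε (j + r) := funext hr
      have h1 := (h.shift r).eq_affine h' (mul_ne_zero hl (dir_ne_zero _ _))
      obtain ⟨f, hf⟩ := exists_dilationEquiv_affine
        (div_ne_zero hl' (mul_ne_zero hl (dir_ne_zero n r)))
        (A' 0 - l' / (l * dir n r) * A (0 + r))
      refine ⟨f, ?_⟩
      rw [← Set.range_comp]
      ext z
      constructor
      · rintro ⟨j, rfl⟩
        refine ⟨j - r, ?_⟩
        rw [h1, Function.comp_apply, hf, sub_add_cancel]
      · rintro ⟨j, rfl⟩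
        exact ⟨j + r, by rw [h1, Function.comp_apply, hf]⟩
    · obtain rfl : ε' = fun j => ε (r - j) := funext hr
      obtain ⟨l₁, hl₁, h₁⟩ := h.reflect hl r
      have h1 := h₁.eq_affine h' hl₁
      obtain ⟨f, hf⟩ := exists_dilationEquiv_conj (div_ne_zero hl' hl₁)
        (A' 0 - l' / l₁ * (starRingEnd ℂ) (A (1 + r - 0)))
      refine ⟨f, ?_⟩
      rw [← Set.range_comp]
      ext z
      constructor
      · rintro ⟨j, rfl⟩
        refine ⟨1 + r - j, ?_⟩
        rw [h1, Function.comp_apply, hf, sub_sub_cancel]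
      · rintro ⟨j, rfl⟩
        exact ⟨1 + r - j, by rw [h1, Function.comp_apply, hf]⟩

theorem sum_dir_eq_zero (h : IsPath n ε l A) (hl : l ≠ 0) :
    ∑ t ∈ Finset.range (2 * n), (if ε t then dir n t else 0) = 0 := by
  have h1 := h.sum_eq_zero
  have h2 : ∀ t : ℤ, (if ε t then l * dir n t else 0) = l * if ε t then dir n t else 0 := by
    intro t; split_ifs <;> simp
  simp only [h2, ← Finset.mul_sum] at h1
  exact (mul_eq_zero.1 h1).resolve_left hl

end IsPath

theorem IsSporadicWord.exists_isPath {n : ℕ} (hn : n ≠ 0) {ε : ℤ → Bool}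
    (h : IsSporadicWord n ε) : ∃ A, IsPath n ε 1 A :=
  Reinhardt.exists_isPath hn h.1 1 (by simpa using h.2.1)

theorem IsSporadicWord.shift {n : ℕ} (hn : n ≠ 0) {ε : ℤ → Bool} (h : IsSporadicWord n ε)
    (r : ℤ) : IsSporadicWord n fun j => ε (j + r) := by
  obtain ⟨A, hA⟩ := h.exists_isPath hn
  refine ⟨h.1.shift r, (hA.shift r).sum_dir_eq_zero (by simp), ?_⟩
  rintro ⟨m, h1, h2, h3⟩
  refine h.2.2 ⟨m, h1, h2, ?_⟩
  simpa using h3.shift (-r)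

theorem IsSporadicWord.reflect {n : ℕ} (hn : n ≠ 0) {ε : ℤ → Bool} (h : IsSporadicWord n ε)
    (r : ℤ) : IsSporadicWord n fun j => ε (r - j) := by
  obtain ⟨A, hA⟩ := h.exists_isPath hn
  obtain ⟨l, hl, h'⟩ := hA.reflect one_ne_zero r
  refine ⟨h.1.reflect r, h'.sum_dir_eq_zero hl, ?_⟩
  rintro ⟨m, h1, h2, h3⟩
  refine h.2.2 ⟨m, h1, h2, ?_⟩
  simpa using h3.reflect r

/-! ### Orbits of words and classes of polygons. -/

/-- Sporadic words up to shifts and reflections. -/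
def wordSetoid (n : ℕ) : Setoid {ε : ℤ → Bool // IsSporadicWord n ε} where
  r ε ε' := WordEquiv ε.1 ε'.1
  iseqv :=
    { refl := fun _ => ⟨0, Or.inl fun _ => by simp⟩
      symm := by
        rintro ε ε' ⟨r, h | h⟩
        · exact ⟨-r, Or.inl fun j => by simp [h]⟩
        · exact ⟨r, Or.inr fun j => by simp [h]⟩
      trans := by
        rintro ε ε' ε'' ⟨r, h | h⟩ ⟨s, h' | h'⟩
        · exact ⟨s + r, Or.inl fun j => by rw [h', h, add_assoc]⟩
        · exact ⟨s + r, Or.inr fun j => by rw [h', h]; exact congrArg ε.1 (by ring)⟩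
        · exact ⟨r - s, Or.inr fun j => by rw [h', h]; exact congrArg ε.1 (by ring)⟩
        · exact ⟨r - s, Or.inl fun j => by rw [h', h]; exact congrArg ε.1 (by ring)⟩ }

/-- By hypothesis the dihedral group of order `4 n`, formed by shifts modulo `2 n` and reflections,
acts freely, so every class has `4 n` elements. -/
theorem card_words {n : ℕ} (hn : n ≠ 0)
    (hshift : ∀ ε, IsSporadicWord n ε → ∀ r : ℤ, (∀ j, ε (j + r) = ε j) →
      ((2 * n : ℕ) : ℤ) ∣ r)
    (hrefl : ∀ ε, IsSporadicWord n ε → ∀ r : ℤ, ¬ ∀ j, ε (r - j) = ε j) :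
    Nat.card {ε // IsSporadicWord n ε} = Nat.card (Quotient (wordSetoid n)) * (2 * n * 2) := by
  -- A chosen representative of each class is moved by all shifts (`true`) and all reflections
  -- (`false`).
  let Φ : Quotient (wordSetoid n) × (Fin (2 * n) × Bool) → {ε // IsSporadicWord n ε} := fun x =>
    bif x.2.2 then ⟨fun j => x.1.out.1 (j + (x.2.1 : ℕ)), x.1.out.2.shift hn _⟩
      else ⟨fun j => x.1.out.1 ((x.2.1 : ℕ) - j), x.1.out.2.reflect hn _⟩
  have hmk : ∀ x, Quotient.mk (wordSetoid n) (Φ x) = x.1 := by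
    rintro ⟨Q, r, σ⟩
    conv_rhs => rw [← Q.out_eq]
    apply Quotient.sound
    refine Setoid.symm' _ ?_
    cases σ
    · exact ⟨((r : ℕ) : ℤ), Or.inr fun j => rfl⟩
    · exact ⟨((r : ℕ) : ℤ), Or.inl fun j => rfl⟩
  have hfin : ∀ r s : Fin (2 * n), ((2 * n : ℕ) : ℤ) ∣ ((r : ℕ) : ℤ) - (s : ℕ) → r = s := by
    intro r s h
    apply Fin.ext
    have h1 : ((s : ℕ) : ℤ) ≡ (r : ℕ) [ZMOD (2 * n : ℕ)] := Int.modEq_iff_dvd.2 h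
    rw [Int.natCast_modEq_iff] at h1
    exact (h1.eq_of_lt_of_lt s.2 r.2).symm
  have hinj : Function.Injective Φ := by
    rintro ⟨Q, r, σ⟩ ⟨Q', r', σ'⟩ h
    have h1 := congrArg (Quotient.mk (wordSetoid n)) h
    rw [hmk, hmk] at h1
    obtain rfl : Q = Q' := h1
    have h2 := fun j => congrFun (congrArg Subtype.val h) j
    have hQ := Q.out.2
    rcases σ with _ | _ <;> rcases σ' with _ | _
    · have h3 : ∀ j, Q.out.1 ((r : ℕ) - j) = Q.out.1 ((r' : ℕ) - j) := h2
      have : r = r' := by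
        refine hfin _ _ (hshift _ hQ _ fun j => ?_)
        have := h3 ((r' : ℕ) - j)
        rw [sub_sub_cancel] at this
        rw [← this]; exact congrArg Q.out.1 (by ring)
      rw [this]
    · have h3 : ∀ j, Q.out.1 ((r : ℕ) - j) = Q.out.1 (j + (r' : ℕ)) := h2
      refine (hrefl _ hQ ((r : ℕ) + (r' : ℕ)) fun j => ?_).elim
      have := h3 (j - (r' : ℕ))
      rw [sub_add_cancel] at this
      rw [← this]; exact congrArg Q.out.1 (by ring)
    · have h3 : ∀ j, Q.out.1 (j + (r : ℕ)) = Q.out.1 ((r' : ℕ) - j) := h2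
      refine (hrefl _ hQ ((r : ℕ) + (r' : ℕ)) fun j => ?_).elim
      have := h3 (j - (r : ℕ))
      rw [sub_add_cancel] at this
      rw [this]; exact congrArg Q.out.1 (by ring)
    · have h3 : ∀ j, Q.out.1 (j + (r : ℕ)) = Q.out.1 (j + (r' : ℕ)) := h2
      have : r = r' := by
        refine hfin _ _ (hshift _ hQ _ fun j => ?_)
        have := h3 (j - (r' : ℕ))
        rw [sub_add_cancel] at this
        rw [← this]; exact congrArg Q.out.1 (by ring)
      rw [this]
  have hsurj : Function.Surjective Φ := by
    intro ε
    set Q := Quotient.mk (wordSetoid n) ε with hQ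
    obtain ⟨r, hr⟩ : WordEquiv Q.out.1 ε.1 := Quotient.exact (Q.out_eq.trans hQ)
    have hN : (0 : ℤ) < (2 * n : ℕ) := by omega
    have h0 := Int.emod_nonneg r hN.ne'
    have hlt := Int.emod_lt_of_pos r hN
    have hd := Int.emod_add_mul_ediv r (2 * n : ℕ)
    have hper := Q.out.2.1.add_int_mul
    have hcast : (((r % (2 * n : ℕ)).toNat : ℕ) : ℤ) = r % (2 * n : ℕ) := Int.toNat_of_nonneg h0
    rcases hr with hr | hr
    · refine ⟨(Q, ⟨(r % (2 * n : ℕ)).toNat, by omega⟩, true), Subtype.ext (funext fun j => ?_)⟩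
      change Q.out.1 (j + ((r % (2 * n : ℕ)).toNat : ℕ)) = ε.1 j
      rw [hr, hcast, ← hper _ (r / (2 * n : ℕ))]
      exact congrArg Q.out.1 (by push_cast at hd ⊢; linarith)
    · refine ⟨(Q, ⟨(r % (2 * n : ℕ)).toNat, by omega⟩, false), Subtype.ext (funext fun j => ?_)⟩
      change Q.out.1 (((r % (2 * n : ℕ)).toNat : ℕ) - j) = ε.1 j
      rw [hr, hcast, ← hper _ (r / (2 * n : ℕ))]
      exact congrArg Q.out.1 (by push_cast at hd ⊢; linarith)
  rw [← Nat.card_eq_of_bijective Φ ⟨hinj, hsurj⟩]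
  simp [Nat.card_prod]

/-- Each sporadic word is sent to the polygon of a path with `l = 1`. Similarity of polygons matches
equivalence of words, and every sporadic polygon is similar to one obtained from its own word. -/
theorem E₁_eq_card_words {n : ℕ} (hn : 3 ≤ n) : E₁ n = Nat.card (Quotient (wordSetoid n)) := by
  have hn0 : n ≠ 0 := by omega
  choose A hA using fun ε : {ε // IsSporadicWord n ε} => ε.2.exists_isPath hn0
  have hr := fun ε => (hA ε).range_pathPolygon hn0 ε.2.1
  have hRe := fun ε => (hA ε).isReinhardtPolygon hn ε.2.1 one_ne_zero
  have hSp : ∀ ε, IsSporadicReinhardt (pathPolygon n ε.1 (A ε)) := fun ε => ⟨hRe ε, by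
    rw [(hA ε).isPeriodicReinhardt_iff hn0 ε.2.1 one_ne_zero (hr ε) (hRe ε)]
    exact ε.2.2.2⟩
  let F : {ε // IsSporadicWord n ε} → {P : Polygon ℂ n // IsSporadicReinhardt P} :=
    fun ε => ⟨_, hSp ε⟩
  have hF : ∀ ε ε', (sporadicSetoid n).r (F ε) (F ε') ↔ (wordSetoid n).r ε ε' := by
    intro ε ε'
    have := (hA ε).exists_dilationEquiv_iff hn0 ε.2.1 (hA ε') ε'.2.1 one_ne_zero one_ne_zero
    rw [← hr, ← hr] at this
    exact this
  have hmap : ∀ ε ε', (wordSetoid n).r ε ε' → (sporadicSetoid n).r (F ε) (F ε') :=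
    fun ε ε' => (hF ε ε').2
  symm
  refine Nat.card_eq_of_bijective (Quotient.map' F hmap) ⟨?_, ?_⟩
  · intro x y
    induction x using Quotient.inductionOn
    induction y using Quotient.inductionOn
    intro h
    exact Quotient.sound ((hF _ _).1 (Quotient.exact h))
  · intro y
    induction y using Quotient.inductionOn with | _ P
    obtain ⟨P, hP, hnp⟩ := P
    obtain ⟨ε, l, B, hε, hl, hB, hPB⟩ := hP.exists_isPath
    have hsp : IsSporadicWord n ε := ⟨hε, hB.sum_dir_eq_zero hl, by
      rwa [← hB.isPeriodicReinhardt_iff hn0 hε hl hPB hP]⟩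
    refine ⟨Quotient.mk _ ⟨ε, hsp⟩, Quotient.sound ?_⟩
    obtain ⟨f, hf⟩ := ((hA ⟨ε, hsp⟩).exists_dilationEquiv_iff hn0 hε hB hε one_ne_zero hl).2
      ⟨0, Or.inl fun _ => by simp⟩
    refine ⟨f, ?_⟩
    rw [hPB, ← hf]
    congr 1
    exact hr ⟨ε, hsp⟩

end Reinhardt

theorem mainTheorem2 (p q : ℕ) (hp : p.Prime) (hq : q.Prime) (hp2 : Odd p) (hq2 : Odd q)
    (hpq : p ≠ q) :
    (Reinhardt.E₁ (2 * p * q) : ℚ) =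
      ((2 ^ (p - 1) - 1) * (2 ^ (q - 1) - 1)) / ((p : ℚ) * q) := by
  have hp0 := hp.two_le
  have hq0 := hq.two_le
  have hn : 3 ≤ 2 * p * q := by nlinarith
  have h1 := Reinhardt.card_words (n := 2 * p * q) (by omega)
    (fun ε hε r hr => (hε.exists_isMixed hp hq hp2 hq2 hpq).elim
      (fun h => h.dvd_of_shift hp hq hp2 hq2 hpq hr) (fun h => h.dvd_of_shift hp hq hp2 hq2 hpq hr))
    (fun ε hε r hr => (hε.exists_isMixed hp hq hp2 hq2 hpq).elim
      (fun h => h.not_reflect hp hq hp2 hq2 hpq hr) (fun h => h.not_reflect hp hq hp2 hq2 hpq hr))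
  have h2 := Reinhardt.ncard_isSporadicWord hp hq hp2 hq2 hpq
  rw [← Nat.card_coe_set_eq] at h2
  have h3 := h1.symm.trans h2
  rw [← Reinhardt.E₁_eq_card_words hn] at h3
  have hpow : ∀ m : ℕ, 2 ≤ m → ((2 ^ m - 2 : ℕ) : ℚ) = 2 * (2 ^ (m - 1) - 1) := by
    intro m hm
    have : 2 ≤ 2 ^ m := by
      calc 2 = 2 ^ 1 := rfl
        _ ≤ 2 ^ m := Nat.pow_le_pow_right (by norm_num) (by omega)
    rw [Nat.cast_sub this]
    obtain ⟨k, rfl⟩ : ∃ k, m = k + 1 := ⟨m - 1, by omega⟩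
    push_cast
    ring
  have h4 : ((Reinhardt.E₁ (2 * p * q) * (2 * (2 * p * q) * 2) : ℕ) : ℚ) =
      ((2 * ((2 ^ p - 2) * (2 ^ q - 2)) : ℕ) : ℚ) := by rw [h3]
  rw [Nat.cast_mul 2, Nat.cast_mul (2 ^ p - 2), hpow p hp0, hpow q hq0] at h4
  push_cast at h4
  have hpQ : (p : ℚ) ≠ 0 := by exact_mod_cast hp.ne_zero
  have hqQ : (q : ℚ) ≠ 0 := by exact_mod_cast hq.ne_zero
  rw [eq_div_iff (mul_ne_zero hpQ hqQ)]
  -- The factor `8` arises on the left from the `4 n = 8pq` elements of each orbit, on the right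
  -- from the two positions of the subwords and a factor `2` in each `2 ^ m - 2`.
  linear_combination h4 / 8
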